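/- \textbf{Setting.} A \emph{twisted $n$-gon} is a sequence $A=(A_i)$ of points of the real projective plane, indexed by $\mathbb Z$ or by $\frac12+\mathbb Z$, such that $A_{i+n}=\phi(A_i)$ for all $i$ and some projective transformation $\phi$, and such that every four consecutive points are in general position. Let $\mathcal P_n$ (resp. $\mathcal P_n^*$) be the space of twisted $n$-gons indexed by $\mathbb Z$ (resp. $\frac12+\mathbb Z$) modulo projective equivalence. The pentagram map $T$ sends $A$ to the polygon $B$ with $B_i=\overline{A_{i-\frac32}A_{i+\frac12}}\cap\overline{A_{i-\frac12}A_{i+\frac32}}$; it interchanges the two index sets. For points on a projective line put $\chi(a,b,c,d)=[b,a,c,d]$, where $[a,b,c,d]=\frac{(a-b)(c-d)}{(b-c)(d-a)}$. For each index $k$ of $A$ let $x_{2k}(A)=\chi(A_{k-2},A_{k-1},B,D)$ and $x_{2k+1}(A)=\chi(A_{k+2},A_{k+1},C,D)$, where $B=\overline{A_{k-2}A_{k-1}}\cap\overline{A_kA_{k+1}}$, $C=\overline{A_{k-1}A_k}\cap\overline{A_{k+1}A_{k+2}}$, $D=\overline{A_{k-2}A_{k-1}}\cap\overline{A_{k+1}A_{k+2}}$.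 Then $x_{j+2n}=x_j$, and $x_1,\dots,x_{2n}$ are coordinates on $\mathcal P_n$ and on $\mathcal P_n^*$. Let $y_j=-(x_jx_{j+1})^{-1}$ if $\frac j2$ is an index of $A$, and $y_j=-x_jx_{j+1}$ otherwise. For a set $S$ contained in the index set of the polygons let $X_S$ be the set of $A$ with $y_{2j}(A)=-1$ for all $j\in S$; for a set $S$ contained in the other one of $\mathbb Z$, $\frac12+\mathbb Z$ let $Y_S$ be the set of $A$ with $y_{2j}(A)=-1$ for all $j\in S$. The iterate $T^k$ is regarded as a rational map between the spaces $\mathcal P_n,\mathcal P_n^*$. It is \emph{nonsingular} at $A$ if each coordinate $x_j\circ T^k$ is given by a rational function of the coordinates with denominator nonzero at $A$, and the values of these functions at $A$ are the coordinates of a twisted polygon, denoted $T^k(A)$; otherwise $T^k$ is \emph{singular} at $A$. A property holds at generic $A\in X$ if it holds on a relatively Zariski open, Zariski dense subset of $X$. For $a\le b$ with $b-a\in d\mathbb Z$ let $[a,b]_d=\{a,a+d,a+2d,\dots,b\}$. \textbf{Theorem.} Let $i,m\in\mathbb Z$ with $1\le m<\frac n3-1$, and let $$S=[i-(m-1),\,i+(m-1)]_2,\qquad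 S'=\left[i-\tfrac12(m-1),\,i+\tfrac12(m-1)\right]_1 .$$ Let $X_{S'}$ be taken in $\mathcal P_n$ if $m$ is odd and in $\mathcal P_n^*$ if $m$ is even. Then: \begin{enumerate} \item for $1\le k\le m+1$, $T^k$ is singular at every $A\in X_{S'}$; \item $T^{m+2}$ is nonsingular at generic $A\in X_{S'}$; \item for every $A\in X_{S'}$ at which $T^{m+2}$ is nonsingular, $T^{m+2}(A)\in Y_S$. \end{enumerate} -/

import Mathlib

open scoped LinearAlgebra.Projectivization

noncomputable section

namespace Pentagram

/-! ### The real projective plane -/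

/-- The real projective plane. -/
abbrev Plane : Type := ℙ ℝ (Fin 3 → ℝ)

/-- Linear automorphisms of `ℝ³`; they act on `Plane` as the projective transformations. -/
abbrev ProjTrans : Type := (Fin 3 → ℝ) ≃ₗ[ℝ] (Fin 3 → ℝ)

/-- The line through two (distinct) points, as a linear subspace of `ℝ³`. -/
def join (p q : Plane) : Submodule ℝ (Fin 3 → ℝ) := p.submodule ⊔ q.submodule

/-- The intersection point of two (distinct) lines. -/
def meet (L M : Submodule ℝ (Fin 3 → ℝ)) : Plane :=
  Classical.epsilon fun p : Plane => p.submodule = L ⊓ M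

/-- Four points are in general position: no three of them are collinear. -/
def GenPos (p q r s : Plane) : Prop :=
  Projectivization.Independent ![p, q, r] ∧ Projectivization.Independent ![p, q, s] ∧
    Projectivization.Independent ![p, r, s] ∧ Projectivization.Independent ![q, r, s]

/-! ### Cross ratios -/

/-- The `2 × 2` determinant; for `u = (a, 1)` and `v = (b, 1)` it is `a - b`. -/
def det₂ (u v : Fin 2 → ℝ) : ℝ := u 0 * v 1 - u 1 * v 0

/-- The cross ratio `(a-b)(c-d) / ((b-c)(d-a))` on the projective line, in homogeneous
coordinates. -/
def crossRatioVec (a b c d : Fin 2 → ℝ) : ℝ :=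
  (det₂ a b * det₂ c d) / (det₂ b c * det₂ d a)

/-- `f` restricts to homogeneous coordinates on a projective line through the four points. -/
def IsLineChart (f : (Fin 3 → ℝ) →ₗ[ℝ] (Fin 2 → ℝ)) (p q r s : Plane) : Prop :=
  Disjoint (LinearMap.ker f) (p.submodule ⊔ q.submodule ⊔ r.submodule ⊔ s.submodule)

open Classical in
/-- The cross ratio `[p, q, r, s]` of four collinear points of the plane: it is computed in any
homogeneous coordinates on their line (see `crossRatio_eq` for the independence of the choice). -/
def crossRatio (p q r s : Plane) : ℝ :=
  if h : ∃ f, IsLineChart f p q r s then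
    crossRatioVec (h.choose p.rep) (h.choose q.rep) (h.choose r.rep) (h.choose s.rep)
  else 0

/-- The reordered cross ratio `χ(a, b, c, d) = [b, a, c, d]`. -/
def chi (a b c d : Plane) : ℝ := crossRatio b a c d

theorem det₂_map (h : (Fin 2 → ℝ) →ₗ[ℝ] (Fin 2 → ℝ)) :
    ∃ l : ℝ, ∀ u v, det₂ (h u) (h v) = l * det₂ u v := by
  refine ⟨h (Pi.single 0 1) 0 * h (Pi.single 1 1) 1 - h (Pi.single 0 1) 1 * h (Pi.single 1 1) 0, ?_⟩
  intro u v
  have key : ∀ w : Fin 2 → ℝ, ∀ i, h w i = w 0 * h (Pi.single 0 1) i + w 1 * h (Pi.single 1 1) i := by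
    intro w i
    have hw : w = w 0 • (Pi.single 0 1 : Fin 2 → ℝ) + w 1 • (Pi.single 1 1 : Fin 2 → ℝ) := by
      ext j; fin_cases j <;> simp
    conv_lhs => rw [hw]
    simp
  simp only [det₂, key u, key v]
  ring

theorem det₂_chart (W : Submodule ℝ (Fin 3 → ℝ)) (f g : (Fin 3 → ℝ) →ₗ[ℝ] (Fin 2 → ℝ))
    (hf : Disjoint (LinearMap.ker f) W) :
    ∃ l : ℝ, ∀ u ∈ W, ∀ v ∈ W, det₂ (g u) (g v) = l * det₂ (f u) (f v) := by
  have hinj : LinearMap.ker (f.domRestrict W) = ⊥ := by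
    rw [LinearMap.ker_eq_bot']
    intro w hw
    have : (w : Fin 3 → ℝ) ∈ LinearMap.ker f ⊓ W := ⟨by simpa using hw, w.2⟩
    rw [hf.eq_bot] at this
    exact Subtype.ext (by simpa using this)
  obtain ⟨s, hs⟩ := LinearMap.exists_leftInverse_of_injective _ hinj
  obtain ⟨l, hl⟩ := det₂_map ((g.domRestrict W).comp s)
  refine ⟨l, fun u hu v hv => ?_⟩
  have e : ∀ w (hw : w ∈ W), ((g.domRestrict W).comp s) (f w) = g w := by
    intro w hw
    have := LinearMap.congr_fun hs ⟨w, hw⟩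
    simp only [LinearMap.comp_apply, LinearMap.domRestrict_apply, LinearMap.id_apply] at this
    simp [this]
  rw [← hl, e u hu, e v hv]

theorem crossRatioVec_smul (a b c d : Fin 2 → ℝ) {s t u v : ℝ} (hs : s ≠ 0) (ht : t ≠ 0)
    (hu : u ≠ 0) (hv : v ≠ 0) :
    crossRatioVec (s • a) (t • b) (u • c) (v • d) = crossRatioVec a b c d := by
  have h : s * t * u * v ≠ 0 := by positivity
  rw [crossRatioVec, crossRatioVec, ← mul_div_mul_left (det₂ a b * _) _ h]
  simp only [det₂, Pi.smul_apply, smul_eq_mul]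
  congr 1 <;> ring

/-- The cross ratio does not depend on the chart of the line and on the representatives. -/
theorem crossRatio_eq {p q r s : Plane} {f : (Fin 3 → ℝ) →ₗ[ℝ] (Fin 2 → ℝ)}
    (hf : IsLineChart f p q r s) {a b c d : Fin 3 → ℝ} (ha : a ≠ 0) (hb : b ≠ 0) (hc : c ≠ 0)
    (hd : d ≠ 0) (hp : p = Projectivization.mk ℝ a ha) (hq : q = Projectivization.mk ℝ b hb)
    (hr : r = Projectivization.mk ℝ c hc) (hs : s = Projectivization.mk ℝ d hd) :
    crossRatio p q r s = crossRatioVec (f a) (f b) (f c) (f d) := by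
  have hex : ∃ f, IsLineChart f p q r s := ⟨f, hf⟩
  rw [crossRatio, dif_pos hex]
  have hg := hex.choose_spec
  generalize hex.choose = g at hg
  have hrep : ∀ (x : Plane) (v : Fin 3 → ℝ) (hv : v ≠ 0), x = Projectivization.mk ℝ v hv →
      ∃ t : ℝ, t ≠ 0 ∧ x.rep = t • v := by
    intro x v hv hx
    have h1 : Projectivization.mk ℝ x.rep x.rep_nonzero = Projectivization.mk ℝ v hv := by
      rw [Projectivization.mk_rep, hx]
    obtain ⟨t, ht⟩ := (Projectivization.mk_eq_mk_iff ℝ _ _ _ _).1 h1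
    exact ⟨(t : ℝ), t.ne_zero, ht.symm⟩
  have hmem : ∀ (x : Plane) (v : Fin 3 → ℝ) (hv : v ≠ 0), x = Projectivization.mk ℝ v hv →
      v ∈ x.submodule := by
    intro x v hv hx
    rw [hx, Projectivization.submodule_mk]
    exact Submodule.mem_span_singleton_self v
  obtain ⟨t1, h1, e1⟩ := hrep p a ha hp
  obtain ⟨t2, h2, e2⟩ := hrep q b hb hq
  obtain ⟨t3, h3, e3⟩ := hrep r c hc hr
  obtain ⟨t4, h4, e4⟩ := hrep s d hd hs
  rw [e1, e2, e3, e4, map_smul, map_smul, map_smul, map_smul, crossRatioVec_smul _ _ _ _ h1 h2 h3 h4]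
  have wa : a ∈ p.submodule ⊔ q.submodule ⊔ r.submodule ⊔ s.submodule :=
    Submodule.mem_sup_left (Submodule.mem_sup_left (Submodule.mem_sup_left (hmem p a ha hp)))
  have wb : b ∈ p.submodule ⊔ q.submodule ⊔ r.submodule ⊔ s.submodule :=
    Submodule.mem_sup_left (Submodule.mem_sup_left (Submodule.mem_sup_right (hmem q b hb hq)))
  have wc : c ∈ p.submodule ⊔ q.submodule ⊔ r.submodule ⊔ s.submodule :=
    Submodule.mem_sup_left (Submodule.mem_sup_right (hmem r c hc hr))
  have wd : d ∈ p.submodule ⊔ q.submodule ⊔ r.submodule ⊔ s.submodule :=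
    Submodule.mem_sup_right (hmem s d hd hs)
  obtain ⟨l, hl⟩ := det₂_chart _ f g hf
  obtain ⟨l', hl'⟩ := det₂_chart _ g f hg
  unfold crossRatioVec
  by_cases h0 : l = 0
  · rw [hl' a wa b wb, hl' b wb c wc, hl a wa b wb, hl b wb c wc, h0]
    simp
  · rw [hl a wa b wb, hl b wb c wc, hl c wc d wd, hl d wd a wa,
      ← mul_div_mul_left (det₂ (f a) (f b) * _) _ (mul_ne_zero h0 h0)]
    congr 1 <;> ring

theorem submodule_smul (ψ : ProjTrans) (p : Plane) :
    (ψ • p).submodule = p.submodule.map (ψ : (Fin 3 → ℝ) →ₗ[ℝ] (Fin 3 → ℝ)) := by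
  induction p using Projectivization.ind with
  | h v hv =>
    rw [Projectivization.smul_mk, Projectivization.submodule_mk, Projectivization.submodule_mk,
      Submodule.map_span, Set.image_singleton]
    rfl

theorem crossRatio_smul (ψ : ProjTrans) (p q r s : Plane) :
    crossRatio (ψ • p) (ψ • q) (ψ • r) (ψ • s) = crossRatio p q r s := by
  have fwd : ∀ (ψ : ProjTrans) (p q r s : Plane) f, IsLineChart f p q r s →
      IsLineChart (f.comp (ψ.symm : (Fin 3 → ℝ) →ₗ[ℝ] (Fin 3 → ℝ)))
        (ψ • p) (ψ • q) (ψ • r) (ψ • s) := by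
    intro ψ p q r s f hf
    unfold IsLineChart at hf ⊢
    simp only [submodule_smul, ← Submodule.map_sup]
    rw [Submodule.disjoint_def] at hf ⊢
    rintro x hx ⟨w, hw, rfl⟩
    have : w = 0 := hf w (by simpa using hx) hw
    simp [this]
  by_cases h : ∃ f, IsLineChart f p q r s
  · obtain ⟨f, hf⟩ := h
    have hm : ∀ x : Plane, ψ • x = Projectivization.mk ℝ (ψ x.rep)
        ((LinearEquiv.map_ne_zero_iff ψ).2 x.rep_nonzero) := by
      intro x
      conv_lhs => rw [← x.mk_rep]
      rw [Projectivization.smul_mk]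
      rfl
    rw [crossRatio_eq (fwd ψ p q r s f hf) _ _ _ _ (hm p) (hm q) (hm r) (hm s),
      crossRatio_eq hf p.rep_nonzero q.rep_nonzero r.rep_nonzero s.rep_nonzero
        p.mk_rep.symm q.mk_rep.symm r.mk_rep.symm s.mk_rep.symm]
    simp
  · have h' : ¬ ∃ f, IsLineChart f (ψ • p) (ψ • q) (ψ • r) (ψ • s) := by
      rintro ⟨f, hf⟩
      have := fwd ψ⁻¹ _ _ _ _ f hf
      simp only [inv_smul_smul] at this
      exact h ⟨_, this⟩
    rw [crossRatio, crossRatio, dif_neg h, dif_neg h']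

/-! ### Twisted polygons

A polygon indexed by `ℤ` or by `1/2 + ℤ` is stored as a sequence indexed by `ℤ`, together with an
integer label `c` that is carried separately: the entry with number `i` is the vertex whose index
is `i + c/2`. So the index set is `ℤ` when `c` is even and `1/2 + ℤ` when `c` is odd. -/

/-- Twisted `n`-gons. -/
structure TwistedPolygon (n : ℕ) where
  vertex : ℤ → Plane
  twisted : ∃ φ : ProjTrans, ∀ i, vertex (i + n) = φ • vertex i
  genPos : ∀ i, GenPos (vertex i) (vertex (i + 1)) (vertex (i + 2)) (vertex (i + 3))

/-- Projective equivalence of twisted polygons. -/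
instance twistedSetoid (n : ℕ) : Setoid (TwistedPolygon n) where
  r A B := ∃ ψ : ProjTrans, ∀ i, ψ • A.vertex i = B.vertex i
  iseqv :=
    { refl := fun A => ⟨1, fun i => one_smul _ _⟩
      symm := by
        rintro A B ⟨ψ, h⟩
        exact ⟨ψ⁻¹, fun i => by rw [← h i, inv_smul_smul]⟩
      trans := by
        rintro A B C ⟨ψ, h⟩ ⟨ψ', h'⟩
        exact ⟨ψ' * ψ, fun i => by rw [mul_smul, h i, h' i]⟩ }

/-- The space of twisted `n`-gons modulo projective equivalence. With an even label it is
`𝒫ₙ` (polygons indexed by `ℤ`), with an odd label it is `𝒫ₙ*` (polygons indexed by `1/2 + ℤ`). -/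
abbrev PolygonSpace (n : ℕ) : Type := Quotient (twistedSetoid n)

/-! ### The coordinates -/

/-- `x_{2k}`, where `k` is the index of the `i`-th entry. -/
def xFirst (v : ℤ → Plane) (i : ℤ) : ℝ :=
  chi (v (i - 2)) (v (i - 1))
    (meet (join (v (i - 2)) (v (i - 1))) (join (v i) (v (i + 1))))
    (meet (join (v (i - 2)) (v (i - 1))) (join (v (i + 1)) (v (i + 2))))

/-- `x_{2k+1}`, where `k` is the index of the `i`-th entry. -/
def xSecond (v : ℤ → Plane) (i : ℤ) : ℝ :=
  chi (v (i + 2)) (v (i + 1))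
    (meet (join (v (i - 1)) (v i)) (join (v (i + 1)) (v (i + 2))))
    (meet (join (v (i - 2)) (v (i - 1))) (join (v (i + 1)) (v (i + 2))))

/-- The coordinate `x_a` of a sequence of points with label `c`: the index of the `i`-th entry is
`k = i + c/2`, so that `2k = 2i + c`. -/
def xSeq (c : ℤ) (v : ℤ → Plane) (a : ℤ) : ℝ :=
  if Even (a - c) then xFirst v ((a - c) / 2) else xSecond v ((a - c - 1) / 2)

theorem join_smul (ψ : ProjTrans) (p q : Plane) :
    join (ψ • p) (ψ • q) = (join p q).map (ψ : (Fin 3 → ℝ) →ₗ[ℝ] (Fin 3 → ℝ)) := by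
  rw [join, join, submodule_smul, submodule_smul, Submodule.map_sup]

/-- The lines `L` and `M` have exactly one point in common. -/
def Meets (L M : Submodule ℝ (Fin 3 → ℝ)) : Prop := ∃ p : Plane, p.submodule = L ⊓ M

theorem meet_eq {L M : Submodule ℝ (Fin 3 → ℝ)} {p : Plane} (h : p.submodule = L ⊓ M) :
    meet L M = p := by
  have := Classical.epsilon_spec (p := fun p : Plane => p.submodule = L ⊓ M) ⟨p, h⟩
  exact Projectivization.submodule_injective (this.trans h.symm)

theorem meet_map {L M : Submodule ℝ (Fin 3 → ℝ)} (h : Meets L M) (ψ : ProjTrans) :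
    meet (L.map (ψ : (Fin 3 → ℝ) →ₗ[ℝ] (Fin 3 → ℝ)))
      (M.map (ψ : (Fin 3 → ℝ) →ₗ[ℝ] (Fin 3 → ℝ))) = ψ • meet L M := by
  obtain ⟨p, hp⟩ := h
  rw [meet_eq hp]
  apply meet_eq
  rw [submodule_smul, hp, Submodule.map_inf _ ψ.injective]

theorem finrank_join {p q : Plane} (h : p ≠ q) : Module.finrank ℝ (join p q) = 2 := by
  have hl := Projectivization.independent_iff.1 ((Projectivization.independent_pair_iff_ne p q).2 h)
  have e : join p q = Submodule.span ℝ (Set.range (Projectivization.rep ∘ ![p, q])) := by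
    rw [join, Projectivization.submodule_eq, Projectivization.submodule_eq, ← Submodule.span_union]
    congr 1
    ext x
    simp [Set.mem_range, eq_comm, or_comm]
  rw [e, finrank_span_eq_card hl]
  simp

theorem ne_of_independent {p q r : Plane} (h : Projectivization.Independent ![p, q, r]) :
    p ≠ q ∧ p ≠ r ∧ q ≠ r := by
  have hl := (Projectivization.independent_iff.1 h).injective
  refine ⟨fun e => ?_, fun e => ?_, fun e => ?_⟩
  · exact absurd (@hl 0 1 (by simp [e])) (by decide)
  · exact absurd (@hl 0 2 (by simp [e])) (by decide)
  · exact absurd (@hl 1 2 (by simp [e])) (by decide)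

theorem meets_join {p q r s : Plane} (h : Projectivization.Independent ![p, q, r])
    (hrs : r ≠ s) : Meets (join p q) (join r s) := by
  have hl := Projectivization.independent_iff.1 h
  have h3 : Submodule.span ℝ (Set.range (Projectivization.rep ∘ ![p, q, r])) ≤
      join p q ⊔ join r s := by
    rw [Submodule.span_le]
    have hm : ∀ x : Plane, x.rep ∈ x.submodule := fun x => by
      rw [Projectivization.submodule_eq]; exact Submodule.mem_span_singleton_self _
    rintro _ ⟨i, rfl⟩
    fin_cases i
    · exact Submodule.mem_sup_left (Submodule.mem_sup_left (hm p))
    · exact Submodule.mem_sup_left (Submodule.mem_sup_right (hm q))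
    · exact Submodule.mem_sup_right (Submodule.mem_sup_left (hm r))
  have h3' := Submodule.finrank_mono h3
  rw [finrank_span_eq_card hl] at h3'
  have hle := Submodule.finrank_le (join p q ⊔ join r s)
  have hsum := Submodule.finrank_sup_add_finrank_inf_eq (join p q) (join r s)
  rw [finrank_join (ne_of_independent h).1, finrank_join hrs] at hsum
  simp only [Fintype.card_fin, Module.finrank_fin_fun] at h3' hle
  have h1 : Module.finrank ℝ ↥(join p q ⊓ join r s) = 1 := by omega
  exact ⟨Projectivization.mk'' _ h1, Projectivization.submodule_mk'' _ h1⟩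

theorem meet_join_smul (ψ : ProjTrans) {p q r s : Plane}
    (h : Projectivization.Independent ![p, q, r]) (hrs : r ≠ s) :
    meet (join (ψ • p) (ψ • q)) (join (ψ • r) (ψ • s)) = ψ • meet (join p q) (join r s) := by
  rw [join_smul, join_smul, meet_map (meets_join h hrs)]

theorem TwistedPolygon.genPos' {n : ℕ} (A : TwistedPolygon n) (i : ℤ) :
    Projectivization.Independent ![A.vertex (i - 2), A.vertex (i - 1), A.vertex i] ∧
    Projectivization.Independent ![A.vertex (i - 2), A.vertex (i - 1), A.vertex (i + 1)] ∧
    Projectivization.Independent ![A.vertex (i - 1), A.vertex i, A.vertex (i + 1)] ∧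
    Projectivization.Independent ![A.vertex i, A.vertex (i + 1), A.vertex (i + 2)] := by
  have h1 := A.genPos (i - 2)
  have h2 := A.genPos (i - 1)
  have e1 : i - 2 + 1 = i - 1 := by ring
  have e2 : i - 2 + 2 = i := by ring
  have e3 : i - 2 + 3 = i + 1 := by ring
  have e4 : i - 1 + 1 = i := by ring
  have e5 : i - 1 + 2 = i + 1 := by ring
  have e6 : i - 1 + 3 = i + 2 := by ring
  rw [e1, e2, e3] at h1
  rw [e4, e5, e6] at h2
  exact ⟨h1.1, h1.2.1, h2.1, h2.2.2.2⟩

theorem xSeq_congr {n : ℕ} (c : ℤ) {A B : TwistedPolygon n} (h : A ≈ B) :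
    xSeq c A.vertex = xSeq c B.vertex := by
  obtain ⟨ψ, hψ⟩ := h
  have h1 : ∀ i, xFirst B.vertex i = xFirst A.vertex i := by
    intro i
    obtain ⟨g1, g2, g3, g4⟩ := A.genPos' i
    simp only [xFirst, chi, ← hψ]
    rw [meet_join_smul ψ g1 (ne_of_independent g4).1,
      meet_join_smul ψ g2 (ne_of_independent g4).2.2, crossRatio_smul]
  have h2 : ∀ i, xSecond B.vertex i = xSecond A.vertex i := by
    intro i
    obtain ⟨g1, g2, g3, g4⟩ := A.genPos' i
    simp only [xSecond, chi, ← hψ]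
    rw [meet_join_smul ψ g3 (ne_of_independent g4).2.2,
      meet_join_smul ψ g2 (ne_of_independent g4).2.2, crossRatio_smul]
  funext a
  simp only [xSeq, h1, h2]

/-- The coordinates `x_a` (`a ∈ ℤ`) on the space of twisted `n`-gons with label `c`. -/
def x {n : ℕ} (c : ℤ) (A : PolygonSpace n) : ℤ → ℝ :=
  Quotient.lift (fun A : TwistedPolygon n => xSeq c A.vertex) (fun _ _ h => xSeq_congr c h) A

/-- The `y`-parameters on the space of twisted `n`-gons with label `c`. For `c` even (on `𝒫ₙ`),
`y_a = -(x_a x_{a+1})⁻¹` for even `a` and `y_a = -x_a x_{a+1}` for odd `a`; for `c` odd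
(on `𝒫ₙ*`) the two cases are exchanged. -/
def y {n : ℕ} (c : ℤ) (A : PolygonSpace n) (a : ℤ) : ℝ :=
  if Even (a - c) then -(x c A a * x c A (a + 1))⁻¹ else -(x c A a * x c A (a + 1))

/-! ### The pentagram map and its iterates -/

/-- The pentagram map on sequences of points. If the input has label `c`, the output has label
`c + 1`: its entry `i` has index `j = i + (c + 1)/2`, and the four entries used have the indices
`j - 3/2`, `j + 1/2`, `j - 1/2`, `j + 3/2`. -/
def pentSeq (v : ℤ → Plane) (i : ℤ) : Plane :=
  meet (join (v (i - 1)) (v (i + 1))) (join (v i) (v (i + 2)))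

/-- `B = T(A)`; there is such a `B` exactly when the points constructed from `A` form a twisted
polygon again, i.e. when the consecutive quadruples of them are in general position. -/
def IsPent {n : ℕ} (A B : PolygonSpace n) : Prop :=
  ∃ A' B' : TwistedPolygon n, (⟦A'⟧ : PolygonSpace n) = A ∧ (⟦B'⟧ : PolygonSpace n) = B ∧
    B'.vertex = pentSeq A'.vertex

/-- `B` is obtained from `A` by applying the construction `T` successively `k` times. -/
def IsPentIter {n : ℕ} : ℕ → PolygonSpace n → PolygonSpace n → Prop
  | 0, A, B => A = B
  | k + 1, A, B => ∃ C, IsPentIter k A C ∧ IsPent C B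

/-- The rational map `T^k`, from the space with label `c` to the space with label `c + k`, is
nonsingular (regular) at `A`, with value `B`: each coordinate of `T^k` is given by a rational
function of the coordinates whose denominator does not vanish at `A`, and the values of these
functions at `A` are the coordinates of the twisted polygon `B`. As `x_{a+2n} = x_a`, polynomials
in the `x_a`, `a ∈ ℤ`, define the same functions as polynomials in `x_1, …, x_{2n}`. -/
def IsRegularWithValue {n : ℕ} (c : ℤ) (k : ℕ) (A B : PolygonSpace n) : Prop :=
  ∀ a : ℤ, ∃ p q : MvPolynomial ℤ ℝ,
    MvPolynomial.eval (x c A) q ≠ 0 ∧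
    (∀ A' B' : PolygonSpace n, IsPentIter k A' B' → MvPolynomial.eval (x c A') q ≠ 0 →
      x (c + k) B' a = MvPolynomial.eval (x c A') p / MvPolynomial.eval (x c A') q) ∧
    x (c + k) B a = MvPolynomial.eval (x c A) p / MvPolynomial.eval (x c A) q

/-- The rational map `T^k` is singular at `A`. -/
def IsSingularAt {n : ℕ} (c : ℤ) (k : ℕ) (A : PolygonSpace n) : Prop :=
  ¬ ∃ B, IsRegularWithValue c k A B

/-! ### Singularity types and genericity -/

/-- The arithmetic progression `[a, b]_d = {a, a + d, a + 2d, …, b}`. -/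
def progression (a b d : ℚ) : Set ℚ := {r | r ≤ b ∧ ∃ t : ℕ, r = a + t * d}

/-- For a set `S` of integers or of half-integers, the set of those `A` in the space with label
`c` such that `y_{2j}(A) = -1` for all `j ∈ S`. It is `X_S` if `S` lies in the index set
`c/2 + ℤ` of the polygons, and `Y_S` if `S` lies in the other one of `ℤ` and `1/2 + ℤ`. -/
def locus {n : ℕ} (c : ℤ) (S : Set ℚ) : Set (PolygonSpace n) :=
  {A | ∀ a : ℤ, (a : ℚ) / 2 ∈ S → y c A a = -1}

/-- `Q` holds at the generic point of `X`: it holds at all points of a Zariski dense, relatively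
Zariski open subset of `X`, cut out by the nonvanishing of a polynomial `g` in the coordinates. -/
def HoldsGenerically {n : ℕ} (c : ℤ) (X : Set (PolygonSpace n)) (Q : PolygonSpace n → Prop) :
    Prop :=
  ∃ g : MvPolynomial ℤ ℝ,
    (∀ A ∈ X, MvPolynomial.eval (x c A) g ≠ 0 → Q A) ∧
    ∀ f : MvPolynomial ℤ ℝ, (∃ A ∈ X, MvPolynomial.eval (x c A) f ≠ 0) →
      ∃ A ∈ X, MvPolynomial.eval (x c A) f ≠ 0 ∧ MvPolynomial.eval (x c A) g ≠ 0

end Pentagram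

end

/-! The iterates of the pentagram map are governed by an octahedron recurrence. Up to a monomial, a
coordinate of `T^k` is a quotient of products of values of the polynomials `octa` on the levels `k`
and `k + 1`, where the y-parameters of the initial polygon are substituted for the lattice variables
along `(a, b) ↦ 3a + b` (`iterNum`, `iterDen`, `pentStep_iter`). So the question is which of these
values vanish identically on `X_{S'}`.

Vanishing: if the variables on a line `a + b = const` crossing the support of `octa` are all `-1`,
then `octa` is zero (`eval_octa_eq_zero`). Neighbouring points of such a line go to indices that
differ by 2, and `S'` prescribes exactly a run of `m` indices with step 2. This gives zeros on the
levels `2, …, m + 1`. On level `m + 1` there is one zero at each index `2j`, `j ∈ S`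
(`octaVal_eq_zero_of_mem_level`).

Nonvanishing: on the levels `m + 2` and `m + 3` no value that occurs is identically zero on `X_{S'}`
(`neZeroOn_octaVal_of_level`). The bound on `m` makes the supports fit into one period, so that
periodicity imposes no relation between the variables.

Consequences: for `k ≤ m` some coordinate of `T^k` would have to vanish on `X_{S'}`, but coordinates
of polygons are never zero. For `k = m + 1` a denominator vanishes and its numerator does not. The
formula for `T^{m+2}` contains only the levels `m + 2` and `m + 3`, so this iterate is generically
regular again. For `a = 2j`, `j ∈ S`, the product `x_a x_{a+1}` of its coordinates is minus the
quotient of the two terms on the right of the recurrence for `octa (m + 3) · octa (m + 1)` at `a`.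
The left side is zero there, so the product is 1, which means `y_a = -1`.

Statements about every point of `X_{S'}` follow from generic ones because `X_{S'}` is a subtorus and
hence irreducible (`NeZeroOn.mul`), and because every admissible rational expression for a
coordinate agrees with `iterNum / iterDen` after cross-multiplication
(`IsRegularWithValue.exists_eval`). -/

open scoped LinearAlgebra.Projectivization

noncomputable section

namespace Pentagram

/-! ### Polynomial solutions of the octahedron recurrence -/

/-- Polynomials in variables attached to the points of the square lattice. -/
abbrev LatticePoly : Type := MvPolynomial (ℤ × ℤ) ℝ

/-- The product of the variables at the points `(a + i, b)`, `|i| ≤ k`. -/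
def ray : ℕ → ℤ → ℤ → LatticePoly
  | 0, a, b => MvPolynomial.X (a, b)
  | k + 1, a, b =>
    MvPolynomial.X (a - (k + 1), b) * ray k a b * MvPolynomial.X (a + (k + 1), b)

/-- This compatibility of the coefficients is what makes the divisions in the octahedron recurrence
exact; it enters `octa_dvd_aux` as the hypothesis `e₆`. -/
theorem ray_mul_ray (k : ℕ) (a b : ℤ) :
    ray (k + 1) (a - 1) b * ray (k + 1) (a + 1) b = ray (k + 2) a b * ray k a b := by
  induction k with
  | zero =>
    simp only [ray]
    push_cast
    ring_nf
  | succ k ih =>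
    rw [ray, ray.eq_2 (a + 1) b (k + 1), ray.eq_2 a b (k + 2), ray.eq_2 a b k]
    push_cast
    rw [show a - 1 - ((k : ℤ) + 1 + 1) = a - (k + 2 + 1) by ring,
      show a - 1 + ((k : ℤ) + 1 + 1) = a + (k + 1) by ring,
      show a + 1 - ((k : ℤ) + 1 + 1) = a - (k + 1) by ring,
      show a + 1 + ((k : ℤ) + 1 + 1) = a + (k + 2 + 1) by ring]
    linear_combination (MvPolynomial.X (a - ((k : ℤ) + 2 + 1), b) * MvPolynomial.X (a + ((k : ℤ) + 1), b) *
      MvPolynomial.X (a - ((k : ℤ) + 1), b) * MvPolynomial.X (a + ((k : ℤ) + 2 + 1), b)) * ih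

theorem map_ray_eq_zero {R : Type*} [CommRing R] (φ : LatticePoly →+* R) {k : ℕ} {a b a' : ℤ}
    (h₁ : a - k ≤ a') (h₂ : a' ≤ a + k) (h : φ (MvPolynomial.X (a', b)) = 0) :
    φ (ray k a b) = 0 := by
  induction k with
  | zero =>
    obtain rfl : a' = a := by simp at h₁ h₂; omega
    exact h
  | succ k ih =>
    rw [ray, map_mul, map_mul]
    push_cast at h₁ h₂
    rcases eq_or_ne a' (a - (k + 1)) with rfl | h₃
    · rw [h, zero_mul, zero_mul]
    rcases eq_or_ne a' (a + (k + 1)) with rfl | h₄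
    · rw [h, mul_zero]
    · rw [ih (by omega) (by omega), mul_zero, zero_mul]

/-- The right-hand side of the octahedron recurrence. -/
def octaRHS (f : ℤ → ℤ → LatticePoly) (k : ℕ) (a b : ℤ) : LatticePoly :=
  f (a - 1) b * f (a + 1) b + ray k a b * (f a (b - 1) * f a (b + 1))

open Classical in
/-- The solution of the octahedron recurrence with initial values `1`. That the division is
possible in each step is `octa_mul_octa`. -/
def octa : ℕ → ℤ → ℤ → LatticePoly
  | 0 => fun _ _ => 1
  | 1 => fun _ _ => 1
  | k + 2 => fun a b =>
    if h : octa k a b ∣ octaRHS (octa (k + 1)) k a b then h.choose else 0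

/-- The octahedron recurrence holds in the first `K` steps. -/
def OctaRec (K : ℕ) : Prop :=
  ∀ k < K, ∀ a b, octa (k + 2) a b * octa k a b = octaRHS (octa (k + 1)) k a b

theorem eval_zero_ray (k : ℕ) (a b : ℤ) : MvPolynomial.eval 0 (ray k a b) = 0 :=
  map_ray_eq_zero (MvPolynomial.eval 0) (a' := a) (by omega) (by omega) (by simp)

/-- The row monomials vanish at the origin, so the recurrence propagates the constant term 1.
Consequently `octa` is never zero and no variable divides it. -/
theorem OctaRec.eval_zero {K : ℕ} (H : OctaRec K) (k : ℕ) (hk : k ≤ K + 1) (a b : ℤ) :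
    MvPolynomial.eval 0 (octa k a b) = 1 := by
  induction k using Nat.twoStepInduction generalizing a b with
  | zero => simp [octa]
  | one => simp [octa]
  | more k ih₀ ih₁ =>
    have h := congrArg (MvPolynomial.eval 0) (H k (by omega) a b)
    rw [octaRHS, map_add, map_mul, map_mul, map_mul, eval_zero_ray, ih₀ (by omega), ih₁ (by omega),
      ih₁ (by omega)] at h
    simpa using h

theorem OctaRec.ne_zero {K : ℕ} (H : OctaRec K) (k : ℕ) (hk : k ≤ K + 1) (a b : ℤ) :
    octa k a b ≠ 0 := by
  intro h
  have := H.eval_zero k hk a b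
  rw [h, map_zero] at this
  exact zero_ne_one this

theorem degreeOf_ray {k : ℕ} {a b : ℤ} {v : ℤ × ℤ} (h : (k : ℤ) < |v.1 - a| + |v.2 - b|) :
    (ray k a b).degreeOf v = 0 := by
  have hX : ∀ a' : ℤ, a - k ≤ a' → a' ≤ a + k →
      MvPolynomial.degreeOf v (MvPolynomial.X (a', b) : LatticePoly) = 0 := by
    intro a' h₁ h₂
    refine MvPolynomial.degreeOf_X_of_ne ?_
    rintro rfl
    simp only [sub_self, abs_zero, add_zero] at h
    rw [lt_abs] at h
    omega
  induction k with
  | zero => exact hX a (by simp) (by simp)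
  | succ k ih =>
    push_cast at h hX
    rw [ray]
    have h₁ := hX (a - (k + 1)) (by omega) (by omega)
    have h₂ := hX (a + (k + 1)) (by omega) (by omega)
    have h₃ := ih (by omega) (fun a' _ _ => hX a' (by omega) (by omega))
    have := MvPolynomial.degreeOf_mul_le v
      (MvPolynomial.X (a - ((k : ℤ) + 1), b) * ray k a b) (MvPolynomial.X (a + ((k : ℤ) + 1), b))
    have := MvPolynomial.degreeOf_mul_le v
      (MvPolynomial.X (a - ((k : ℤ) + 1), b)) (ray k a b)
    omega

/-- Each step of the recurrence enlarges the support by one lattice step, and `ray k` reaches no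
further than distance `k`. Degrees add in products of nonzero polynomials, so a variable absent from
the right side is absent from the new factor on the left. -/
theorem OctaRec.degreeOf_eq_zero {K : ℕ} (H : OctaRec K) (k : ℕ) (hk : k ≤ K + 1) (a b : ℤ)
    (v : ℤ × ℤ) (h : (k : ℤ) - 1 ≤ |v.1 - a| + |v.2 - b|) : (octa k a b).degreeOf v = 0 := by
  induction k using Nat.twoStepInduction generalizing a b with
  | zero => simp [octa]
  | one => simp [octa]
  | more k ih₀ ih₁ =>
    have e := congrArg (MvPolynomial.degreeOf v) (H k (by omega) a b)
    rw [MvPolynomial.degreeOf_mul_eq (H.ne_zero _ hk a b) (H.ne_zero _ (by omega) a b)] at e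
    push_cast at h ih₁
    have h₁ := ih₁ (by omega) (a - 1) b (by simp only [abs_eq_max_neg] at h ⊢; omega)
    have h₂ := ih₁ (by omega) (a + 1) b (by simp only [abs_eq_max_neg] at h ⊢; omega)
    have h₃ := ih₁ (by omega) a (b - 1) (by simp only [abs_eq_max_neg] at h ⊢; omega)
    have h₄ := ih₁ (by omega) a (b + 1) (by simp only [abs_eq_max_neg] at h ⊢; omega)
    have h₅ := degreeOf_ray (k := k) (a := a) (b := b) (v := v) (by omega)
    have := MvPolynomial.degreeOf_add_le v
      (octa (k + 1) (a - 1) b * octa (k + 1) (a + 1) b)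
      (ray k a b * (octa (k + 1) a (b - 1) * octa (k + 1) a (b + 1)))
    have := MvPolynomial.degreeOf_mul_le v (octa (k + 1) (a - 1) b) (octa (k + 1) (a + 1) b)
    have := MvPolynomial.degreeOf_mul_le v (octa (k + 1) a (b - 1)) (octa (k + 1) a (b + 1))
    have := MvPolynomial.degreeOf_mul_le v (ray k a b)
      (octa (k + 1) a (b - 1) * octa (k + 1) a (b + 1))
    rw [octaRHS] at e
    omega

/-- Setting one variable to zero. -/
def kill (v : ℤ × ℤ) : LatticePoly →ₐ[ℝ] LatticePoly :=
  MvPolynomial.aeval fun w => if w = v then 0 else MvPolynomial.X w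

theorem kill_of_degreeOf {v : ℤ × ℤ} {p : LatticePoly} (h : p.degreeOf v = 0) : kill v p = p := by
  have hv : v ∉ p.vars := fun hv => MvPolynomial.mem_vars_iff_degreeOf_ne_zero.1 hv h
  have : (kill v : LatticePoly →+* LatticePoly) p = (RingHom.id _) p := by
    refine MvPolynomial.hom_congr_vars ?_ ?_ rfl
    · ext r
      simp [kill]
    · intro w hw _
      have : w ≠ v := by rintro rfl; exact hv hw
      simp [kill, this]
  exact this

theorem kill_X_self (v : ℤ × ℤ) : kill v (MvPolynomial.X v) = 0 := by simp [kill]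

theorem kill_ray {k : ℕ} {a b a' : ℤ} (h₁ : a - k ≤ a') (h₂ : a' ≤ a + k) :
    kill (a', b) (ray k a b) = 0 :=
  map_ray_eq_zero (kill (a', b) : LatticePoly →+* LatticePoly) h₁ h₂ (kill_X_self _)

/-- The extreme variable lies on the row, so the ray term dies. It is too far away to occur in the
other polynomials except one, which the induction hypothesis turns into the factor that can be
cancelled. -/
theorem OctaRec.kill_bot {K : ℕ} (H : OctaRec K) (q : ℕ) (hq : q + 2 ≤ K + 1) (a b : ℤ) :
    kill (a - q, b) (octa (q + 2) a b) = octa (q + 1) (a + 1) b := by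
  induction q generalizing a b with
  | zero =>
    have h := congrArg (kill (a, b)) (H 0 (by omega) a b)
    rw [octaRHS, map_add, map_mul _ (ray _ _ _), kill_ray (by simp) (by simp)] at h
    simpa [octa] using h
  | succ q ih =>
    have h := congrArg (kill (a - (q + 1), b)) (H (q + 1) (by omega) a b)
    have i₁ := ih (by omega) (a - 1) b
    rw [show a - 1 - (q : ℤ) = a - (q + 1) by ring, sub_add_cancel] at i₁
    have i₂ : kill (a - (q + 1), b) (octa (q + 1) a b) = octa (q + 1) a b :=
      kill_of_degreeOf (H.degreeOf_eq_zero _ (by omega) _ _ _ (by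
        push_cast; have := neg_abs_le (a - ((q : ℤ) + 1) - a); have := abs_nonneg (b - b); omega))
    have i₃ : kill (a - (q + 1), b) (octa (q + 2) (a + 1) b) = octa (q + 2) (a + 1) b :=
      kill_of_degreeOf (H.degreeOf_eq_zero _ (by omega) _ _ _ (by
        push_cast
        have := neg_abs_le (a - ((q : ℤ) + 1) - (a + 1)); have := abs_nonneg (b - b); omega))
    rw [octaRHS, map_add, map_mul _ (ray _ _ _),
      kill_ray (by push_cast; omega) (by push_cast; omega), map_mul, map_mul, i₂] at h
    rw [show q + 1 + 1 = q + 2 from rfl, i₁, i₃, zero_mul, add_zero] at h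
    push_cast
    exact mul_right_cancel₀ (H.ne_zero _ (by omega) a b) (h.trans (mul_comm _ _))

theorem OctaRec.kill_top {K : ℕ} (H : OctaRec K) (q : ℕ) (hq : q + 2 ≤ K + 1) (a b : ℤ) :
    kill (a + q, b) (octa (q + 2) a b) = octa (q + 1) (a - 1) b := by
  induction q generalizing a b with
  | zero =>
    have h := congrArg (kill (a, b)) (H 0 (by omega) a b)
    rw [octaRHS, map_add, map_mul _ (ray _ _ _), kill_ray (by simp) (by simp)] at h
    simpa [octa] using h
  | succ q ih =>
    have h := congrArg (kill (a + (q + 1), b)) (H (q + 1) (by omega) a b)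
    have i₁ := ih (by omega) (a + 1) b
    rw [show a + 1 + (q : ℤ) = a + (q + 1) by ring, add_sub_cancel_right] at i₁
    have i₂ : kill (a + (q + 1), b) (octa (q + 1) a b) = octa (q + 1) a b :=
      kill_of_degreeOf (H.degreeOf_eq_zero _ (by omega) _ _ _ (by
        push_cast; have := le_abs_self (a + ((q : ℤ) + 1) - a); have := abs_nonneg (b - b); omega))
    have i₃ : kill (a + (q + 1), b) (octa (q + 2) (a - 1) b) = octa (q + 2) (a - 1) b :=
      kill_of_degreeOf (H.degreeOf_eq_zero _ (by omega) _ _ _ (by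
        push_cast
        have := le_abs_self (a + ((q : ℤ) + 1) - (a - 1)); have := abs_nonneg (b - b); omega))
    rw [octaRHS, map_add, map_mul _ (ray _ _ _),
      kill_ray (by push_cast; omega) (by push_cast; omega), map_mul, map_mul, i₂] at h
    rw [show q + 1 + 1 = q + 2 from rfl, i₁, i₃, zero_mul, add_zero] at h
    push_cast
    exact mul_right_cancel₀ (H.ne_zero _ (by omega) a b) h

/-! ### Coprimality of neighbours and exactness of the division -/

theorem degreeOf_eq_zero_of_dvd {v : ℤ × ℤ} {d p : LatticePoly} (hp : p ≠ 0) (hd : d ∣ p)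
    (h : p.degreeOf v = 0) : d.degreeOf v = 0 := by
  obtain ⟨e, rfl⟩ := hd
  rw [MvPolynomial.degreeOf_mul_eq (left_ne_zero_of_mul hp) (right_ne_zero_of_mul hp)] at h
  omega

theorem dvd_kill {v : ℤ × ℤ} {d p q : LatticePoly} (hp : p ≠ 0) (hd : d ∣ p)
    (h : p.degreeOf v = 0) (hq : d ∣ q) : d ∣ kill v q := by
  have := map_dvd (kill v) hq
  rwa [kill_of_degreeOf (degreeOf_eq_zero_of_dvd hp hd h)] at this

/-- The extreme variable of each polynomial is absent from the other one, hence from every common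
divisor, and may be set to zero in the polynomial containing it. By `kill_top` and `kill_bot` this
leads to a diagonal pair one level lower. -/
theorem OctaRec.isRelPrime_diagonal {K : ℕ} (H : OctaRec K) (k : ℕ) (hk : k ≤ K + 1)
    (a b s : ℤ) (hs : |s| = 1) : IsRelPrime (octa k a b) (octa k (a + 1) (b + s)) := by
  induction k generalizing a b s with
  | zero => exact isRelPrime_one_left
  | succ k ih =>
    cases k with
    | zero => exact isRelPrime_one_left
    | succ q =>
      intro d hd₁ hd₂
      have h₁ := dvd_kill (v := (a + 1 + q, b + s)) (H.ne_zero _ hk _ _) hd₁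
        (H.degreeOf_eq_zero _ hk _ _ _ (by
          push_cast
          rw [add_sub_cancel_left, hs]
          have := le_abs_self (a + 1 + (q : ℤ) - a)
          omega)) hd₂
      have h₂ := dvd_kill (v := (a - q, b)) (H.ne_zero _ hk _ _) hd₂
        (H.degreeOf_eq_zero _ hk _ _ _ (by
          push_cast
          rw [show b - (b + s) = -s by ring, abs_neg, hs]
          have := neg_abs_le (a - (q : ℤ) - (a + 1))
          omega)) hd₁
      rw [H.kill_top q hk, add_sub_cancel_right] at h₁
      rw [H.kill_bot q hk] at h₂
      have := ih (by omega) a (b + s) (-s) (by rwa [abs_neg])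
      rw [add_neg_cancel_right] at this
      exact this h₁ h₂

theorem OctaRec.isRelPrime_X {K : ℕ} (H : OctaRec K) (k : ℕ) (hk : k ≤ K + 1) (a b : ℤ)
    (v : ℤ × ℤ) : IsRelPrime (octa k a b) (MvPolynomial.X v) := by
  have hp : Prime (MvPolynomial.X v : LatticePoly) := MvPolynomial.X_prime
  refine ((hp.irreducible.isRelPrime_iff_not_dvd).2 ?_).symm
  rintro ⟨q, hq⟩
  have := H.eval_zero k hk a b
  rw [hq] at this
  simp at this

theorem OctaRec.isRelPrime_ray {K : ℕ} (H : OctaRec K) (k : ℕ) (hk : k ≤ K + 1) (a b : ℤ)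
    (l : ℕ) (a' b' : ℤ) : IsRelPrime (octa k a b) (ray l a' b') := by
  induction l with
  | zero => exact H.isRelPrime_X k hk a b _
  | succ l ih =>
    exact ((H.isRelPrime_X k hk a b _).mul_right ih).mul_right (H.isRelPrime_X k hk a b _)

/-- By the recurrence, a common divisor divides the product of the two horizontal neighbours, and
both are diagonal neighbours of the second polynomial. -/
theorem OctaRec.isRelPrime_vertical {K : ℕ} (H : OctaRec K) (k : ℕ) (hk : k < K) (a b s : ℤ)
    (hs : s = 1 ∨ s = -1) : IsRelPrime (octa (k + 2) a b) (octa (k + 1) a (b + s)) := by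
  have hdiv : octa (k + 1) a (b + s) ∣ octa (k + 1) a (b - 1) * octa (k + 1) a (b + 1) := by
    rcases hs with rfl | rfl
    · exact dvd_mul_left _ _
    · exact dvd_mul_right _ _
  have hs' : |s| = 1 := by rcases hs with rfl | rfl <;> simp
  intro d hd₁ hd₂
  have h₁ : d ∣ octa (k + 1) (a - 1) b * octa (k + 1) (a + 1) b := by
    have h := (hd₁.mul_right (octa k a b))
    rw [H k hk, octaRHS] at h
    exact (dvd_add_left (dvd_mul_of_dvd_right (hd₂.trans hdiv) _)).1 h
  have p₁ : IsRelPrime d (octa (k + 1) (a - 1) b) := by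
    have := (H.isRelPrime_diagonal (k + 1) (by omega) (a - 1) b s hs').symm
    rw [sub_add_cancel] at this
    exact this.of_dvd_left hd₂
  have p₂ : IsRelPrime d (octa (k + 1) (a + 1) b) := by
    have := (H.isRelPrime_diagonal (k + 1) (by omega) a (b + s) (-s) (by rwa [abs_neg]))
    rw [add_neg_cancel_right] at this
    exact this.of_dvd_left hd₂
  exact p₂ dvd_rfl (p₁.dvd_of_dvd_mul_left h₁)

/-- As in the vertical case with the two terms of the recurrence exchanged. The extra monomial `ray`
is harmless because no variable divides `octa`. -/
theorem OctaRec.isRelPrime_horizontal {K : ℕ} (H : OctaRec K) (k : ℕ) (hk : k < K) (a b s : ℤ)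
    (hs : s = 1 ∨ s = -1) : IsRelPrime (octa (k + 2) a b) (octa (k + 1) (a + s) b) := by
  have hdiv : octa (k + 1) (a + s) b ∣ octa (k + 1) (a - 1) b * octa (k + 1) (a + 1) b := by
    rcases hs with rfl | rfl
    · exact dvd_mul_left _ _
    · exact dvd_mul_right _ _
  have hp : ∀ t : ℤ, |t| = 1 → IsRelPrime (octa (k + 1) (a + s) b) (octa (k + 1) a (b + t)) := by
    intro t ht
    rcases hs with rfl | rfl
    · have := (H.isRelPrime_diagonal (k + 1) (by omega) a (b + t) (-t) (by rwa [abs_neg])).symm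
      rwa [add_neg_cancel_right] at this
    · have := H.isRelPrime_diagonal (k + 1) (by omega) (a + -1) b t ht
      rwa [neg_add_cancel_right] at this
  intro d hd₁ hd₂
  have h₁ : d ∣ ray k a b * (octa (k + 1) a (b - 1) * octa (k + 1) a (b + 1)) := by
    have h := (hd₁.mul_right (octa k a b))
    rw [H k hk, octaRHS] at h
    exact (dvd_add_right (hd₂.trans hdiv)).1 h
  have h₂ := ((H.isRelPrime_ray (k + 2) (by omega) a b k a b).of_dvd_left hd₁).dvd_of_dvd_mul_left h₁
  have h₃ := ((hp (-1) (by simp)).of_dvd_left hd₂).dvd_of_dvd_mul_left h₂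
  exact ((hp 1 (by simp)).of_dvd_left hd₂) dvd_rfl h₃

/-- Modulo `D` one has `A₁A₂g₁g₂ ≡ r₁r₂c₁c₂c₃c₄` and `B₁B₂h₁h₂ ≡ c₁c₂c₃c₄`. With `r₁r₂ = τρ` the
whole expression becomes `τc₁c₂c₃c₄(g₁g₂ + ρh₁h₂)`, and the bracket is `D e`. -/
theorem octa_dvd_aux {R : Type*} [CommRing R]
    {D e A₁ A₂ B₁ B₂ g₁ g₂ h₁ h₂ r₁ r₂ ρ τ s₁ s₂ s₃ s₄ c₁ c₂ c₃ c₄ : R}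
    (e₁ : A₁ * g₁ = D * s₁ + r₁ * (c₁ * c₂)) (e₂ : A₂ * g₂ = D * s₂ + r₂ * (c₃ * c₄))
    (e₃ : B₁ * h₁ = c₁ * c₃ + D * s₃) (e₄ : B₂ * h₂ = c₂ * c₄ + D * s₄)
    (e₅ : D * e = g₁ * g₂ + ρ * (h₁ * h₂)) (e₆ : r₁ * r₂ = τ * ρ) :
    D ∣ (A₁ * A₂ + τ * (B₁ * B₂)) * (g₁ * g₂ * (h₁ * h₂)) := by
  refine ⟨(D * s₁ * s₂ + s₁ * r₂ * c₃ * c₄ + s₂ * r₁ * c₁ * c₂) * h₁ * h₂ +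
    τ * (c₁ * c₃ * s₄ + s₃ * c₂ * c₄ + D * s₃ * s₄) * g₁ * g₂ + τ * c₁ * c₂ * c₃ * c₄ * e, ?_⟩
  linear_combination (A₂ * g₂ * h₁ * h₂) * e₁ + (D * s₁ + r₁ * (c₁ * c₂)) * h₁ * h₂ * e₂ +
    τ * (B₂ * h₂ * g₁ * g₂) * e₃ + τ * (c₁ * c₃ + D * s₃) * g₁ * g₂ * e₄ -
    τ * c₁ * c₂ * c₃ * c₄ * e₅ + c₁ * c₂ * c₃ * c₄ * h₁ * h₂ * e₆

/-- After multiplication by the four neighbours one level below the divisor, divisibility is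
`octa_dvd_aux`. These neighbours are coprime to the divisor and can be removed. -/
theorem OctaRec.octa_dvd {K : ℕ} (H : OctaRec K) (a b : ℤ) :
    octa K a b ∣ octaRHS (octa (K + 1)) K a b := by
  rcases K with _ | _ | k
  · exact one_dvd _
  · exact one_dvd _
  have e₁ := H (k + 1) (by omega) (a - 1) b
  have e₂ := H (k + 1) (by omega) (a + 1) b
  have e₃ := H (k + 1) (by omega) a (b - 1)
  have e₄ := H (k + 1) (by omega) a (b + 1)
  have e₅ := H k (by omega) a b
  simp only [octaRHS, sub_add_cancel, add_sub_cancel_right, show k + 1 + 1 = k + 2 from rfl,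
    show k + 1 + 2 = k + 3 from rfl] at e₁ e₂ e₃ e₄ e₅
  have key : octa (k + 2) a b ∣
      (octa (k + 3) (a - 1) b * octa (k + 3) (a + 1) b +
        ray (k + 2) a b * (octa (k + 3) a (b - 1) * octa (k + 3) a (b + 1))) *
      (octa (k + 1) (a - 1) b * octa (k + 1) (a + 1) b *
        (octa (k + 1) a (b - 1) * octa (k + 1) a (b + 1))) := by
    refine octa_dvd_aux (s₁ := octa (k + 2) (a - 1 - 1) b) (s₂ := octa (k + 2) (a + 1 + 1) b)
      (s₃ := ray (k + 1) a (b - 1) * octa (k + 2) a (b - 1 - 1))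
      (s₄ := ray (k + 1) a (b + 1) * octa (k + 2) a (b + 1 + 1))
      (c₁ := octa (k + 2) (a - 1) (b - 1)) (c₂ := octa (k + 2) (a - 1) (b + 1))
      (c₃ := octa (k + 2) (a + 1) (b - 1)) (c₄ := octa (k + 2) (a + 1) (b + 1)) ?_ e₂ ?_ ?_ e₅
      (ray_mul_ray k a b)
    · rw [e₁]; ring
    · rw [e₃]; ring
    · rw [e₄]; ring
  have v₁ := H.isRelPrime_vertical k (by omega) a b (-1) (Or.inr rfl)
  have v₂ := H.isRelPrime_vertical k (by omega) a b 1 (Or.inl rfl)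
  have w₁ := H.isRelPrime_horizontal k (by omega) a b (-1) (Or.inr rfl)
  have w₂ := H.isRelPrime_horizontal k (by omega) a b 1 (Or.inl rfl)
  exact ((w₁.mul_right w₂).mul_right (v₁.mul_right v₂)).dvd_of_dvd_mul_right key

theorem octaRec (K : ℕ) : OctaRec K := by
  induction K with
  | zero => intro k hk; omega
  | succ K ih =>
    intro k hk a b
    rcases Nat.lt_succ_iff_lt_or_eq.1 hk with h | rfl
    · exact ih k h a b
    · have h := ih.octa_dvd a b
      simp only [octa, dif_pos h]
      rw [mul_comm]
      exact h.choose_spec.symm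

theorem octa_mul_octa (k : ℕ) (a b : ℤ) :
    octa (k + 2) a b * octa k a b =
      octa (k + 1) (a - 1) b * octa (k + 1) (a + 1) b +
        ray k a b * (octa (k + 1) a (b - 1) * octa (k + 1) a (b + 1)) :=
  octaRec (k + 1) k (by omega) a b

theorem octa_ne_zero (k : ℕ) (a b : ℤ) : octa k a b ≠ 0 := (octaRec k).ne_zero k (by omega) a b

theorem eval_zero_octa (k : ℕ) (a b : ℤ) : MvPolynomial.eval 0 (octa k a b) = 1 :=
  (octaRec k).eval_zero k (by omega) a b

/-- `octa k a b` involves only the variables at lattice distance at most `k - 2` from `(a, b)`. -/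
theorem degreeOf_octa (k : ℕ) (a b : ℤ) (v : ℤ × ℤ) (h : (k : ℤ) - 1 ≤ |v.1 - a| + |v.2 - b|) :
    (octa k a b).degreeOf v = 0 :=
  (octaRec k).degreeOf_eq_zero k (by omega) a b v h


/-! ### Specializations of the octahedron polynomials -/

theorem eval_octa_congr {η θ : ℤ × ℤ → ℝ} {k : ℕ} {a b : ℤ}
    (h : ∀ v : ℤ × ℤ, |v.1 - a| + |v.2 - b| + 2 ≤ k → η v = θ v) :
    MvPolynomial.eval η (octa k a b) = MvPolynomial.eval θ (octa k a b) := by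
  refine MvPolynomial.hom_congr_vars (f₁ := MvPolynomial.eval η) (f₂ := MvPolynomial.eval θ)
    (by ext r; simp) (fun v hv _ => ?_) rfl
  have : ¬ ((k : ℤ) - 1 ≤ |v.1 - a| + |v.2 - b|) := fun hle =>
    MvPolynomial.mem_vars_iff_degreeOf_ne_zero.1 hv (degreeOf_octa k a b v hle)
  simpa using h v (by omega)

theorem rename_ray (s t : ℤ) (k : ℕ) (a b : ℤ) :
    MvPolynomial.rename (fun v : ℤ × ℤ => (v.1 + s, v.2 + t)) (ray k a b) =
      ray k (a + s) (b + t) := by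
  induction k with
  | zero => simp [ray]
  | succ k ih =>
    rw [ray, ray, map_mul, map_mul, ih, MvPolynomial.rename_X, MvPolynomial.rename_X]
    simp only []
    rw [sub_add_eq_add_sub, add_right_comm]

theorem rename_octa (s t : ℤ) (k : ℕ) (a b : ℤ) :
    MvPolynomial.rename (fun v : ℤ × ℤ => (v.1 + s, v.2 + t)) (octa k a b) =
      octa k (a + s) (b + t) := by
  induction k using Nat.twoStepInduction generalizing a b with
  | zero => simp [octa]
  | one => simp [octa]
  | more k ih₀ ih₁ =>
    have h := congrArg (MvPolynomial.rename fun v : ℤ × ℤ => (v.1 + s, v.2 + t))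
      (octa_mul_octa k a b)
    simp only [map_mul, map_add, ih₀, ih₁, rename_ray] at h
    refine mul_right_cancel₀ (octa_ne_zero k (a + s) (b + t)) ?_
    rw [h, octa_mul_octa, sub_add_eq_add_sub, sub_add_eq_add_sub, add_right_comm a,
      add_right_comm b]

theorem octa_two (a b : ℤ) : octa 2 a b = 1 + MvPolynomial.X (a, b) := by
  have := octa_mul_octa 0 a b
  simpa [octa, ray] using this

theorem kill_octa_ne_zero (v : ℤ × ℤ) (k : ℕ) (a b : ℤ) : kill v (octa k a b) ≠ 0 := by
  have h : ((MvPolynomial.eval 0).comp (kill v : LatticePoly →+* LatticePoly)) =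
      MvPolynomial.eval (0 : ℤ × ℤ → ℝ) := by
    ext w
    · simp [kill]
    · by_cases hw : w = v <;> simp [kill, hw]
  intro h₀
  have h₁ := RingHom.congr_fun h (octa k a b)
  rw [RingHom.comp_apply, eval_zero_octa] at h₁
  simp [h₀] at h₁

theorem octa_one (a b : ℤ) : octa 1 a b = 1 := rfl

/-- The vanishing variable lies on the row and removes the ray term. What remains is a
multiplicative relation between consecutive levels, which the product of the two factors also
satisfies; for `p = 0` or `q = 0` one factor is `octa 1 = 1`. -/
theorem kill_octa_split (p q : ℕ) (a b e : ℤ) (he : e = a + p - q) :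
    kill (e, b) (octa (p + q + 1) a b) =
      kill (e, b) (octa (p + 1) (a - q) b) * kill (e, b) (octa (q + 1) (a + p) b) := by
  induction p generalizing q a with
  | zero => simp [octa]
  | succ p ihp =>
    induction q generalizing a with
    | zero => simp [octa_one]
    | succ q ihq =>
      push_cast at he ihq ⊢
      have h := congrArg (kill (e, b)) (octa_mul_octa (p + q + 1) a b)
      rw [map_add, map_mul _ (ray _ _ _), kill_ray (by push_cast; omega) (by push_cast; omega),
        map_mul, map_mul, ihp q a (by omega)] at h
      have h₁ := ihq (a - 1) (by omega)
      have h₂ := ihp (q + 1) (a + 1) (by push_cast; omega)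
      push_cast at h₂
      rw [show p + 1 + q + 1 = p + q + 1 + 1 by ring, show a - 1 + ((p : ℤ) + 1) = a + p by ring,
        show a - 1 - (q : ℤ) = a - (q + 1) by ring] at h₁
      rw [show p + (q + 1) + 1 = p + q + 1 + 1 by ring, show a + 1 - ((q : ℤ) + 1) = a - q by ring,
        show a + 1 + (p : ℤ) = a + (p + 1) by ring] at h₂
      rw [h₁, h₂] at h
      rw [show p + 1 + (q + 1) + 1 = p + q + 1 + 2 by ring]
      refine mul_right_cancel₀ (mul_ne_zero (kill_octa_ne_zero (e, b) (p + 1) (a - q) b)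
        (kill_octa_ne_zero (e, b) (q + 1) (a + p) b)) (h.trans ?_)
      ring

theorem eval_kill {η : ℤ × ℤ → ℝ} {v : ℤ × ℤ} (h : η v = 0) (p : LatticePoly) :
    MvPolynomial.eval η (kill v p) = MvPolynomial.eval η p := by
  have : (MvPolynomial.eval η).comp (kill v : LatticePoly →+* LatticePoly) =
      MvPolynomial.eval η := by
    ext w
    · simp [kill]
    · by_cases hw : w = v
      · simp [kill, hw, h]
      · simp [kill, hw]
  exact RingHom.congr_fun this p

/-- If the variable at a suitable interior point vanishes, then `octa` factors. -/
theorem eval_octa_split {η : ℤ × ℤ → ℝ} (p q : ℕ) (a b : ℤ) (h : η (a + p - q, b) = 0) :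
    MvPolynomial.eval η (octa (p + q + 1) a b) =
      MvPolynomial.eval η (octa (p + 1) (a - q) b) *
        MvPolynomial.eval η (octa (q + 1) (a + p) b) := by
  rw [← eval_kill h, kill_octa_split p q a b _ rfl, map_mul, eval_kill h, eval_kill h]

theorem prod_range_condense {M : Type*} [CommMonoid M] (g : ℕ → M) (l : ℕ) :
    (∏ i ∈ Finset.range (l + 2), g i) * ∏ i ∈ Finset.range l, g (i + 1) =
      (∏ i ∈ Finset.range (l + 1), g (i + 1)) * ∏ i ∈ Finset.range (l + 1), g i := by
  rw [Finset.prod_range_succ _ (l + 1), Finset.prod_range_succ (fun i => g (i + 1)) l]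
  ac_rfl

/-- The terms of `octa` that do not involve the variables of the other parity. -/
theorem octa_diagonal {R : Type*} [CommRing R] [IsDomain R] (φ : LatticePoly →+* R) (s : ℤ)
    (hφ : ∀ v : ℤ × ℤ, ¬ Even (v.1 + v.2 + s) → φ (MvPolynomial.X v) = 0) (k : ℕ) (a b : ℤ)
    (hab : Even (a + b + k + 1 + s)) :
    φ (octa (k + 1) a b) =
      ∏ i ∈ Finset.range k, (1 + φ (MvPolynomial.X (a + k - 1 - 2 * i, b))) := by
  -- The factor to be cancelled in the recurrence may vanish under `φ`. The identity is therefore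
  -- proved for the universal specialization `δ`, through which `φ` factors and under which `octa`
  -- stays nonzero.
  let δ : LatticePoly →ₐ[ℝ] LatticePoly := MvPolynomial.aeval fun v =>
    if Even (v.1 + v.2 + s) then MvPolynomial.X v else 0
  have hδ : ∀ p, φ (δ p) = φ p := by
    intro p
    have : φ.comp (δ : LatticePoly →+* LatticePoly) = φ := by
      ext v
      · simp [δ]
      · by_cases hv : Even (v.1 + v.2 + s)
        · simp [δ, hv]
        · simp [δ, hv, hφ v hv]
    exact RingHom.congr_fun this p
  have h0 : ∀ p, MvPolynomial.eval 0 (δ p) = MvPolynomial.eval 0 p := by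
    intro p
    have : (MvPolynomial.eval 0).comp (δ : LatticePoly →+* LatticePoly) =
        MvPolynomial.eval (0 : ℤ × ℤ → ℝ) := by
      ext v
      · simp [δ]
      · by_cases hv : Even (v.1 + v.2 + s) <;> simp [δ, hv]
    exact RingHom.congr_fun this p
  have hne : ∀ k a b, δ (octa k a b) ≠ 0 := by
    intro k a b h
    have := h0 (octa k a b)
    rw [h, eval_zero_octa, map_zero] at this
    exact zero_ne_one this
  have main : ∀ (k : ℕ) (a b : ℤ), Even (a + b + k + 1 + s) → δ (octa (k + 1) a b) =
      ∏ i ∈ Finset.range k, (1 + MvPolynomial.X (a + k - 1 - 2 * i, b)) := by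
    intro k
    induction k using Nat.twoStepInduction with
    | zero => intro a b _; simp [octa]
    | one =>
      intro a b h
      have : Even (a + b + s) := by
        rw [show a + b + s = a + b + (1 : ℕ) + 1 + s - 2 by push_cast; ring]
        exact h.sub (by decide)
      simp [octa_two, δ, this]
    | more k ih₀ ih₁ =>
      intro a b h
      have e := congrArg δ (octa_mul_octa (k + 1) a b)
      have hray : δ (ray (k + 1) a b) = 0 := by
        refine map_ray_eq_zero (δ : LatticePoly →+* LatticePoly) (a' := a + k)
          (by push_cast; omega) (by push_cast; omega) ?_
        have : ¬ Even (a + k + b + s) := by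
          push_cast at h
          rw [Int.even_iff] at h ⊢
          omega
        simp [δ, this]
      push_cast at h ih₁ ⊢
      rw [Int.even_iff] at h
      rw [map_add, map_mul _ (ray _ _ _), hray, map_mul, map_mul, ih₀ a b (Int.even_iff.2 (by omega)),
        ih₁ (a - 1) b (Int.even_iff.2 (by omega)), ih₁ (a + 1) b (Int.even_iff.2 (by omega)),
        zero_mul, add_zero] at e
      have hc := prod_range_condense
        (fun i : ℕ => (1 + MvPolynomial.X (a + (k + 2) - 1 - 2 * (i : ℤ), b) : LatticePoly)) k
      have hk : ∏ i ∈ Finset.range k, (1 + MvPolynomial.X (a + k - 1 - 2 * (i : ℤ), b) : LatticePoly) ≠ 0 := by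
        rw [← ih₀ a b (Int.even_iff.2 (by omega))]
        exact hne _ _ _
      refine mul_right_cancel₀ hk (e.trans ?_)
      push_cast at hc
      convert hc.symm using 3 <;> [skip; skip; skip] <;> ring_nf
  rw [← hδ, main k a b hab, map_prod]
  simp

/-! ### Vanishing along a line of variables equal to -1 -/

/-- A generic perturbation of the specialization `-1` on the line `a + b = L`. -/
def linePert (L : ℤ) : LatticePoly →+* Polynomial LatticePoly :=
  MvPolynomial.eval₂Hom (Polynomial.C.comp MvPolynomial.C) fun v =>
    if v.1 + v.2 = L then -1 + Polynomial.X * Polynomial.C (MvPolynomial.X v)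
    else Polynomial.C (MvPolynomial.X v)

theorem linePert_X (L : ℤ) (v : ℤ × ℤ) : linePert L (MvPolynomial.X v) =
    if v.1 + v.2 = L then -1 + Polynomial.X * Polynomial.C (MvPolynomial.X v)
    else Polynomial.C (MvPolynomial.X v) := by
  simp [linePert]

/-- Setting the variables of the other parity to 0 and all remaining ones to 1 reduces `octa` to the
product in `octa_diagonal`. The row meets the line in at most one point: that factor is `1 + (-1 +
X) = X`, and every other factor is 2. This bounds the order of vanishing from above. -/
theorem linePert_octa_specialize (L : ℤ) (k : ℕ) (a b : ℤ) (hab : Even (a + b + k + 1 + L)) :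
    ∃ ψ : Polynomial LatticePoly →+* Polynomial ℝ, ψ Polynomial.X = Polynomial.X ∧
      ψ (linePert L (octa (k + 1) a b)) =
      ∏ i ∈ Finset.range k, (if a + b + k - 1 - 2 * i = L then Polynomial.X else 2) := by
  let χ : LatticePoly →+* ℝ :=
    MvPolynomial.eval fun v : ℤ × ℤ => if Even (v.1 + v.2 + L) then 1 else 0
  refine ⟨Polynomial.mapRingHom χ, by simp, ?_⟩
  have hX : ∀ v : ℤ × ℤ, (Polynomial.mapRingHom χ).comp (linePert L) (MvPolynomial.X v) =
      if v.1 + v.2 = L then -1 + Polynomial.X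
      else if Even (v.1 + v.2 + L) then 1 else 0 := by
    intro v
    rw [RingHom.comp_apply, linePert_X]
    by_cases h : v.1 + v.2 = L
    · have : Even (v.1 + v.2 + L) := by rw [h]; exact ⟨L, rfl⟩
      simp [h, χ]
    · by_cases h' : Even (v.1 + v.2 + L) <;> simp [h, h', χ]
  have := octa_diagonal ((Polynomial.mapRingHom χ).comp (linePert L)) L (by
    intro v hv
    rw [hX, if_neg, if_neg hv]
    rintro rfl
    exact hv ⟨_, rfl⟩) k a b hab
  rw [RingHom.comp_apply] at this
  rw [this]
  refine Finset.prod_congr rfl fun i _ => ?_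
  rw [hX]
  have e : a + k - 1 - 2 * (i : ℤ) + b = a + b + k - 1 - 2 * i := by ring
  have : Even (a + b + k - 1 - 2 * (i : ℤ) + L) := by
    rw [Int.even_iff] at hab ⊢
    omega
  simp only [e, this, if_true]
  split_ifs
  · ring
  · norm_num

theorem linePert_octa_not_sq_dvd (L : ℤ) (k : ℕ) (a b : ℤ) (hab : Even (a + b + k + 1 + L)) :
    ¬ Polynomial.X ^ 2 ∣ linePert L (octa (k + 1) a b) := by
  intro h
  obtain ⟨ψ, hψ, e⟩ := linePert_octa_specialize L k a b hab
  have h' := map_dvd ψ h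
  rw [map_pow, hψ, e] at h'
  have h2 : ∀ s : Finset ℕ, (∀ i ∈ s, a + b + k - 1 - 2 * (i : ℤ) ≠ L) →
      ¬ Polynomial.X ∣ ∏ i ∈ s, (if a + b + k - 1 - 2 * (i : ℤ) = L then Polynomial.X
        else (2 : Polynomial ℝ)) := by
    intro s hs hd
    rw [Finset.prod_congr rfl (fun i hi => if_neg (hs i hi)), Finset.prod_const,
      Polynomial.X_dvd_iff] at hd
    simp [Polynomial.coeff_zero_eq_eval_zero] at hd
  by_cases hi : ∃ i ∈ Finset.range k, a + b + k - 1 - 2 * (i : ℤ) = L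
  · obtain ⟨i, hi, hL⟩ := hi
    rw [← Finset.mul_prod_erase _ _ hi, if_pos hL, pow_two] at h'
    refine h2 _ ?_ ((mul_dvd_mul_iff_left Polynomial.X_ne_zero).1 h')
    intro j hj
    have := (Finset.mem_erase.1 hj).1
    omega
  · push Not at hi
    exact h2 _ hi ((dvd_pow_self _ two_ne_zero).trans h')

theorem linePert_octa_not_dvd (L : ℤ) (k : ℕ) (a b : ℤ) (hab : Even (a + b + k + 1 + L))
    (hL : L < a + b - k + 1 ∨ a + b + k - 1 < L) :
    ¬ Polynomial.X ∣ linePert L (octa (k + 1) a b) := by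
  intro h
  obtain ⟨ψ, hψ, e⟩ := linePert_octa_specialize L k a b hab
  have h' := map_dvd ψ h
  have : ∀ i ∈ Finset.range k, a + b + k - 1 - 2 * (i : ℤ) ≠ L := by
    intro i hi
    have := Finset.mem_range.1 hi
    omega
  rw [hψ, e, Finset.prod_congr rfl (fun i hi => if_neg (this i hi)), Finset.prod_const,
    Polynomial.X_dvd_iff] at h'
  simp [Polynomial.coeff_zero_eq_eval_zero] at h'

/-- At the specialization itself both factors on the left of the recurrence may vanish, so the order
in the perturbation parameter is followed instead. If the line crosses the supports of all four
neighbours, the right side has order at least 2 while the lower factor has order at most 1.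
Otherwise the right side has order at least 1 and the lower factor has order 0. -/
theorem X_dvd_linePert_octa (L : ℤ) (k : ℕ) (a b : ℤ) (hab : Even (a + b + k + 1 + L))
    (h₁ : a + b - k + 1 ≤ L) (h₂ : L ≤ a + b + k - 1) :
    Polynomial.X ∣ linePert L (octa (k + 1) a b) := by
  induction k generalizing a b with
  | zero => push_cast at h₁ h₂; omega
  | succ k ih =>
    push_cast at hab h₁ h₂
    rw [Int.even_iff] at hab
    cases k with
    | zero =>
      rw [octa_two, map_add, map_one, linePert_X, if_pos (by push_cast at h₁ h₂; omega)]
      exact ⟨_, add_neg_cancel_left _ _⟩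
    | succ k =>
      push_cast at hab h₁ h₂ ih
      have e := congrArg (linePert L) (octa_mul_octa (k + 1) a b)
      rw [map_add, map_mul, map_mul, map_mul _ (ray _ _ _), map_mul] at e
      have pX : Prime (Polynomial.X : Polynomial LatticePoly) := Polynomial.prime_X
      have lo : L ≤ a + b + k → Polynomial.X ∣ linePert L (octa (k + 2) (a - 1) b) ∧
          Polynomial.X ∣ linePert L (octa (k + 2) a (b - 1)) := fun h =>
        ⟨ih _ _ (Int.even_iff.2 (by omega)) (by omega) (by omega),
          ih _ _ (Int.even_iff.2 (by omega)) (by omega) (by omega)⟩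
      have hi : a + b - k ≤ L → Polynomial.X ∣ linePert L (octa (k + 2) (a + 1) b) ∧
          Polynomial.X ∣ linePert L (octa (k + 2) a (b + 1)) := fun h =>
        ⟨ih _ _ (Int.even_iff.2 (by omega)) (by omega) (by omega),
          ih _ _ (Int.even_iff.2 (by omega)) (by omega) (by omega)⟩
      have hev : Even (a + b + k + 1 + L) := Int.even_iff.2 (by omega)
      by_cases c₁ : L ≤ a + b + k
      · by_cases c₂ : a + b - k ≤ L
        · have hd : Polynomial.X ^ 2 ∣ linePert L (octa (k + 3) a b) * linePert L (octa (k + 1) a b) := by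
            rw [e, pow_two]
            exact dvd_add (mul_dvd_mul (lo c₁).1 (hi c₂).1)
              (dvd_mul_of_dvd_right (mul_dvd_mul (lo c₁).2 (hi c₂).2) _)
          by_contra hn
          exact linePert_octa_not_sq_dvd L k a b hev (pX.pow_dvd_of_dvd_mul_left 2 hn hd)
        · have hd : Polynomial.X ∣ linePert L (octa (k + 3) a b) * linePert L (octa (k + 1) a b) := by
            rw [e]
            exact dvd_add (dvd_mul_of_dvd_left (lo c₁).1 _)
              (dvd_mul_of_dvd_right (dvd_mul_of_dvd_left (lo c₁).2 _) _)
          exact (pX.dvd_or_dvd hd).resolve_right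
            (linePert_octa_not_dvd L k a b hev (Or.inl (by omega)))
      · have hd : Polynomial.X ∣ linePert L (octa (k + 3) a b) * linePert L (octa (k + 1) a b) := by
          rw [e]
          exact dvd_add (dvd_mul_of_dvd_right (hi (by omega)).1 _)
            (dvd_mul_of_dvd_right (dvd_mul_of_dvd_right (hi (by omega)).2 _) _)
        exact (pX.dvd_or_dvd hd).resolve_right
          (linePert_octa_not_dvd L k a b hev (Or.inr (by omega)))

/-- `octa` vanishes if the variables on one of the lines `a + b = const` equal `-1`. -/
theorem eval_octa_eq_zero {η : ℤ × ℤ → ℝ} (k u : ℕ) (hu : u < k) (a b : ℤ)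
    (h : ∀ t : ℕ, t < k → η (a + k - 1 - u - t, b - u + t) = -1) :
    MvPolynomial.eval η (octa (k + 1) a b) = 0 := by
  set L : ℤ := a + b + k - 1 - 2 * u with hL
  -- The hypothesis covers only the points of the line inside the support of `octa`; continuing the
  -- value `-1` along the whole line does not change the result.
  let θ : ℤ × ℤ → ℝ := fun v => if v.1 + v.2 = L then -1 else η v
  rw [eval_octa_congr (θ := θ)]
  · obtain ⟨q, hq⟩ := X_dvd_linePert_octa L k a b (Int.even_iff.2 (by omega)) (by omega) (by omega)
    have hc : ((Polynomial.evalRingHom (0 : ℝ)).comp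
        (Polynomial.mapRingHom (MvPolynomial.eval θ))).comp (linePert L) =
        MvPolynomial.eval θ := by
      ext v
      · simp [linePert]
      · by_cases hv : v.1 + v.2 = L <;> simp [linePert_X, hv, θ]
    rw [← hc, RingHom.comp_apply, hq]
    simp
  · intro v hv
    by_cases hvL : v.1 + v.2 = L
    · simp only [θ, hvL, if_true]
      have h₁ := le_abs_self (v.1 - a)
      have h₂ := neg_abs_le (v.1 - a)
      have h₃ := le_abs_self (v.2 - b)
      have h₄ := neg_abs_le (v.2 - b)
      have e := h (v.2 - b + u).toNat (by push_cast at hv; omega)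
      have et : ((v.2 - b + u).toNat : ℤ) = v.2 - b + u :=
        Int.toNat_of_nonneg (by push_cast at hv; omega)
      rw [et, show a + k - 1 - (u : ℤ) - (v.2 - b + u) = v.1 by omega,
        show b - (u : ℤ) + (v.2 - b + u) = v.2 by ring] at e
      exact e
    · simp [θ, hvL]


/-! ### The leading term in the variables of one parity -/

/-- The polynomials that do not vanish at points without zero coordinates. -/
def torusUnits : Submonoid LatticePoly where
  carrier := {p | ∀ η : ℤ × ℤ → ℝ, (∀ v, η v ≠ 0) → MvPolynomial.eval η p ≠ 0}
  one_mem' := fun η _ => by simp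
  mul_mem' := fun hp hq η hη => by
    rw [map_mul]
    exact mul_ne_zero (hp η hη) (hq η hη)

theorem X_mem_torusUnits (v : ℤ × ℤ) : MvPolynomial.X v ∈ torusUnits := fun η hη => by
  simpa using hη v

/-- Scaling of the variables at the points `v` with `v.1 + v.2 + s` odd. -/
def scaleOdd (s : ℤ) : LatticePoly →+* Polynomial LatticePoly :=
  MvPolynomial.eval₂Hom (Polynomial.C.comp MvPolynomial.C) fun v =>
    if Even (v.1 + v.2 + s) then Polynomial.C (MvPolynomial.X v)
    else Polynomial.C (MvPolynomial.X v) * Polynomial.X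

theorem scaleOdd_X (s : ℤ) (v : ℤ × ℤ) : scaleOdd s (MvPolynomial.X v) =
    if Even (v.1 + v.2 + s) then Polynomial.C (MvPolynomial.X v)
    else Polynomial.C (MvPolynomial.X v) * Polynomial.X := by
  simp [scaleOdd]

theorem scaleOdd_X_natDegree (s : ℤ) (v : ℤ × ℤ) :
    (scaleOdd s (MvPolynomial.X v)).natDegree = (if Even (v.1 + v.2 + s) then 0 else 1) ∧
      (scaleOdd s (MvPolynomial.X v)).leadingCoeff = MvPolynomial.X v := by
  rw [scaleOdd_X]
  split_ifs
  · simp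
  · simp [Polynomial.natDegree_C_mul_X _ (MvPolynomial.X_ne_zero (R := ℝ) v)]

theorem scaleOdd_ray (s : ℤ) (k : ℕ) (a b : ℤ) :
    (scaleOdd s (ray k a b)).natDegree = (if Even (a + b + k + s) then k else k + 1) ∧
      (scaleOdd s (ray k a b)).leadingCoeff ∈ torusUnits ∧ scaleOdd s (ray k a b) ≠ 0 := by
  induction k with
  | zero =>
    obtain ⟨h₁, h₂⟩ := scaleOdd_X_natDegree s (a, b)
    refine ⟨by simpa [ray] using h₁, by rw [ray, h₂]; exact X_mem_torusUnits _, ?_⟩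
    rw [ray, ← Polynomial.leadingCoeff_ne_zero, h₂]
    exact MvPolynomial.X_ne_zero _
  | succ k ih =>
    obtain ⟨h₁, h₂, h₃⟩ := ih
    obtain ⟨l₁, l₂⟩ := scaleOdd_X_natDegree s (a - (k + 1), b)
    obtain ⟨r₁, r₂⟩ := scaleOdd_X_natDegree s (a + (k + 1), b)
    have l₃ : scaleOdd s (MvPolynomial.X (a - ((k : ℤ) + 1), b)) ≠ 0 := by
      rw [← Polynomial.leadingCoeff_ne_zero, l₂]
      exact MvPolynomial.X_ne_zero _
    have r₃ : scaleOdd s (MvPolynomial.X (a + ((k : ℤ) + 1), b)) ≠ 0 := by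
      rw [← Polynomial.leadingCoeff_ne_zero, r₂]
      exact MvPolynomial.X_ne_zero _
    rw [ray, map_mul, map_mul]
    refine ⟨?_, ?_, mul_ne_zero (mul_ne_zero l₃ h₃) r₃⟩
    · rw [Polynomial.natDegree_mul (mul_ne_zero l₃ h₃) r₃, Polynomial.natDegree_mul l₃ h₃, h₁, l₁,
        r₁]
      push_cast
      simp only [Int.even_iff]
      split_ifs <;> omega
    · rw [Polynomial.leadingCoeff_mul, Polynomial.leadingCoeff_mul, l₂, r₂]
      exact mul_mem (mul_mem (X_mem_torusUnits _) h₂) (X_mem_torusUnits _)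

theorem scaleOdd_octa_ne_zero (s : ℤ) (k : ℕ) (a b : ℤ) : scaleOdd s (octa k a b) ≠ 0 := by
  intro h
  have hc : (MvPolynomial.eval 0).comp ((Polynomial.evalRingHom 1).comp (scaleOdd s)) =
      MvPolynomial.eval (0 : ℤ × ℤ → ℝ) := by
    ext v
    · simp [scaleOdd]
    · by_cases hv : Even (v.1 + v.2 + s) <;> simp [scaleOdd_X, hv]
  have h1 := RingHom.congr_fun hc (octa k a b)
  rw [eval_zero_octa, RingHom.comp_apply, RingHom.comp_apply, h] at h1
  simp at h1

/-- The two products of neighbours have equal degrees, so the ray makes the second term strictly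
dominant. The degrees then have second difference `k + 1`, which gives the binomial coefficient, and
the leading coefficients obey a multiplicative recurrence solved by the product over a column. The
monomials coming from the rays are absorbed in `A` and `B`. -/
theorem scaleOdd_octa (s : ℤ) (k : ℕ) (a b : ℤ) (hab : Even (a + b + k + 1 + s)) :
    (scaleOdd s (octa (k + 1) a b)).natDegree = (k + 1).choose 3 ∧
      ∃ A ∈ torusUnits, ∃ B ∈ torusUnits,
        A * (scaleOdd s (octa (k + 1) a b)).leadingCoeff =
          B * ∏ i ∈ Finset.range k, (1 + MvPolynomial.X (a, b + k - 1 - 2 * i)) := by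
  induction k using Nat.twoStepInduction generalizing a b with
  | zero => exact ⟨by rw [zero_add, octa_one, map_one, Polynomial.natDegree_one]; rfl, 1, one_mem _, 1, one_mem _, by simp [octa_one]⟩
  | one =>
    have : Even (a + b + s) := by
      rw [show a + b + s = a + b + (1 : ℕ) + 1 + s - 2 by push_cast; ring]
      exact hab.sub (by decide)
    have e : scaleOdd s (octa 2 a b) = Polynomial.C (1 + MvPolynomial.X (a, b)) := by
      rw [octa_two, map_add, scaleOdd_X, if_pos this]
      simp
    rw [e]
    refine ⟨by simp, 1, one_mem _, 1, one_mem _, by rw [Polynomial.leadingCoeff_C]; simp⟩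
  | more k ih₀ ih₁ =>
    push_cast at hab ih₁
    rw [Int.even_iff] at hab
    have e := congrArg (scaleOdd s) (octa_mul_octa (k + 1) a b)
    rw [map_add, map_mul, map_mul, map_mul _ (ray _ _ _), map_mul] at e
    obtain ⟨d₀, A₀, hA₀, B₀, hB₀, e₀⟩ := ih₀ a b (Int.even_iff.2 (by omega))
    obtain ⟨d₁, -⟩ := ih₁ (a - 1) b (Int.even_iff.2 (by omega))
    obtain ⟨d₂, -⟩ := ih₁ (a + 1) b (Int.even_iff.2 (by omega))
    obtain ⟨d₃, A₃, hA₃, B₃, hB₃, e₃⟩ := ih₁ a (b - 1) (Int.even_iff.2 (by omega))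
    obtain ⟨d₄, A₄, hA₄, B₄, hB₄, e₄⟩ := ih₁ a (b + 1) (Int.even_iff.2 (by omega))
    obtain ⟨d₅, hr, n₅⟩ := scaleOdd_ray s (k + 1) a b
    rw [if_pos (Int.even_iff.2 (by push_cast; omega))] at d₅
    have n := fun a b => scaleOdd_octa_ne_zero s (k + 1 + 1) a b
    have n₀ := scaleOdd_octa_ne_zero s (k + 1) a b
    have n₆ := scaleOdd_octa_ne_zero s (k + 1 + 2) a b
    have hlt : (scaleOdd s (octa (k + 1 + 1) (a - 1) b) *
        scaleOdd s (octa (k + 1 + 1) (a + 1) b)).natDegree <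
        (scaleOdd s (ray (k + 1) a b) * (scaleOdd s (octa (k + 1 + 1) a (b - 1)) *
          scaleOdd s (octa (k + 1 + 1) a (b + 1)))).natDegree := by
      rw [Polynomial.natDegree_mul (n _ _) (n _ _),
        Polynomial.natDegree_mul n₅ (mul_ne_zero (n _ _) (n _ _)),
        Polynomial.natDegree_mul (n _ _) (n _ _), d₁, d₂, d₃, d₄, d₅]
      omega
    have hdeg := congrArg Polynomial.natDegree e
    have hlc := congrArg Polynomial.leadingCoeff e
    rw [Polynomial.natDegree_add_eq_right_of_natDegree_lt hlt, Polynomial.natDegree_mul n₆ n₀,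
      Polynomial.natDegree_mul n₅ (mul_ne_zero (n _ _) (n _ _)),
      Polynomial.natDegree_mul (n _ _) (n _ _), d₀, d₃, d₄, d₅] at hdeg
    rw [Polynomial.leadingCoeff_add_of_degree_lt (Polynomial.degree_lt_degree hlt),
      Polynomial.leadingCoeff_mul, Polynomial.leadingCoeff_mul, Polynomial.leadingCoeff_mul] at hlc
    refine ⟨?_, B₀ * A₃ * A₄, mul_mem (mul_mem hB₀ hA₃) hA₄,
      (scaleOdd s (ray (k + 1) a b)).leadingCoeff * A₀ * B₃ * B₄,
      mul_mem (mul_mem (mul_mem hr hA₀) hB₃) hB₄, ?_⟩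
    · have c₁ := Nat.choose_succ_succ' (k + 2) 2
      have c₂ := Nat.choose_succ_succ' (k + 1) 2
      have c₃ := Nat.choose_succ_succ' (k + 1) 1
      rw [Nat.choose_one_right] at c₃
      simp only [show k + 1 + 1 = k + 2 from rfl, show k + 2 + 1 = k + 3 from rfl,
        show 2 + 1 = 3 from rfl, show 1 + 1 = 2 from rfl]
        at c₁ c₂ c₃ hdeg ⊢
      omega
    · have hc := prod_range_condense
        (fun i : ℕ => (1 + MvPolynomial.X (a, b + (k + 2) - 1 - 2 * (i : ℤ)) : LatticePoly)) k
      have hprod : ∏ i ∈ Finset.range k,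
          (1 + MvPolynomial.X (a, b + k - 1 - 2 * (i : ℤ)) : LatticePoly) ≠ 0 := by
        refine Finset.prod_ne_zero_iff.2 fun i _ h => ?_
        have := congrArg (MvPolynomial.eval 0) h
        simp at this
      push_cast at hc ⊢
      have hc' : (∏ i ∈ Finset.range (k + 2), (1 + MvPolynomial.X (a, b + (k + 2) - 1 - 2 * (i : ℤ)) : LatticePoly)) *
          ∏ i ∈ Finset.range k, (1 + MvPolynomial.X (a, b + k - 1 - 2 * (i : ℤ))) =
          (∏ i ∈ Finset.range (k + 1), (1 + MvPolynomial.X (a, b - 1 + (k + 1) - 1 - 2 * (i : ℤ)))) *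
          ∏ i ∈ Finset.range (k + 1), (1 + MvPolynomial.X (a, b + 1 + (k + 1) - 1 - 2 * (i : ℤ))) := by
        convert hc using 3 <;> [skip; skip; skip] <;> ring_nf
      refine mul_right_cancel₀ hprod ?_
      rw [mul_assoc (_ * B₄), hc']
      calc _ = (A₃ * A₄ * (scaleOdd s (octa (k + 1 + 2) a b)).leadingCoeff) *
            (B₀ * ∏ i ∈ Finset.range k, (1 + MvPolynomial.X (a, b + k - 1 - 2 * (i : ℤ)))) := by
              ring
        _ = A₃ * A₄ * A₀ * ((scaleOdd s (octa (k + 1 + 2) a b)).leadingCoeff *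
            (scaleOdd s (octa (k + 1) a b)).leadingCoeff) := by rw [← e₀]; ring
        _ = A₀ * (scaleOdd s (ray (k + 1) a b)).leadingCoeff *
            (A₃ * (scaleOdd s (octa (k + 1 + 1) a (b - 1))).leadingCoeff) *
            (A₄ * (scaleOdd s (octa (k + 1 + 1) a (b + 1))).leadingCoeff) := by rw [hlc]; ring
        _ = _ := by rw [e₃, e₄]; ring

theorem exists_scale_eval_octa_ne_zero {η : ℤ × ℤ → ℝ} (hη : ∀ v, η v ≠ 0) (s : ℤ) (k : ℕ)
    (a b : ℤ) (hab : Even (a + b + k + 1 + s))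
    (h : ∀ i : ℕ, i < k → η (a, b + k - 1 - 2 * i) ≠ -1) :
    ∃ r : ℝ, r ≠ 0 ∧ MvPolynomial.eval
      (fun v => if Even (v.1 + v.2 + s) then η v else η v * r) (octa (k + 1) a b) ≠ 0 := by
  obtain ⟨-, A, hA, B, hB, e⟩ := scaleOdd_octa s k a b hab
  set P : Polynomial ℝ := (scaleOdd s (octa (k + 1) a b)).map (MvPolynomial.eval η) with hP
  have hP0 : P ≠ 0 := by
    intro h0
    have hc : MvPolynomial.eval η (scaleOdd s (octa (k + 1) a b)).leadingCoeff = 0 := by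
      rw [Polynomial.leadingCoeff, ← Polynomial.coeff_map, ← hP, h0, Polynomial.coeff_zero]
    have := congrArg (MvPolynomial.eval η) e
    rw [map_mul, hc, mul_zero, map_mul, map_prod] at this
    refine mul_ne_zero (hB η hη) (Finset.prod_ne_zero_iff.2 fun i hi => ?_) this.symm
    have := h i (Finset.mem_range.1 hi)
    rw [map_add, map_one, MvPolynomial.eval_X]
    intro h'
    exact this (by linarith)
  -- The extra factor `X` excludes `r = 0`.
  have hP1 : P * Polynomial.X ≠ 0 := mul_ne_zero hP0 Polynomial.X_ne_zero
  obtain ⟨r, hr⟩ : ∃ r, (P * Polynomial.X).eval r ≠ 0 := by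
    by_contra hn
    push Not at hn
    exact hP1 (Polynomial.funext fun r => by rw [hn r, Polynomial.eval_zero])
  rw [Polynomial.eval_mul, Polynomial.eval_X] at hr
  refine ⟨r, right_ne_zero_of_mul hr, ?_⟩
  have hc : ((Polynomial.evalRingHom r).comp (Polynomial.mapRingHom (MvPolynomial.eval η))).comp
      (scaleOdd s) = MvPolynomial.eval fun v => if Even (v.1 + v.2 + s) then η v else η v * r := by
    ext v
    · simp [scaleOdd]
    · by_cases hv : Even (v.1 + v.2 + s) <;> simp [scaleOdd_X, hv]
  rw [← hc]
  exact left_ne_zero_of_mul hr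

theorem MvPolynomial_exists_eval_ne_zero {σ : Type*} {P : MvPolynomial σ ℝ} (hP : P ≠ 0) :
    ∃ t : σ → ℝ, (∀ v, t v ≠ 0) ∧ MvPolynomial.eval t P ≠ 0 := by
  by_contra hn
  push Not at hn
  refine hP (MvPolynomial.funext_set (fun _ => {0}ᶜ)
    (fun _ => Set.Finite.infinite_compl (Set.finite_singleton 0)) fun t ht => ?_)
  rw [hn t (fun v => ht v (Set.mem_univ v)), map_zero]

/-! ### The recurrence on sequences -/

/-- The lattice function `(a, b) ↦ η (3 a + b)`. -/
def toLattice (η : ℤ → ℝ) (v : ℤ × ℤ) : ℝ := η (3 * v.1 + v.2)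

/-- The values of the octahedron polynomials at `toLattice η`. -/
def octaVal (η : ℤ → ℝ) (k : ℕ) (j : ℤ) : ℝ := MvPolynomial.eval (toLattice η) (octa k 0 j)

/-- The product of `η (j + 3 i)`, `|i| ≤ k`. -/
def rayVal (η : ℤ → ℝ) (k : ℕ) (j : ℤ) : ℝ := MvPolynomial.eval (toLattice η) (ray k 0 j)

theorem toLattice_shift (η : ℤ → ℝ) (a s : ℤ) :
    toLattice η ∘ (fun v : ℤ × ℤ => (v.1 + a, v.2 + s)) =
      toLattice fun j => η (j + (3 * a + s)) := by
  funext v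
  simp only [toLattice, Function.comp]
  congr 1
  ring

theorem eval_octa (η : ℤ → ℝ) (k : ℕ) (a b : ℤ) :
    MvPolynomial.eval (toLattice η) (octa k a b) = octaVal η k (3 * a + b) := by
  have := rename_octa a (-3 * a) k 0 (3 * a + b)
  rw [zero_add, show 3 * a + b + -3 * a = b by ring] at this
  rw [← this, MvPolynomial.eval_rename, toLattice_shift, show 3 * a + -3 * a = 0 by ring]
  simp [octaVal]

theorem eval_ray (η : ℤ → ℝ) (k : ℕ) (a b : ℤ) :
    MvPolynomial.eval (toLattice η) (ray k a b) = rayVal η k (3 * a + b) := by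
  have := rename_ray a (-3 * a) k 0 (3 * a + b)
  rw [zero_add, show 3 * a + b + -3 * a = b by ring] at this
  rw [← this, MvPolynomial.eval_rename, toLattice_shift, show 3 * a + -3 * a = 0 by ring]
  simp [rayVal]

theorem octaVal_shift (η : ℤ → ℝ) (k : ℕ) (j s : ℤ) :
    octaVal (fun i => η (i + s)) k j = octaVal η k (j + s) := by
  rw [octaVal, octaVal]
  have := rename_octa 0 s k 0 j
  rw [zero_add] at this
  rw [← this, MvPolynomial.eval_rename, toLattice_shift]
  simp

theorem octaVal_zero (η : ℤ → ℝ) (j : ℤ) : octaVal η 0 j = 1 := by simp [octaVal, octa]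

theorem octaVal_one (η : ℤ → ℝ) (j : ℤ) : octaVal η 1 j = 1 := by simp [octaVal, octa]

theorem rayVal_zero (η : ℤ → ℝ) (j : ℤ) : rayVal η 0 j = η j := by simp [rayVal, ray, toLattice]

theorem rayVal_succ (η : ℤ → ℝ) (k : ℕ) (j : ℤ) :
    rayVal η (k + 1) j = η (j - 3 * (k + 1)) * rayVal η k j * η (j + 3 * (k + 1)) := by
  rw [rayVal, ray, map_mul, map_mul, MvPolynomial.eval_X, MvPolynomial.eval_X, toLattice, toLattice,
    rayVal, show 3 * ((0 : ℤ) - (k + 1)) + j = j - 3 * (k + 1) by ring,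
    show 3 * ((0 : ℤ) + (k + 1)) + j = j + 3 * (k + 1) by ring]

theorem rayVal_ne_zero {η : ℤ → ℝ} (hη : ∀ j, η j ≠ 0) (k : ℕ) (j : ℤ) : rayVal η k j ≠ 0 := by
  induction k with
  | zero => rw [rayVal_zero]; exact hη j
  | succ k ih => rw [rayVal_succ]; exact mul_ne_zero (mul_ne_zero (hη _) ih) (hη _)

theorem octaVal_mul_octaVal (η : ℤ → ℝ) (k : ℕ) (j : ℤ) :
    octaVal η (k + 2) j * octaVal η k j =
      octaVal η (k + 1) (j - 3) * octaVal η (k + 1) (j + 3) +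
        rayVal η k j * (octaVal η (k + 1) (j - 1) * octaVal η (k + 1) (j + 1)) := by
  have h := congrArg (MvPolynomial.eval (toLattice η)) (octa_mul_octa k 0 j)
  simpa only [map_mul, map_add, eval_octa, eval_ray, show 3 * (0 : ℤ) + j = j by ring,
    show 3 * ((0 : ℤ) - 1) + j = j - 3 by ring, show 3 * ((0 : ℤ) + 1) + j = j + 3 by ring,
    show 3 * (0 : ℤ) + (j - 1) = j - 1 by ring, show 3 * (0 : ℤ) + (j + 1) = j + 1 by ring] using h

theorem rayVal_mul_rayVal (η : ℤ → ℝ) (k : ℕ) (j : ℤ) :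
    rayVal η (k + 1) (j - 3) * rayVal η (k + 1) (j + 3) = rayVal η (k + 2) j * rayVal η k j := by
  have h := congrArg (MvPolynomial.eval (toLattice η)) (ray_mul_ray k 0 j)
  simpa only [map_mul, eval_ray, show 3 * (0 : ℤ) + j = j by ring,
    show 3 * ((0 : ℤ) - 1) + j = j - 3 by ring, show 3 * ((0 : ℤ) + 1) + j = j + 3 by ring] using h

theorem octaVal_congr {η θ : ℤ → ℝ} {k : ℕ} {j : ℤ} (h : ∀ i, |i - j| + 6 ≤ 3 * k → η i = θ i) :
    octaVal η k j = octaVal θ k j := by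
  refine eval_octa_congr fun v hv => h _ ?_
  simp only [abs_eq_max_neg] at hv ⊢
  omega

theorem octaVal_eq_zero {η : ℤ → ℝ} (k u : ℕ) (hu : u < k) (j : ℤ)
    (h : ∀ t : ℕ, t < k → η (j + 3 * (k - 1) - 4 * u - 2 * t) = -1) :
    octaVal η (k + 1) j = 0 := by
  refine eval_octa_eq_zero k u hu 0 j fun t ht => ?_
  rw [toLattice, ← h t ht]
  congr 1
  ring

/-- Polynomials in variables attached to the integers outside `Z`, the values at the points of `Z`
being given by `w`. -/
def pinned (Z : Set ℤ) (w : ℤ → ℝ) : LatticePoly →+* MvPolynomial ℤ ℝ :=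
  open Classical in
  MvPolynomial.eval₂Hom MvPolynomial.C fun v =>
    if 3 * v.1 + v.2 ∈ Z then MvPolynomial.C (w (3 * v.1 + v.2))
    else MvPolynomial.X (3 * v.1 + v.2)

open Classical in
theorem eval_pinned (Z : Set ℤ) (w t : ℤ → ℝ) (p : LatticePoly) :
    MvPolynomial.eval t (pinned Z w p) =
      MvPolynomial.eval (toLattice fun z => if z ∈ Z then w z else t z) p := by
  have : (MvPolynomial.eval t).comp (pinned Z w) =
      MvPolynomial.eval (toLattice fun z => if z ∈ Z then w z else t z) := by
    ext v
    · simp [pinned]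
    · by_cases hv : 3 * v.1 + v.2 ∈ Z <;> simp [pinned, toLattice, hv]
  exact RingHom.congr_fun this p

/-- The parity condition puts `Z` in the class that is not scaled, so the values `-1` survive the
scaling. The column of the leading term becomes the set of indices `j + k - 1 - 2 * i`. -/
theorem exists_octaVal_ne_zero_of_antidiagonal (Z : Set ℤ) (k : ℕ) (j : ℤ)
    (h : ∀ i : ℕ, i < k → j + k - 1 - 2 * i ∉ Z) (hZ : ∀ z ∈ Z, Even (z + j + k + 1)) :
    ∃ η : ℤ → ℝ, (∀ z, η z ≠ 0) ∧ (∀ z ∈ Z, η z = -1) ∧ octaVal η (k + 1) j ≠ 0 := by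
  classical
  let θ : ℤ → ℝ := fun z => if z ∈ Z then -1 else 1
  have hθ : ∀ z, θ z ≠ 0 := by
    intro z
    simp only [θ]
    split_ifs <;> norm_num
  obtain ⟨r, hr, hne⟩ := exists_scale_eval_octa_ne_zero (η := toLattice θ) (fun v => hθ _)
    (j + k + 1) k 0 j ⟨j + k + 1, by ring⟩ (fun i hi => by
      have := h i hi
      simp only [toLattice, mul_zero, zero_add, θ, this, if_false]
      norm_num)
  refine ⟨fun z => if Even (z + (j + k + 1)) then θ z else θ z * r, ?_, ?_, ?_⟩
  · intro z
    simp only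
    split_ifs
    · exact hθ z
    · exact mul_ne_zero (hθ z) hr
  · intro z hz
    have := hZ z hz
    rw [add_assoc, add_assoc, ← add_assoc j] at this
    simp only [this, if_true, θ, hz]
  · convert hne using 2
    rw [octaVal]
    congr 1
    congr 1
    funext v
    simp only [toLattice]
    congr 1
    simp only [Int.even_iff, eq_iff_iff]
    omega

/-- A criterion for `octa` not to vanish identically on the set where the variables at the points of
`Z` equal `-1`, in terms of a block anti-diagonal permutation of the square of variables. -/
theorem exists_octaVal_ne_zero (Z : Set ℤ) (k r : ℕ) (hr : r ≤ k) (j : ℤ)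
    (hZ : ∀ z ∈ Z, Even (z + j + k + 1))
    (h₁ : ∀ i : ℕ, i < r → j + 3 * k - 2 * r - 1 - 2 * i ∉ Z)
    (h₂ : ∀ i : ℕ, i < k - r → j + k - 4 * r - 1 - 2 * i ∉ Z) :
    ∃ η : ℤ → ℝ, (∀ z, η z ≠ 0) ∧ (∀ z ∈ Z, η z = -1) ∧ octaVal η (k + 1) j ≠ 0 := by
  classical
  obtain ⟨p, rfl⟩ := Nat.exists_eq_add_of_le' hr
  rw [Nat.add_sub_cancel] at h₂
  push_cast at h₁ h₂ hZ
  obtain ⟨η₁, -, hZ₁, hn₁⟩ := exists_octaVal_ne_zero_of_antidiagonal Z r (j + 3 * p)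
    (fun i hi => by convert h₁ i hi using 3; ring)
    (fun z hz => by have := hZ z hz; rw [Int.even_iff] at this ⊢; omega)
  obtain ⟨η₂, -, hZ₂, hn₂⟩ := exists_octaVal_ne_zero_of_antidiagonal Z p (j - 3 * r)
    (fun i hi => by convert h₂ i hi using 3; ring)
    (fun z hz => by have := hZ z hz; rw [Int.even_iff] at this ⊢; omega)
  -- Setting the variable at `e` to zero splits `octa (p + r + 1)` into factors of levels `p + 1`
  -- and `r + 1`, one for each antidiagonal block. The index `e` has the parity opposite to that of
  -- `Z`, so this is compatible with the prescribed values.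
  set e : ℤ := j + 3 * p - 3 * r with he
  have heZ : e ∉ Z := fun h => by
    have := hZ e h
    rw [Int.even_iff] at this
    omega
  let w : ℤ → ℝ := fun z => if z = e then 0 else -1
  have hw : ∀ z ∈ Z, w z = -1 := fun z hz => if_neg (by rintro rfl; exact heZ hz)
  -- Both centres are at distance `3 * l` from `e`, beyond the reach `3 * l - 3` of the factor, so
  -- each factor remains a nonzero polynomial in the free variables.
  have key : ∀ (η : ℤ → ℝ) (l : ℕ) (c : ℤ), (∀ z ∈ Z, η z = -1) → octaVal η (l + 1) c ≠ 0 →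
      3 * (l : ℤ) ≤ |e - c| → pinned (insert e Z) w (octa (l + 1) 0 c) ≠ 0 := by
    intro η l c hη hne hl h0
    apply hne
    have := eval_pinned (insert e Z) w η (octa (l + 1) 0 c)
    rw [h0, map_zero] at this
    rw [this]
    refine octaVal_congr fun i hi => ?_
    push_cast at hi
    have hie : i ≠ e := by rintro rfl; omega
    by_cases hiZ : i ∈ Z
    · rw [if_pos (Set.mem_insert_of_mem _ hiZ), hη i hiZ, hw i hiZ]
    · rw [if_neg]
      simp [hie, hiZ]
  obtain ⟨t, -, ht⟩ := MvPolynomial_exists_eval_ne_zero (mul_ne_zero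
    (key η₂ p (j - 3 * r) hZ₂ hn₂ (by simp only [abs_eq_max_neg]; omega))
    (key η₁ r (j + 3 * p) hZ₁ hn₁ (by simp only [abs_eq_max_neg]; omega)))
  rw [map_mul, eval_pinned, eval_pinned] at ht
  set ζ : ℤ → ℝ := fun z => if z ∈ insert e Z then w z else t z with hζ
  have hsplit := eval_octa_split (η := toLattice ζ) p r 0 j (by
    have : (3 * ((0 : ℤ) + p - r) + j) = e := by omega
    simp only [toLattice, this, hζ]
    simp [w])
  rw [eval_octa, eval_octa, eval_octa] at hsplit
  have hζ0 : octaVal ζ (p + r + 1) j ≠ 0 := by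
    rw [eval_octa, eval_octa] at ht
    rw [show 3 * (0 : ℤ) + j = j by ring, show 3 * ((0 : ℤ) - r) + j = j - 3 * r by ring,
      show 3 * ((0 : ℤ) + p) + j = j + 3 * p by ring] at hsplit
    rw [hsplit]
    convert ht using 2 <;> (rw [mul_zero, zero_add, hζ]; congr!)
  -- The zero at `e` has served as a witness that the polynomial in all variables outside `Z` is
  -- nonzero; it can now be evaluated at a point without zero coordinates.
  have hpin : pinned Z (fun _ => -1) (octa (p + r + 1) 0 j) ≠ 0 := by
    intro h0
    apply hζ0
    have := eval_pinned Z (fun _ => -1) ζ (octa (p + r + 1) 0 j)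
    rw [h0, map_zero] at this
    rw [this]
    refine octaVal_congr fun i _ => ?_
    by_cases hi : i ∈ Z
    · simp [hζ, hi, hw i hi]
    · simp [hi]
  obtain ⟨τ, hτ, hne⟩ := MvPolynomial_exists_eval_ne_zero hpin
  rw [eval_pinned] at hne
  refine ⟨_, fun z => ?_, fun z hz => ?_, hne⟩
  · split_ifs
    · norm_num
    · exact hτ z
  · simp [hz]


/-! ### Homogeneous coordinates -/

/-- The determinant of three vectors. -/
def tri (u v w : Fin 3 → ℝ) : ℝ :=
  u 0 * (v 1 * w 2 - v 2 * w 1) - u 1 * (v 0 * w 2 - v 2 * w 0) + u 2 * (v 0 * w 1 - v 1 * w 0)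

theorem tri_rotate (u v w : Fin 3 → ℝ) : tri u v w = tri v w u := by
  simp only [tri]; ring

theorem tri_swap (u v w : Fin 3 → ℝ) : tri u v w = -tri v u w := by
  simp only [tri]; ring

theorem tri_swap_right (u v w : Fin 3 → ℝ) : tri u v w = -tri u w v := by
  simp only [tri]; ring

theorem tri_reverse (u v w : Fin 3 → ℝ) : tri u v w = -tri w v u := by
  simp only [tri]; ring

/-- The vector `u` is a vector of homogeneous coordinates of the point `p`. -/
def IsCoord (p : Plane) (u : Fin 3 → ℝ) : Prop := ∃ h : u ≠ 0, p = Projectivization.mk ℝ u h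

theorem isCoord_rep (p : Plane) : IsCoord p p.rep := ⟨p.rep_nonzero, p.mk_rep.symm⟩

theorem IsCoord.submodule {p : Plane} {u : Fin 3 → ℝ} (h : IsCoord p u) :
    p.submodule = Submodule.span ℝ {u} := by
  obtain ⟨h0, rfl⟩ := h
  rw [Projectivization.submodule_mk]

theorem IsCoord.mem {p : Plane} {u : Fin 3 → ℝ} (h : IsCoord p u) : u ∈ p.submodule := by
  rw [h.submodule]; exact Submodule.mem_span_singleton_self u

theorem isCoord_of_mem {p : Plane} {u : Fin 3 → ℝ} (h0 : u ≠ 0) (h : u ∈ p.submodule) :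
    IsCoord p u := by
  refine ⟨h0, ?_⟩
  rw [(isCoord_rep p).submodule, Submodule.mem_span_singleton] at h
  obtain ⟨t, rfl⟩ := h
  exact p.mk_rep.symm.trans
    ((Projectivization.mk_eq_mk_iff' ℝ _ _ p.rep_nonzero h0).2
      ⟨t⁻¹, inv_smul_smul₀ (fun ht => h0 (by rw [ht, zero_smul])) _⟩)

theorem linearIndependent_iff_tri (u v w : Fin 3 → ℝ) :
    LinearIndependent ℝ ![u, v, w] ↔ tri u v w ≠ 0 := by
  have : LinearIndependent ℝ ![u, v, w] ↔ IsUnit (Matrix.of ![u, v, w]) :=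
    Matrix.linearIndependent_rows_iff_isUnit (A := Matrix.of ![u, v, w])
  rw [this, Matrix.isUnit_iff_isUnit_det, isUnit_iff_ne_zero, Matrix.det_fin_three]
  have e : tri u v w = u 0 * v 1 * w 2 - u 0 * v 2 * w 1 - u 1 * v 0 * w 2 + u 1 * v 2 * w 0 +
      u 2 * v 0 * w 1 - u 2 * v 1 * w 0 := by
    simp only [tri]; ring
  rw [e]
  simp

theorem independent_iff_tri {p q r : Plane} {u v w : Fin 3 → ℝ} (hp : IsCoord p u)
    (hq : IsCoord q v) (hr : IsCoord r w) :
    Projectivization.Independent ![p, q, r] ↔ tri u v w ≠ 0 := by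
  have key : ∀ (p : Plane) (u : Fin 3 → ℝ), IsCoord p u → ∃ t : ℝ, t ≠ 0 ∧ p.rep = t • u := by
    intro p u h
    have := (isCoord_rep p).mem
    rw [h.submodule, Submodule.mem_span_singleton] at this
    obtain ⟨t, ht⟩ := this
    refine ⟨t, ?_, ht.symm⟩
    rintro rfl
    exact p.rep_nonzero (by rw [← ht, zero_smul])
  obtain ⟨a, ha, ea⟩ := key p u hp
  obtain ⟨b, hb, eb⟩ := key q v hq
  obtain ⟨c, hc, ec⟩ := key r w hr
  have e : Projectivization.rep ∘ ![p, q, r] = ![a • u, b • v, c • w] := by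
    funext i
    fin_cases i <;> simp [ea, eb, ec]
  rw [Projectivization.independent_iff, e, linearIndependent_iff_tri]
  have : tri (a • u) (b • v) (c • w) = a * b * c * tri u v w := by
    simp only [tri, Pi.smul_apply, smul_eq_mul]; ring
  rw [this, Ne, mul_eq_zero, not_or]
  exact ⟨fun h => h.2, fun h => ⟨mul_ne_zero (mul_ne_zero ha hb) hc, h⟩⟩

/-- Cramer's identity writes one vector both as a combination of `a, b` and as a combination of `c,
d`, so it lies on both lines. -/
theorem isCoord_meet {p q r s : Plane} {a b c d : Fin 3 → ℝ} (hp : IsCoord p a) (hq : IsCoord q b)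
    (hr : IsCoord r c) (hs : IsCoord s d) (h₁ : tri a b c ≠ 0) (h₂ : tri b c d ≠ 0) :
    IsCoord (meet (join p q) (join r s)) (tri a c d • b - tri b c d • a) := by
  have hrs : r ≠ s :=
    (ne_of_independent ((independent_iff_tri hq hr hs).2 h₂)).2.2
  obtain ⟨x, hx⟩ := meets_join ((independent_iff_tri hp hq hr).2 h₁) hrs
  rw [meet_eq hx]
  have mp : a ∈ join p q := Submodule.mem_sup_left hp.mem
  have mq : b ∈ join p q := Submodule.mem_sup_right hq.mem
  have mr : c ∈ join r s := Submodule.mem_sup_left hr.mem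
  have ms : d ∈ join r s := Submodule.mem_sup_right hs.mem
  refine isCoord_of_mem ?_ ?_
  · intro h0
    have : tri (tri a c d • b - tri b c d • a) b c = -(tri b c d * tri a b c) := by
      simp only [tri, Pi.sub_apply, Pi.smul_apply, smul_eq_mul]; ring
    rw [h0] at this
    have h3 : tri 0 b c = 0 := by simp [tri]
    rw [h3, eq_comm, neg_eq_zero] at this
    exact mul_ne_zero h₂ h₁ this
  · rw [hx]
    refine ⟨Submodule.sub_mem _ (Submodule.smul_mem _ _ mq) (Submodule.smul_mem _ _ mp), ?_⟩
    have : tri a c d • b - tri b c d • a = tri a b d • c - tri a b c • d := by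
      ext i
      fin_cases i <;> simp [tri] <;> ring
    rw [this]
    exact Submodule.sub_mem _ (Submodule.smul_mem _ _ mr) (Submodule.smul_mem _ _ ms)

/-- Coordinates on the line through `a` and `b`. -/
def lineChart (a b z : Fin 3 → ℝ) : (Fin 3 → ℝ) →ₗ[ℝ] (Fin 2 → ℝ) where
  toFun w := ![tri w b z, tri a w z]
  map_add' u v := by
    ext i
    fin_cases i <;> simp [tri] <;> ring
  map_smul' t u := by
    ext i
    fin_cases i <;> simp [tri] <;> ring

theorem crossRatio_of_coord {a b z : Fin 3 → ℝ} (hz : tri a b z ≠ 0) {p q r s : Plane}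
    {x₁ x₂ x₃ x₄ y₁ y₂ y₃ y₄ : ℝ} (hp : IsCoord p (x₁ • a + y₁ • b))
    (hq : IsCoord q (x₂ • a + y₂ • b)) (hr : IsCoord r (x₃ • a + y₃ • b))
    (hs : IsCoord s (x₄ • a + y₄ • b)) :
    crossRatio p q r s = ((x₁ * y₂ - y₁ * x₂) * (x₃ * y₄ - y₃ * x₄)) /
      ((x₂ * y₃ - y₂ * x₃) * (x₄ * y₁ - y₄ * x₁)) := by
  have hval : ∀ x y : ℝ, lineChart a b z (x • a + y • b) = ![x * tri a b z, y * tri a b z] := by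
    intro x y
    ext i
    fin_cases i <;> simp [lineChart, tri] <;> ring
  have hle : ∀ (p : Plane) (x y : ℝ), IsCoord p (x • a + y • b) →
      p.submodule ≤ Submodule.span ℝ {a, b} := by
    intro p x y h
    rw [h.submodule, Submodule.span_singleton_le_iff_mem]
    exact Submodule.mem_span_pair.2 ⟨x, y, rfl⟩
  have hchart : IsLineChart (lineChart a b z) p q r s := by
    have hd : Disjoint (LinearMap.ker (lineChart a b z)) (Submodule.span ℝ {a, b}) := by
      rw [Submodule.disjoint_def]
      intro w hw hw'
      obtain ⟨x, y, rfl⟩ := Submodule.mem_span_pair.1 hw'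
      rw [LinearMap.mem_ker, hval] at hw
      have e₀ := congrFun hw 0
      have e₁ := congrFun hw 1
      simp only [Matrix.cons_val_zero, Matrix.cons_val_one, Pi.zero_apply, mul_eq_zero, hz,
        or_false] at e₀ e₁
      simp [e₀, e₁]
    exact hd.mono_right (sup_le (sup_le (sup_le (hle _ _ _ hp) (hle _ _ _ hq)) (hle _ _ _ hr))
      (hle _ _ _ hs))
  obtain ⟨np, ep⟩ := hp
  obtain ⟨nq, eq⟩ := hq
  obtain ⟨nr, er⟩ := hr
  obtain ⟨ns, es⟩ := hs
  rw [crossRatio_eq hchart np nq nr ns ep eq er es, hval, hval, hval, hval]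
  have h4 : tri a b z ^ 4 ≠ 0 := pow_ne_zero _ hz
  simp only [crossRatioVec, det₂, Matrix.cons_val_zero, Matrix.cons_val_one]
  rw [← mul_div_mul_left ((x₁ * y₂ - y₁ * x₂) * _) _ h4]
  congr 1 <;> ring

/-- In the basis `a, b` of the line the cross ratio is a quotient of minors. The only one that is
not already a single product factors by a Plücker relation, `e₁`. -/
theorem chi_corner {pa pb pc pd pe : Plane} {a b c d e : Fin 3 → ℝ} (ha : IsCoord pa a)
    (hb : IsCoord pb b) (hc : IsCoord pc c) (hd : IsCoord pd d) (he : IsCoord pe e)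
    (h₁ : tri a b c ≠ 0) (h₂ : tri b c d ≠ 0) (h₃ : tri a b d ≠ 0) (h₄ : tri b d e ≠ 0) :
    chi pa pb (meet (join pa pb) (join pc pd)) (meet (join pa pb) (join pd pe)) =
      tri a b d * tri c d e / (tri a c d * tri b d e) := by
  have hB := isCoord_meet ha hb hc hd h₁ h₂
  have hD := isCoord_meet ha hb hd he h₃ h₄
  have hB' : IsCoord (meet (join pa pb) (join pc pd)) ((-tri b c d) • a + tri a c d • b) := by
    convert hB using 1
    rw [neg_smul]; abel
  have hD' : IsCoord (meet (join pa pb) (join pd pe)) ((-tri b d e) • a + tri a d e • b) := by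
    convert hD using 1
    rw [neg_smul]; abel
  have ha' : IsCoord pa ((1 : ℝ) • a + (0 : ℝ) • b) := by simpa using ha
  have hb' : IsCoord pb ((0 : ℝ) • a + (1 : ℝ) • b) := by simpa using hb
  rw [chi, crossRatio_of_coord h₁ hb' ha' hB' hD']
  have e₁ : tri a c d * tri b d e - tri b c d * tri a d e = tri a b d * tri c d e := by
    simp only [tri]; ring
  rw [← e₁, ← neg_div_neg_eq (tri a c d * tri b d e - _)]
  congr 1 <;> ring

/-! ### The coordinates in terms of determinants -/

/-- Four consecutive vectors are in general position. -/
structure GenVec (v : ℤ → Fin 3 → ℝ) : Prop where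
  consec : ∀ i j k, j = i + 1 → k = i + 2 → tri (v i) (v j) (v k) ≠ 0
  left : ∀ i j k, j = i + 1 → k = i + 3 → tri (v i) (v j) (v k) ≠ 0
  right : ∀ i j k, j = i + 2 → k = i + 3 → tri (v i) (v j) (v k) ≠ 0

theorem genVec_iff {p : ℤ → Plane} {v : ℤ → Fin 3 → ℝ} (h : ∀ i, IsCoord (p i) (v i)) :
    GenVec v ↔ ∀ i, GenPos (p i) (p (i + 1)) (p (i + 2)) (p (i + 3)) := by
  simp only [GenPos, independent_iff_tri (h _) (h _) (h _)]
  constructor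
  · intro g i
    exact ⟨g.consec _ _ _ rfl rfl, g.left _ _ _ rfl rfl, g.right _ _ _ rfl rfl,
      g.consec _ _ _ (by ring) (by ring)⟩
  · intro g
    refine ⟨?_, ?_, ?_⟩
    · rintro i j k rfl rfl; exact (g i).1
    · rintro i j k rfl rfl; exact (g i).2.1
    · rintro i j k rfl rfl; exact (g i).2.2.1

/-- `xFirst` as a function of homogeneous coordinates. -/
def vecFirst (v : ℤ → Fin 3 → ℝ) (i : ℤ) : ℝ :=
  tri (v (i - 2)) (v (i - 1)) (v (i + 1)) * tri (v i) (v (i + 1)) (v (i + 2)) /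
    (tri (v (i - 2)) (v i) (v (i + 1)) * tri (v (i - 1)) (v (i + 1)) (v (i + 2)))

/-- `xSecond` as a function of homogeneous coordinates. -/
def vecSecond (v : ℤ → Fin 3 → ℝ) (i : ℤ) : ℝ :=
  tri (v (i - 1)) (v (i + 1)) (v (i + 2)) * tri (v (i - 2)) (v (i - 1)) (v i) /
    (tri (v (i - 1)) (v i) (v (i + 2)) * tri (v (i - 2)) (v (i - 1)) (v (i + 1)))

theorem meet_comm (L M : Submodule ℝ (Fin 3 → ℝ)) : meet L M = meet M L := by
  rw [meet, meet, inf_comm]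

theorem join_comm (p q : Plane) : join p q = join q p := sup_comm _ _

section

variable {p : ℤ → Plane} {v : ℤ → Fin 3 → ℝ}

theorem xFirst_eq (h : ∀ i, IsCoord (p i) (v i)) (g : GenVec v) (i : ℤ) :
    xFirst p i = vecFirst v i :=
  chi_corner (h _) (h _) (h _) (h _) (h _) (g.consec _ _ _ (by ring) (by ring))
    (g.consec _ _ _ (by ring) (by ring)) (g.left _ _ _ (by ring) (by ring))
    (g.right _ _ _ (by ring) (by ring))

theorem xSecond_eq (h : ∀ i, IsCoord (p i) (v i)) (g : GenVec v) (i : ℤ) :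
    xSecond p i = vecSecond v i := by
  -- The second coordinate is the first one for the five points read in reverse order.
  rw [xSecond, meet_comm (join (p (i - 1)) _), meet_comm (join (p (i - 2)) _),
    join_comm (p (i + 1)), join_comm (p (i - 1)), join_comm (p (i - 2)),
    chi_corner (h _) (h _) (h _) (h _) (h _), vecSecond]
  · rw [tri_reverse (v (i + 2)) (v (i + 1)), tri_reverse (v i) (v (i - 1)),
      tri_reverse (v (i + 2)) (v i), tri_reverse (v (i + 1)) (v (i - 1))]
    congr 1 <;> ring
  · rw [tri_reverse]; exact neg_ne_zero.2 (g.consec _ _ _ (by ring) (by ring))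
  · rw [tri_reverse]; exact neg_ne_zero.2 (g.consec _ _ _ (by ring) (by ring))
  · rw [tri_reverse]; exact neg_ne_zero.2 (g.right _ _ _ (by ring) (by ring))
  · rw [tri_reverse]; exact neg_ne_zero.2 (g.left _ _ _ (by ring) (by ring))

/-- A Plücker relation isolates the determinant of `v (i - 2)`, `v i`, `v (i + 2)`, the only factor
that may vanish. It is also the factor that decides whether the image is in general position, so `1
- x x'` detects the obstruction to the pentagram map. -/
theorem one_sub_vecFirst_mul_vecSecond (g : GenVec v) (i : ℤ) :
    1 - vecFirst v i * vecSecond v i =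
      tri (v (i - 2)) (v i) (v (i + 2)) * tri (v (i - 1)) (v i) (v (i + 1)) /
        (tri (v (i - 2)) (v i) (v (i + 1)) * tri (v (i - 1)) (v i) (v (i + 2))) := by
  have h₁ := g.left (i - 2) (i - 1) (i + 1) (by ring) (by ring)
  have h₂ := g.right (i - 2) i (i + 1) (by ring) (by ring)
  have h₃ := g.right (i - 1) (i + 1) (i + 2) (by ring) (by ring)
  have h₄ := g.left (i - 1) i (i + 2) (by ring) (by ring)
  have e : tri (v (i - 2)) (v i) (v (i + 2)) * tri (v (i - 1)) (v i) (v (i + 1)) =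
      tri (v (i - 2)) (v i) (v (i + 1)) * tri (v (i - 1)) (v i) (v (i + 2)) -
      tri (v i) (v (i + 1)) (v (i + 2)) * tri (v (i - 2)) (v (i - 1)) (v i) := by
    simp only [tri]; ring
  rw [e, vecFirst, vecSecond]
  field_simp

/-! ### The pentagram map in homogeneous coordinates -/

/-- The cross product. -/
def cr (u v : Fin 3 → ℝ) : Fin 3 → ℝ :=
  ![u 1 * v 2 - u 2 * v 1, u 2 * v 0 - u 0 * v 2, u 0 * v 1 - u 1 * v 0]

/-- The lines `ab` and `bc` meet in `b`, so the cross product of the first two vectors is `tri a b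
c` times `b`. Used for vertices and again for diagonals, this factors all determinants of the image
polygon. -/
theorem tri_cr_cr_cr (a b c d e : Fin 3 → ℝ) :
    tri (cr a b) (cr b c) (cr d e) = tri a b c * tri b d e := by
  simp [tri, cr]; ring

/-- The diagonal through `v (i - 1)` and `v (i + 1)`. -/
def diagVec (v : ℤ → Fin 3 → ℝ) (i : ℤ) : Fin 3 → ℝ := cr (v (i - 1)) (v (i + 1))

/-- Homogeneous coordinates of the image under the pentagram map. -/
def pentVec (v : ℤ → Fin 3 → ℝ) (i : ℤ) : Fin 3 → ℝ := cr (diagVec v i) (diagVec v (i + 1))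

theorem isCoord_pentSeq (h : ∀ i, IsCoord (p i) (v i)) (g : GenVec v) (i : ℤ) :
    IsCoord (pentSeq p i) (pentVec v i) := by
  have := isCoord_meet (h (i - 1)) (h (i + 1)) (h i) (h (i + 2))
    (by rw [tri_swap_right]; exact neg_ne_zero.2 (g.consec _ _ _ (by ring) (by ring)))
    (by rw [tri_swap]; exact neg_ne_zero.2 (g.consec _ _ _ (by ring) (by ring)))
  rw [pentSeq]
  convert this using 1
  rw [pentVec, diagVec, diagVec, add_sub_cancel_right, show i + 1 + 1 = i + 2 by ring]
  ext j
  fin_cases j <;> simp [cr, tri] <;> ring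

theorem tri_diagVec_consec (i j k : ℤ) (hj : j = i + 1) (hk : k = i + 2) :
    tri (diagVec v i) (diagVec v j) (diagVec v k) =
      tri (v (i - 1)) (v (i + 1)) (v (i + 3)) * tri (v i) (v (i + 1)) (v (i + 2)) := by
  subst hj hk
  rw [tri_reverse, tri_rotate, tri_reverse, neg_neg, tri_rotate, tri_rotate, tri_reverse, diagVec,
    diagVec, diagVec, show i + 2 - 1 = i + 1 by ring, show i + 2 + 1 = i + 3 by ring,
    add_sub_cancel_right, show i + 1 + 1 = i + 2 by ring]
  simp [tri, cr]; ring

theorem tri_diagVec_left (i j k : ℤ) (hj : j = i + 1) (hk : k = i + 3) :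
    tri (diagVec v i) (diagVec v j) (diagVec v k) =
      tri (v i) (v (i + 2)) (v (i + 4)) * tri (v (i - 1)) (v (i + 1)) (v (i + 2)) := by
  subst hj hk
  rw [tri_rotate, diagVec, diagVec, diagVec, add_sub_cancel_right, show i + 1 + 1 = i + 2 by ring,
    show i + 3 - 1 = i + 2 by ring, show i + 3 + 1 = i + 4 by ring, tri_cr_cr_cr,
    tri_rotate (v (i + 2)) (v (i - 1))]

theorem tri_diagVec_right (i j k : ℤ) (hj : j = i + 2) (hk : k = i + 3) :
    tri (diagVec v i) (diagVec v j) (diagVec v k) =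
      tri (v (i - 1)) (v (i + 1)) (v (i + 3)) * tri (v (i + 1)) (v (i + 2)) (v (i + 4)) := by
  subst hj hk
  rw [diagVec, diagVec, diagVec, show i + 2 - 1 = i + 1 by ring, show i + 2 + 1 = i + 3 by ring,
    show i + 3 - 1 = i + 2 by ring, show i + 3 + 1 = i + 4 by ring, tri_cr_cr_cr]

theorem tri_pentVec_consec (i j k : ℤ) (hj : j = i + 1) (hk : k = i + 2) :
    tri (pentVec v i) (pentVec v j) (pentVec v k) =
      tri (v (i - 1)) (v (i + 1)) (v (i + 3)) * tri (v i) (v (i + 1)) (v (i + 2)) *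
        (tri (v i) (v (i + 2)) (v (i + 4)) * tri (v (i + 1)) (v (i + 2)) (v (i + 3))) := by
  subst hj hk
  rw [pentVec, pentVec, pentVec, tri_cr_cr_cr, tri_diagVec_consec _ _ _ rfl (by ring),
    tri_diagVec_consec _ _ _ (by ring) (by ring), add_sub_cancel_right,
    show i + 1 + 1 = i + 2 by ring, show i + 1 + 3 = i + 4 by ring, show i + 1 + 2 = i + 3 by ring]

theorem tri_pentVec_left (i j k : ℤ) (hj : j = i + 1) (hk : k = i + 3) :
    tri (pentVec v i) (pentVec v j) (pentVec v k) =
      tri (v (i - 1)) (v (i + 1)) (v (i + 3)) * tri (v i) (v (i + 1)) (v (i + 2)) *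
        (tri (v i) (v (i + 2)) (v (i + 4)) * tri (v (i + 2)) (v (i + 3)) (v (i + 5))) := by
  subst hj hk
  rw [pentVec, pentVec, pentVec, tri_cr_cr_cr, tri_diagVec_consec _ _ _ rfl (by ring),
    tri_diagVec_right _ _ _ (by ring) (by ring), add_sub_cancel_right,
    show i + 1 + 1 = i + 2 by ring, show i + 1 + 3 = i + 4 by ring, show i + 1 + 2 = i + 3 by ring,
    show i + 1 + 4 = i + 5 by ring]

theorem tri_pentVec_right (i j k : ℤ) (hj : j = i + 2) (hk : k = i + 3) :
    tri (pentVec v i) (pentVec v j) (pentVec v k) =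
      tri (v (i + 1)) (v (i + 3)) (v (i + 5)) * tri (v (i + 2)) (v (i + 3)) (v (i + 4)) *
        (tri (v i) (v (i + 2)) (v (i + 4)) * tri (v (i - 1)) (v (i + 1)) (v (i + 2))) := by
  subst hj hk
  rw [tri_rotate, show i + 3 = i + 2 + 1 by ring, pentVec, pentVec, pentVec, tri_cr_cr_cr,
    tri_diagVec_consec _ _ _ rfl (by ring), tri_rotate (diagVec v (i + 2 + 1)),
    tri_diagVec_left _ _ _ (by ring) (by ring), show i + 2 - 1 = i + 1 by ring,
    show i + 2 + 1 = i + 3 by ring, show i + 2 + 2 = i + 4 by ring, show i + 2 + 3 = i + 5 by ring]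

theorem genVec_pentVec (g : GenVec v)
    (hu : ∀ i, tri (v (i - 2)) (v i) (v (i + 2)) ≠ 0) : GenVec (pentVec v) := by
  have hu' : ∀ i j k : ℤ, j = i + 2 → k = i + 4 → tri (v i) (v j) (v k) ≠ 0 := by
    rintro i j k rfl rfl
    have := hu (i + 2)
    rwa [add_sub_cancel_right, show i + 2 + 2 = i + 4 by ring] at this
  refine ⟨fun i j k hj hk => ?_, fun i j k hj hk => ?_, fun i j k hj hk => ?_⟩
  · rw [tri_pentVec_consec i j k hj hk]
    exact mul_ne_zero (mul_ne_zero (hu' _ _ _ (by ring) (by ring))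
      (g.consec _ _ _ (by ring) (by ring))) (mul_ne_zero (hu' _ _ _ (by ring) (by ring))
      (g.consec _ _ _ (by ring) (by ring)))
  · rw [tri_pentVec_left i j k hj hk]
    exact mul_ne_zero (mul_ne_zero (hu' _ _ _ (by ring) (by ring))
      (g.consec _ _ _ (by ring) (by ring))) (mul_ne_zero (hu' _ _ _ (by ring) (by ring))
      (g.left _ _ _ (by ring) (by ring)))
  · rw [tri_pentVec_right i j k hj hk]
    exact mul_ne_zero (mul_ne_zero (hu' _ _ _ (by ring) (by ring))
      (g.consec _ _ _ (by ring) (by ring))) (mul_ne_zero (hu' _ _ _ (by ring) (by ring))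
      (g.right _ _ _ (by ring) (by ring)))

theorem tri_ne_zero_of_genVec_pentVec (g : GenVec (pentVec v)) (i : ℤ) :
    tri (v (i - 2)) (v i) (v (i + 2)) ≠ 0 := by
  have := g.consec (i - 1) i (i + 1) (by ring) (by ring)
  rw [tri_pentVec_consec _ _ _ (by ring) (by ring), show i - 1 - 1 = i - 2 by ring,
    sub_add_cancel, show i - 1 + 3 = i + 2 by ring] at this
  exact left_ne_zero_of_mul (left_ne_zero_of_mul this)

theorem vecFirst_pentVec (g : GenVec v) (g' : GenVec (pentVec v)) (i : ℤ) :
    vecFirst (pentVec v) i = vecFirst v i *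
      ((1 - vecFirst v (i - 1) * vecSecond v (i - 1)) /
        (1 - vecFirst v (i + 1) * vecSecond v (i + 1))) := by
  rw [one_sub_vecFirst_mul_vecSecond g, one_sub_vecFirst_mul_vecSecond g, vecFirst, vecFirst,
    tri_pentVec_left (i - 2) _ _ (by ring) (by ring),
    tri_pentVec_consec i _ _ (by ring) (by ring),
    tri_pentVec_right (i - 2) _ _ (by ring) (by ring),
    tri_pentVec_right (i - 1) _ _ (by ring) (by ring)]
  simp only [show i - 2 - 1 = i - 3 by ring, show i - 2 + 1 = i - 1 by ring,
    show i - 2 + 3 = i + 1 by ring, show i - 2 + 2 = i by ring, show i - 2 + 4 = i + 2 by ring,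
    show i - 2 + 5 = i + 3 by ring, show i - 1 - 1 = i - 2 by ring, show i - 1 + 1 = i by ring,
    show i - 1 + 2 = i + 1 by ring, show i - 1 + 3 = i + 2 by ring, show i - 1 + 4 = i + 3 by ring,
    show i - 1 + 5 = i + 4 by ring, show i - 1 - 2 = i - 3 by ring, show i + 1 - 2 = i - 1 by ring,
    show i + 1 + 2 = i + 3 by ring, show i + 1 - 1 = i by ring, show i + 1 + 1 = i + 2 by ring]
  have d := tri_ne_zero_of_genVec_pentVec g'
  have d₁ := d (i - 1)
  have d₂ := d i
  have d₃ := d (i + 1)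
  have d₄ := d (i + 2)
  simp only [show i - 1 - 2 = i - 3 by ring, show i - 1 + 2 = i + 1 by ring,
    show i + 1 - 2 = i - 1 by ring, show i + 1 + 2 = i + 3 by ring, show i + 2 + 2 = i + 4 by ring,
    show i + 2 - 2 = i by ring] at d₁ d₂ d₃ d₄
  have a₁ := g.consec (i - 2) (i - 1) i (by ring) (by ring)
  have a₂ := g.consec (i - 1) i (i + 1) (by ring) (by ring)
  have a₃ := g.consec i (i + 1) (i + 2) (by ring) (by ring)
  have a₄ := g.consec (i + 1) (i + 2) (i + 3) (by ring) (by ring)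
  have b₁ := g.left (i - 3) (i - 2) i (by ring) (by ring)
  have b₂ := g.left (i - 2) (i - 1) (i + 1) (by ring) (by ring)
  have b₃ := g.left (i - 1) i (i + 2) (by ring) (by ring)
  have b₄ := g.left i (i + 1) (i + 3) (by ring) (by ring)
  have c₁ := g.right (i - 3) (i - 1) i (by ring) (by ring)
  have c₂ := g.right (i - 2) i (i + 1) (by ring) (by ring)
  have c₃ := g.right (i - 1) (i + 1) (i + 2) (by ring) (by ring)
  have c₄ := g.right i (i + 2) (i + 3) (by ring) (by ring)
  field_simp

theorem vecSecond_pentVec (g : GenVec v) (g' : GenVec (pentVec v)) (i : ℤ) :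
    vecSecond (pentVec v) i = vecSecond v (i + 1) *
      ((1 - vecFirst v (i + 2) * vecSecond v (i + 2)) /
        (1 - vecFirst v i * vecSecond v i)) := by
  rw [one_sub_vecFirst_mul_vecSecond g, one_sub_vecFirst_mul_vecSecond g, vecSecond, vecSecond,
    tri_pentVec_right (i - 1) _ _ (by ring) (by ring),
    tri_pentVec_consec (i - 2) _ _ (by ring) (by ring),
    tri_pentVec_left (i - 1) _ _ (by ring) (by ring),
    tri_pentVec_left (i - 2) _ _ (by ring) (by ring)]
  simp only [show i - 2 - 1 = i - 3 by ring, show i - 2 + 1 = i - 1 by ring,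
    show i - 2 + 3 = i + 1 by ring, show i - 2 + 2 = i by ring, show i - 2 + 4 = i + 2 by ring,
    show i - 2 + 5 = i + 3 by ring, show i - 1 - 1 = i - 2 by ring, show i - 1 + 1 = i by ring,
    show i - 1 + 2 = i + 1 by ring, show i - 1 + 3 = i + 2 by ring, show i - 1 + 4 = i + 3 by ring,
    show i - 1 + 5 = i + 4 by ring, show i + 1 - 2 = i - 1 by ring,
    show i + 1 + 2 = i + 3 by ring, show i + 1 - 1 = i by ring, show i + 1 + 1 = i + 2 by ring,
    show i + 2 - 2 = i by ring, show i + 2 + 2 = i + 4 by ring, show i + 2 - 1 = i + 1 by ring,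
    show i + 2 + 1 = i + 3 by ring]
  have d := tri_ne_zero_of_genVec_pentVec g'
  have d₁ := d (i - 1)
  have d₂ := d i
  have d₃ := d (i + 1)
  have d₄ := d (i + 2)
  simp only [show i - 1 - 2 = i - 3 by ring, show i - 1 + 2 = i + 1 by ring,
    show i + 1 - 2 = i - 1 by ring, show i + 1 + 2 = i + 3 by ring, show i + 2 + 2 = i + 4 by ring,
    show i + 2 - 2 = i by ring] at d₁ d₂ d₃ d₄
  have a₁ := g.consec (i - 2) (i - 1) i (by ring) (by ring)
  have a₂ := g.consec (i - 1) i (i + 1) (by ring) (by ring)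
  have a₃ := g.consec i (i + 1) (i + 2) (by ring) (by ring)
  have a₄ := g.consec (i + 1) (i + 2) (i + 3) (by ring) (by ring)
  have b₁ := g.left (i - 3) (i - 2) i (by ring) (by ring)
  have b₂ := g.left (i - 2) (i - 1) (i + 1) (by ring) (by ring)
  have b₃ := g.left (i - 1) i (i + 2) (by ring) (by ring)
  have b₄ := g.left i (i + 1) (i + 3) (by ring) (by ring)
  have b₅ := g.left (i + 1) (i + 2) (i + 4) (by ring) (by ring)
  have c₁ := g.right (i - 3) (i - 1) i (by ring) (by ring)
  have c₂ := g.right (i - 2) i (i + 1) (by ring) (by ring)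
  have c₃ := g.right (i - 1) (i + 1) (i + 2) (by ring) (by ring)
  have c₄ := g.right i (i + 2) (i + 3) (by ring) (by ring)
  field_simp

end


/-! ### Coordinates of polygons -/

theorem xSeq_even (c : ℤ) (p : ℤ → Plane) {a i : ℤ} (h : a = 2 * i + c) :
    xSeq c p a = xFirst p i := by
  have h1 : a - c = 2 * i := by omega
  rw [xSeq, h1, if_pos (even_two_mul i), Int.mul_ediv_cancel_left _ (by norm_num)]

theorem xSeq_odd (c : ℤ) (p : ℤ → Plane) {a i : ℤ} (h : a = 2 * i + c + 1) :
    xSeq c p a = xSecond p i := by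
  have h1 : a - c = 2 * i + 1 := by omega
  rw [xSeq, h1, if_neg (Int.not_even_two_mul_add_one i), add_sub_cancel_right,
    Int.mul_ediv_cancel_left _ (by norm_num)]

/-- Homogeneous coordinates of the vertices. -/
def TwistedPolygon.vec {n : ℕ} (A : TwistedPolygon n) (i : ℤ) : Fin 3 → ℝ := (A.vertex i).rep

theorem TwistedPolygon.isCoord_vec {n : ℕ} (A : TwistedPolygon n) (i : ℤ) :
    IsCoord (A.vertex i) (A.vec i) := isCoord_rep _

theorem TwistedPolygon.genVec {n : ℕ} (A : TwistedPolygon n) : GenVec A.vec :=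
  (genVec_iff A.isCoord_vec).2 A.genPos

theorem vecFirst_ne_zero {v : ℤ → Fin 3 → ℝ} (g : GenVec v) (i : ℤ) : vecFirst v i ≠ 0 :=
  div_ne_zero (mul_ne_zero (g.left _ _ _ (by ring) (by ring)) (g.consec _ _ _ (by ring) (by ring)))
    (mul_ne_zero (g.right _ _ _ (by ring) (by ring)) (g.right _ _ _ (by ring) (by ring)))

theorem vecSecond_ne_zero {v : ℤ → Fin 3 → ℝ} (g : GenVec v) (i : ℤ) : vecSecond v i ≠ 0 :=
  div_ne_zero (mul_ne_zero (g.right _ _ _ (by ring) (by ring)) (g.consec _ _ _ (by ring) (by ring)))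
    (mul_ne_zero (g.left _ _ _ (by ring) (by ring)) (g.left _ _ _ (by ring) (by ring)))

theorem exists_eq_of_even_or_odd (c a : ℤ) : (∃ i, a = 2 * i + c) ∨ ∃ i, a = 2 * i + c + 1 := by
  rcases Int.even_or_odd' (a - c) with ⟨i, h | h⟩
  · exact Or.inl ⟨i, by omega⟩
  · exact Or.inr ⟨i, by omega⟩

theorem x_ne_zero {n : ℕ} (c : ℤ) (A : PolygonSpace n) (a : ℤ) : x c A a ≠ 0 := by
  induction A using Quotient.inductionOn with
  | h A =>
    change xSeq c A.vertex a ≠ 0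
    rcases exists_eq_of_even_or_odd c a with ⟨i, h⟩ | ⟨i, h⟩
    · rw [xSeq_even c _ h, xFirst_eq A.isCoord_vec A.genVec]
      exact vecFirst_ne_zero A.genVec i
    · rw [xSeq_odd c _ h, xSecond_eq A.isCoord_vec A.genVec]
      exact vecSecond_ne_zero A.genVec i

theorem x_add_two_mul {n : ℕ} (c : ℤ) (A : PolygonSpace n) (a : ℤ) :
    x c A (a + 2 * n) = x c A a := by
  induction A using Quotient.inductionOn with
  | h A =>
    change xSeq c A.vertex (a + 2 * n) = xSeq c A.vertex a
    obtain ⟨φ, hφ⟩ := A.twisted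
    let A' : TwistedPolygon n :=
      { vertex := fun i => A.vertex (i + n)
        twisted := ⟨φ, fun i => hφ _⟩
        genPos := fun i => by
          have := A.genPos (i + n)
          rwa [add_right_comm i (n : ℤ) 1, add_right_comm i (n : ℤ) 2,
            add_right_comm i (n : ℤ) 3] at this }
    have h : A ≈ A' := ⟨φ, fun i => (hφ i).symm⟩
    have hx : ∀ b, xSeq c A.vertex b = xSeq c A'.vertex b := congrFun (xSeq_congr c h)
    rw [hx a]
    rcases exists_eq_of_even_or_odd c a with ⟨i, h⟩ | ⟨i, h⟩
    · rw [xSeq_even c _ h, xSeq_even (i := i + n) c _ (by omega), xFirst, xFirst]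
      simp only [A', sub_add_eq_add_sub, add_right_comm]
    · rw [xSeq_odd c _ h, xSeq_odd (i := i + n) c _ (by omega), xSecond, xSecond]
      simp only [A', sub_add_eq_add_sub, add_right_comm]

/-! ### The pentagram map in coordinates -/

/-- The quantities whose vanishing obstructs the pentagram map. -/
def stepU (X : ℤ → ℝ) (a : ℤ) : ℝ := 1 - X a * X (a + 1)

/-- The pentagram map in coordinates. -/
def pentStep (c : ℤ) (X : ℤ → ℝ) (a : ℤ) : ℝ :=
  if Even (a - (c + 1)) then X (a - 1) * (stepU X (a - 3) / stepU X (a + 1))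
  else X (a + 1) * (stepU X (a + 2) / stepU X (a - 2))

theorem pentSeq_smul {n : ℕ} (A : TwistedPolygon n)
    (hu : ∀ i, tri (A.vec (i - 1)) (A.vec i) (A.vec (i + 1)) ≠ 0) (ψ : ProjTrans) (i : ℤ) :
    pentSeq (fun j => ψ • A.vertex j) i = ψ • pentSeq A.vertex i := by
  rw [pentSeq, pentSeq, meet_join_smul]
  · rw [independent_iff_tri (A.isCoord_vec _) (A.isCoord_vec _) (A.isCoord_vec _), tri_swap_right]
    exact neg_ne_zero.2 (hu i)
  · exact (ne_of_independent ((independent_iff_tri (A.isCoord_vec _) (A.isCoord_vec _)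
      (A.isCoord_vec _)).2 (A.genVec.consec i (i + 1) (i + 2) rfl rfl))).2.1

theorem stepU_xSeq {n : ℕ} (c : ℤ) (A : TwistedPolygon n) {a i : ℤ} (h : a = 2 * i + c) :
    stepU (xSeq c A.vertex) a = 1 - vecFirst A.vec i * vecSecond A.vec i := by
  rw [stepU, xSeq_even c _ h, xSeq_odd (i := i) c _ (by omega), xFirst_eq A.isCoord_vec A.genVec,
    xSecond_eq A.isCoord_vec A.genVec]

theorem isPent_stepU_ne_zero_and_x {n : ℕ} (c : ℤ) {A B : PolygonSpace n} (h : IsPent A B) :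
    (∀ a, Even (a - c) → stepU (x c A) a ≠ 0) ∧ x (c + 1) B = pentStep c (x c A) := by
  obtain ⟨A, B, rfl, rfl, hB⟩ := h
  change (∀ a, Even (a - c) → stepU (xSeq c A.vertex) a ≠ 0) ∧
    xSeq (c + 1) B.vertex = pentStep c (xSeq c A.vertex)
  have hW : ∀ i, IsCoord (B.vertex i) (pentVec A.vec i) := by
    rw [hB]; exact isCoord_pentSeq A.isCoord_vec A.genVec
  have gW : GenVec (pentVec A.vec) := (genVec_iff hW).2 B.genPos
  constructor
  · intro a ha
    obtain ⟨i, hi⟩ := ha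
    rw [stepU_xSeq (i := i) c A (by omega), one_sub_vecFirst_mul_vecSecond A.genVec]
    exact div_ne_zero (mul_ne_zero (tri_ne_zero_of_genVec_pentVec gW i)
      (A.genVec.consec _ _ _ (by ring) (by ring)))
      (mul_ne_zero (A.genVec.right _ _ _ (by ring) (by ring))
      (A.genVec.left _ _ _ (by ring) (by ring)))
  · funext a
    rcases exists_eq_of_even_or_odd (c + 1) a with ⟨i, h⟩ | ⟨i, h⟩
    · rw [pentStep, if_pos ⟨i, by omega⟩, xSeq_even (c + 1) _ h, xFirst_eq hW gW,
        vecFirst_pentVec A.genVec gW, stepU_xSeq (i := i - 1) c A (by omega),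
        stepU_xSeq (i := i + 1) c A (by omega), xSeq_even (i := i) c _ (by omega),
        xFirst_eq A.isCoord_vec A.genVec]
    · have hn : ¬ Even (a - (c + 1)) := by rw [Int.not_even_iff_odd]; exact ⟨i, by omega⟩
      rw [pentStep, if_neg hn, xSeq_odd (c + 1) _ h, xSecond_eq hW gW,
        vecSecond_pentVec A.genVec gW, stepU_xSeq (i := i + 2) c A (by omega),
        stepU_xSeq (i := i) c A (by omega), xSeq_odd (i := i + 1) c _ (by omega),
        xSecond_eq A.isCoord_vec A.genVec]

theorem exists_isPent {n : ℕ} (c : ℤ) (A : PolygonSpace n)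
    (h : ∀ a, Even (a - c) → stepU (x c A) a ≠ 0) : ∃ B, IsPent A B := by
  induction A using Quotient.inductionOn with
  | h A =>
    change ∀ a, Even (a - c) → stepU (xSeq c A.vertex) a ≠ 0 at h
    have hu : ∀ i, tri (A.vec (i - 2)) (A.vec i) (A.vec (i + 2)) ≠ 0 := by
      intro i
      have := h (2 * i + c) ⟨i, by ring⟩
      rw [stepU_xSeq (i := i) c A rfl, one_sub_vecFirst_mul_vecSecond A.genVec] at this
      exact left_ne_zero_of_mul (div_ne_zero_iff.1 this).1
    have hW : ∀ i, IsCoord (pentSeq A.vertex i) (pentVec A.vec i) :=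
      isCoord_pentSeq A.isCoord_vec A.genVec
    let B : TwistedPolygon n :=
      { vertex := pentSeq A.vertex
        twisted := by
          obtain ⟨φ, hφ⟩ := A.twisted
          refine ⟨φ, fun i => ?_⟩
          rw [← pentSeq_smul A (fun i => A.genVec.consec _ _ _ (by ring) (by ring)), pentSeq,
            pentSeq]
          simp only [← hφ, sub_add_eq_add_sub, add_right_comm]
        genPos := (genVec_iff hW).1 (genVec_pentVec A.genVec hu) }
    exact ⟨⟦B⟧, A, B, rfl, rfl, rfl⟩

/-! ### Polygons with given coordinates -/

theorem exists_int_seq_mul {G : Type*} [Group G] (M : ℤ → G) :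
    ∃ Q : ℤ → G, Q 0 = 1 ∧ ∀ i, Q (i + 1) = Q i * M i := by
  let f : ℕ → G := fun k => Nat.rec 1 (fun j g => g * M j) k
  let g : ℕ → G := fun k => Nat.rec 1 (fun j h => h * (M (-(j + 1 : ℕ)))⁻¹) k
  refine ⟨fun i => if 0 ≤ i then f i.toNat else g (-i).toNat, by simp [f], fun i => ?_⟩
  rcases lt_or_ge i 0 with hi | hi
  · obtain ⟨j, rfl⟩ : ∃ j : ℕ, i = -(j + 1 : ℕ) := ⟨(-i).toNat - 1, by omega⟩
    have e : (if 0 ≤ -((j + 1 : ℕ) : ℤ) then f (-((j + 1 : ℕ) : ℤ)).toNat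
        else g (- -((j + 1 : ℕ) : ℤ)).toNat) = g (j + 1) := by
      rw [if_neg (by omega), neg_neg, Int.toNat_natCast]
    have e' : (if 0 ≤ -((j + 1 : ℕ) : ℤ) + 1 then f (-((j + 1 : ℕ) : ℤ) + 1).toNat
        else g (-(-((j + 1 : ℕ) : ℤ) + 1)).toNat) = g j := by
      rcases Nat.eq_zero_or_pos j with rfl | hj
      · simp [f, g]
      · rw [if_neg (by omega)]
        congr 1
        omega
    simp only [e, e']
    exact (inv_mul_cancel_right _ _).symm
  · obtain ⟨j, rfl⟩ := Int.eq_ofNat_of_zero_le hi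
    have e : ((j : ℤ) + 1).toNat = j + 1 := by omega
    simp only [if_pos hi, if_pos (by omega : (0 : ℤ) ≤ j + 1), e, Int.toNat_natCast]
    rfl

/-- Here `Q n` is the monodromy of the periodic product; it acts on the left and becomes the
projective transformation of a twisted polygon. -/
theorem int_seq_mul_add {G : Type*} [Group G] {M Q : ℤ → G} (h₀ : Q 0 = 1)
    (h : ∀ i, Q (i + 1) = Q i * M i) {n : ℤ} (hM : ∀ i, M (i + n) = M i) (i : ℤ) :
    Q (i + n) = Q n * Q i := by
  induction i using Int.induction_on with
  | zero => rw [zero_add, h₀, mul_one]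
  | succ i ih => rw [add_right_comm, h, h, ih, hM, mul_assoc]
  | pred i ih =>
    have e₁ := h (-i - 1 + n)
    have e₂ := h (-i - 1)
    rw [hM, add_right_comm, sub_add_cancel, ih] at e₁
    rw [sub_add_cancel] at e₂
    rw [e₂, ← mul_assoc] at e₁
    exact (mul_right_cancel e₁).symm

/-- The companion matrix of the recurrence `v₃ = v₂ + b v₁ + c v₀`. -/
def companion (b c : ℝ) (hc : c ≠ 0) : ProjTrans where
  toFun w := ![c * w 2, w 0 + b * w 2, w 1 + w 2]
  invFun w := ![w 1 - b * (w 0 / c), w 2 - w 0 / c, w 0 / c]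
  map_add' u v := by ext i; fin_cases i <;> simp <;> ring
  map_smul' t u := by ext i; fin_cases i <;> simp <;> ring
  left_inv w := by
    ext i
    fin_cases i <;> simp <;> field_simp
    all_goals ring
  right_inv w := by ext i; fin_cases i <;> simp <;> field_simp

/-- The columns of `Q i` are `v i`, `v (i + 1)`, `v (i + 2)`, and multiplication by a companion
matrix on the right shifts this frame by one. -/
theorem exists_linear_recurrence (b c : ℤ → ℝ) (hc : ∀ i, c i ≠ 0) {n : ℤ}
    (hbn : ∀ i, b (i + n) = b i) (hcn : ∀ i, c (i + n) = c i) :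
    ∃ (v : ℤ → Fin 3 → ℝ) (φ : ProjTrans), (∀ i, v (i + n) = φ (v i)) ∧
      (∀ i, v (i + 3) = v (i + 2) + b i • v (i + 1) + c i • v i) ∧
      ∀ i, tri (v i) (v (i + 1)) (v (i + 2)) ≠ 0 := by
  obtain ⟨Q, h₀, h⟩ := exists_int_seq_mul fun i => companion (b i) (c i) (hc i)
  have hn := int_seq_mul_add (n := n) h₀ h (fun i => by simp only [hbn, hcn])
  have e₁ : ∀ i, Q (i + 1) ![1, 0, 0] = Q i ![0, 1, 0] := by
    intro i
    rw [h, LinearEquiv.mul_apply]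
    congr 1
    ext j; fin_cases j <;> simp [companion]
  have e₂ : ∀ i, Q (i + 1) ![0, 1, 0] = Q i ![0, 0, 1] := by
    intro i
    rw [h, LinearEquiv.mul_apply]
    congr 1
    ext j; fin_cases j <;> simp [companion]
  have e₃ : ∀ i, Q (i + 1) ![0, 0, 1] =
      Q i ![0, 0, 1] + b i • Q i ![0, 1, 0] + c i • Q i ![1, 0, 0] := by
    intro i
    rw [h, LinearEquiv.mul_apply, ← map_smul, ← map_smul, ← map_add, ← map_add]
    congr 1
    ext j; fin_cases j <;> simp [companion]
  have v₂ : ∀ i, Q (i + 2) ![1, 0, 0] = Q i ![0, 0, 1] := by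
    intro i
    rw [show i + 2 = i + 1 + 1 by ring, e₁, e₂]
  refine ⟨fun i => Q i ![1, 0, 0], Q n, fun i => ?_, fun i => ?_, fun i => ?_⟩
  · simp only [hn]; rfl
  · simp only
    rw [show i + 3 = i + 1 + 2 by ring, v₂, v₂, e₁, e₃]
  · simp only
    rw [e₁, v₂, ← linearIndependent_iff_tri]
    have hl : LinearIndependent ℝ ![(![1, 0, 0] : Fin 3 → ℝ), ![0, 1, 0], ![0, 0, 1]] := by
      rw [linearIndependent_iff_tri]; simp [tri]
    have := hl.map' (Q i : (Fin 3 → ℝ) →ₗ[ℝ] (Fin 3 → ℝ)) (LinearEquiv.ker _)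
    have e : (Q i : (Fin 3 → ℝ) →ₗ[ℝ] (Fin 3 → ℝ)) ∘ ![![1, 0, 0], ![0, 1, 0], ![0, 0, 1]] =
        ![Q i ![1, 0, 0], Q i ![0, 1, 0], Q i ![0, 0, 1]] := by
      funext j
      fin_cases j <;> rfl
    rwa [e] at this

/-- With the coefficient of `v (i + 2)` equal to 1, every determinant in the coordinates is an
explicit multiple of one of three consecutive vectors. The other two coefficients are then chosen so
that the quotients give `f` and `z`. -/
theorem exists_polygon {n : ℕ} (c : ℤ) (X : ℤ → ℝ) (hX : ∀ a, X a ≠ 0)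
    (hper : ∀ a, X (a + 2 * n) = X a) : ∃ A : PolygonSpace n, x c A = X := by
  let f : ℤ → ℝ := fun i => X (2 * i + c)
  let z : ℤ → ℝ := fun i => X (2 * i + c + 1)
  have hf : ∀ i, f i ≠ 0 := fun i => hX _
  have hz : ∀ i, z i ≠ 0 := fun i => hX _
  have hfn : ∀ i, f (i + n) = f i := fun i => by
    change X _ = X _
    rw [← hper (2 * i + c)]; congr 1; ring
  have hzn : ∀ i, z (i + n) = z i := fun i => by
    change X _ = X _
    rw [← hper (2 * i + c + 1)]; congr 1; ring
  obtain ⟨v, φ, hφ, hrec, htri⟩ := exists_linear_recurrence (n := n) (fun i => -z (i + 1))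
    (fun i => f (i + 1) * z i * z (i + 1))
    (fun i => mul_ne_zero (mul_ne_zero (hf _) (hz _)) (hz _))
    (fun i => by simp only [add_right_comm i (n : ℤ), hzn])
    (fun i => by simp only [add_right_comm i (n : ℤ), hzn, hfn])
  have t₁ : ∀ i j k l : ℤ, j = i + 1 → k = i + 2 → l = i + 3 →
      tri (v i) (v j) (v l) = tri (v i) (v j) (v k) := by
    rintro i j k l rfl rfl rfl
    rw [hrec]; simp only [tri, Pi.add_apply, Pi.smul_apply, smul_eq_mul]; ring
  have t₂ : ∀ i j k l : ℤ, j = i + 1 → k = i + 2 → l = i + 3 →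
      tri (v i) (v k) (v l) = z j * tri (v i) (v j) (v k) := by
    rintro i j k l rfl rfl rfl
    rw [hrec]; simp only [tri, Pi.add_apply, Pi.smul_apply, smul_eq_mul]; ring
  have t₃ : ∀ i j k l : ℤ, j = i + 1 → k = i + 2 → l = i + 3 →
      tri (v j) (v k) (v l) = f j * z i * z j * tri (v i) (v j) (v k) := by
    rintro i j k l rfl rfl rfl
    rw [hrec]; simp only [tri, Pi.add_apply, Pi.smul_apply, smul_eq_mul]; ring
  have g : GenVec v := by
    refine ⟨fun i j k hj hk => ?_, fun i j k hj hk => ?_, fun i j k hj hk => ?_⟩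
    · subst hj hk; exact htri i
    · rw [t₁ i j (i + 2) k hj rfl hk]
      subst hj; exact htri i
    · rw [t₂ i (i + 1) j k rfl hj hk]
      subst hj; exact mul_ne_zero (hz _) (htri i)
  have hv : ∀ i, v i ≠ 0 := by
    intro i h
    apply htri i
    rw [h]; simp [tri]
  have hc : ∀ i, IsCoord (Projectivization.mk ℝ (v i) (hv i)) (v i) := fun i => ⟨hv i, rfl⟩
  let A : TwistedPolygon n :=
    { vertex := fun i => Projectivization.mk ℝ (v i) (hv i)
      twisted := ⟨φ, fun i => by
        simp only [hφ]
        rw [Projectivization.smul_mk]; rfl⟩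
      genPos := (genVec_iff hc).1 g }
  refine ⟨⟦A⟧, ?_⟩
  change xSeq c A.vertex = X
  funext a
  rcases exists_eq_of_even_or_odd c a with ⟨i, h⟩ | ⟨i, h⟩
  · rw [xSeq_even c _ h, xFirst_eq hc g, vecFirst,
      t₁ (i - 2) (i - 1) i (i + 1) (by ring) (by ring) (by ring),
      t₂ (i - 2) (i - 1) i (i + 1) (by ring) (by ring) (by ring),
      t₂ (i - 1) i (i + 1) (i + 2) (by ring) (by ring) (by ring),
      t₃ (i - 1) i (i + 1) (i + 2) (by ring) (by ring) (by ring)]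
    have d₁ := g.consec (i - 2) (i - 1) i (by ring) (by ring)
    have d₂ := g.consec (i - 1) i (i + 1) (by ring) (by ring)
    have z₁ := hz (i - 1)
    have z₂ := hz i
    have e : X a = f i := by rw [h]
    rw [e]
    field_simp
  · rw [xSeq_odd c _ h, xSecond_eq hc g, vecSecond,
      t₁ (i - 2) (i - 1) i (i + 1) (by ring) (by ring) (by ring),
      t₂ (i - 1) i (i + 1) (i + 2) (by ring) (by ring) (by ring),
      t₁ (i - 1) i (i + 1) (i + 2) (by ring) (by ring) (by ring)]
    have d₁ := g.consec (i - 2) (i - 1) i (by ring) (by ring)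
    have d₂ := g.consec (i - 1) i (i + 1) (by ring) (by ring)
    have e : X a = z i := by rw [h]
    rw [e]
    field_simp

/-! ### Iterates of the pentagram map -/

/-- The `y`-parameters as functions of the coordinates. -/
def yOf (c : ℤ) (X : ℤ → ℝ) (a : ℤ) : ℝ :=
  if Even (a - c) then -(X a * X (a + 1))⁻¹ else -(X a * X (a + 1))

theorem y_eq_yOf {n : ℕ} (c : ℤ) (A : PolygonSpace n) : y c A = yOf c (x c A) := rfl

theorem yOf_ne_zero {X : ℤ → ℝ} (hX : ∀ a, X a ≠ 0) (c a : ℤ) : yOf c X a ≠ 0 := by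
  have := mul_ne_zero (hX a) (hX (a + 1))
  rw [yOf]
  split_ifs
  · exact neg_ne_zero.2 (inv_ne_zero this)
  · exact neg_ne_zero.2 this

/-- The monomial factor of the coordinates of the `k`-th iterate. -/
def iterMono (c : ℤ) (X : ℤ → ℝ) : ℕ → ℤ → ℝ
  | 0, a => X a
  | k + 1, a =>
    if Even (a - (c + k + 1)) then
      iterMono c X k (a - 1) * (rayVal (yOf c X) k (a + 1) / rayVal (yOf c X) k (a - 3))
    else iterMono c X k (a + 1) * (rayVal (yOf c X) k (a - 2) / rayVal (yOf c X) k (a + 2))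

/-- The numerator of the coordinates of the `k`-th iterate. -/
def iterNum (c : ℤ) (X : ℤ → ℝ) (k : ℕ) (a : ℤ) : ℝ :=
  if Even (a - (c + k)) then
    iterMono c X k a * (octaVal (yOf c X) (k + 1) (a - 3) * octaVal (yOf c X) k (a + 2))
  else iterMono c X k a * (octaVal (yOf c X) (k + 1) (a + 2) * octaVal (yOf c X) k (a - 3))

/-- The denominator of the coordinates of the `k`-th iterate. -/
def iterDen (c : ℤ) (X : ℤ → ℝ) (k : ℕ) (a : ℤ) : ℝ :=
  if Even (a - (c + k)) then octaVal (yOf c X) (k + 1) (a + 1) * octaVal (yOf c X) k (a - 2)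
  else octaVal (yOf c X) (k + 1) (a - 2) * octaVal (yOf c X) k (a + 1)

section

variable {c : ℤ} {X : ℤ → ℝ}

theorem iterMono_ne_zero (hX : ∀ a, X a ≠ 0) (k : ℕ) (a : ℤ) : iterMono c X k a ≠ 0 := by
  have h := fun k j => rayVal_ne_zero (yOf_ne_zero hX c) k j
  induction k generalizing a with
  | zero => exact hX a
  | succ k ih =>
    rw [iterMono]
    split_ifs
    · exact mul_ne_zero (ih _) (div_ne_zero (h _ _) (h _ _))
    · exact mul_ne_zero (ih _) (div_ne_zero (h _ _) (h _ _))

/-- The value of `rayVal` at `k - 1`, extended to `k = 0`. -/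
def rayPred (η : ℤ → ℝ) : ℕ → ℤ → ℝ
  | 0, j => (η j)⁻¹
  | k + 1, j => rayVal η k j

theorem rayPred_ne_zero {η : ℤ → ℝ} (h : ∀ i, η i ≠ 0) (k : ℕ) (j : ℤ) : rayPred η k j ≠ 0 := by
  cases k with
  | zero => exact inv_ne_zero (h j)
  | succ k => exact rayVal_ne_zero h k j

theorem rayVal_mul_rayVal_eq {η : ℤ → ℝ} (h : ∀ i, η i ≠ 0) (k : ℕ) (j : ℤ) :
    rayVal η k (j - 3) * rayVal η k (j + 3) = rayVal η (k + 1) j * rayPred η k j := by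
  cases k with
  | zero =>
    have := h j
    rw [rayVal_succ, rayVal_zero, rayVal_zero, rayVal_zero, rayPred]
    simp only [Nat.cast_zero, zero_add, mul_one]
    field_simp
  | succ k => exact rayVal_mul_rayVal ..

/-- These are the monomial parts of the y-parameters of `T^k`: `ray k` on one parity and the inverse
of `ray (k - 1)` on the other. In the induction one parity is carried over from level `k`; the other
combines three neighbouring products with the row identity. -/
theorem iterMono_mul_iterMono (hX : ∀ a, X a ≠ 0) (k : ℕ) (j : ℤ) :
    iterMono c X k j * iterMono c X k (j + 1) =
      if Even (j - (c + k)) then -(rayVal (yOf c X) k j)⁻¹ else -(rayPred (yOf c X) k j)⁻¹ := by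
  have hr := fun k j => rayVal_ne_zero (yOf_ne_zero hX c) k j
  induction k generalizing j with
  | zero =>
    rw [iterMono, iterMono, rayVal_zero, rayPred, inv_inv, Nat.cast_zero, add_zero, yOf]
    split_ifs
    · rw [inv_neg, inv_inv, neg_neg]
    · rw [neg_neg]
  | succ k ih =>
    by_cases he : Even (j - (c + k + 1))
    · have h₁ : ¬ Even (j + 1 - (c + k + 1)) := by grind
      have hm : iterMono c X k (j - 1) * iterMono c X k (j + 2) *
          (rayVal (yOf c X) k (j - 1) * rayVal (yOf c X) k (j + 1)) =
            -rayPred (yOf c X) k j := by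
        have i₁ := ih (j - 1)
        have i₂ := ih j
        have i₃ := ih (j + 1)
        rw [if_pos (by grind), sub_add_cancel] at i₁
        rw [if_neg (by grind)] at i₂
        rw [if_pos (by grind), add_assoc, one_add_one_eq_two] at i₃
        have m₁ := iterMono_ne_zero (c := c) hX k j
        have m₂ := iterMono_ne_zero (c := c) hX k (j + 1)
        have r₁ := hr k (j - 1)
        have r₂ := hr k (j + 1)
        have r₃ := rayPred_ne_zero (yOf_ne_zero hX c) k j
        have e : iterMono c X k (j - 1) * iterMono c X k (j + 2) *
            (iterMono c X k j * iterMono c X k (j + 1)) =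
            (rayVal (yOf c X) k (j - 1) * rayVal (yOf c X) k (j + 1))⁻¹ := by
          rw [mul_inv, ← neg_mul_neg (rayVal (yOf c X) k (j - 1))⁻¹, ← i₁, ← i₃]; ring
        rw [i₂] at e
        field_simp at e ⊢
        linear_combination -e
      rw [iterMono, iterMono, if_pos he, if_neg h₁, if_pos (by push_cast; rwa [← add_assoc])]
      have := rayVal_mul_rayVal_eq (yOf_ne_zero hX c) k j
      rw [show j + 1 + 1 = j + 2 by ring, show j + 1 - 2 = j - 1 by ring,
        show j + 1 + 2 = j + 3 by ring]
      have r₁ := hr k (j - 3)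
      have r₂ := hr k (j + 3)
      have r₃ := hr (k + 1) j
      field_simp
      linear_combination rayVal (yOf c X) (k + 1) j * hm + this
    · have h₁ : Even (j + 1 - (c + k + 1)) := by grind
      have i₁ := ih j
      rw [if_pos (by grind)] at i₁
      rw [iterMono, iterMono, if_neg he, if_pos h₁, if_neg (by push_cast; rwa [← add_assoc]),
        add_sub_cancel_right, show j + 1 + 1 = j + 2 by ring, show j + 1 - 3 = j - 2 by ring,
        rayPred, ← i₁]
      have r₁ := hr k (j - 2)
      have r₂ := hr k (j + 2)
      field_simp

/-- Here the recurrence meets the geometry: the monomials contribute `-1 / ray`, so `1 - x_j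
x_{j+1}` is the right side of the recurrence divided by its second term. -/
theorem stepU_iter (hX : ∀ a, X a ≠ 0) (k : ℕ)
    (h₁ : ∀ j, Even (j - (c + k + 1)) → octaVal (yOf c X) (k + 1) j ≠ 0)
    (h₀ : ∀ j, Even (j - (c + k)) → octaVal (yOf c X) k j ≠ 0) (j : ℤ) (hj : Even (j - (c + k))) :
    stepU (fun a => iterNum c X k a / iterDen c X k a) j =
      octaVal (yOf c X) (k + 2) j * octaVal (yOf c X) k j /
        (rayVal (yOf c X) k j *
          (octaVal (yOf c X) (k + 1) (j - 1) * octaVal (yOf c X) (k + 1) (j + 1))) := by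
  have hj' : ¬ Even (j + 1 - (c + k)) := by grind
  have hm := iterMono_mul_iterMono (c := c) hX k j
  have hr := rayVal_ne_zero (yOf_ne_zero hX c) k j
  rw [if_pos hj] at hm
  have n₁ := h₁ (j - 1) (by grind)
  have n₂ := h₁ (j + 1) (by grind)
  have n₃ := h₀ (j - 2) (by grind)
  have n₄ := h₀ (j + 2) (by grind)
  rw [stepU, iterNum, iterNum, iterDen, iterDen, if_pos hj, if_pos hj, if_neg hj', if_neg hj',
    octaVal_mul_octaVal, show j + 1 + 2 = j + 3 by ring, show j + 1 - 3 = j - 2 by ring,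
    show j + 1 - 2 = j - 1 by ring, show j + 1 + 1 = j + 2 by ring]
  have hm' : iterMono c X k j * iterMono c X k (j + 1) * rayVal (yOf c X) k j = -1 := by
    rw [hm]; field_simp
  field_simp
  linear_combination -(octaVal (yOf c X) (k + 1) (j - 3) * octaVal (yOf c X) (k + 1) (j + 3)) * hm'

/-- After inserting `stepU_iter` twice, the values of level `k` cancel and only the levels `k + 1`
and `k + 2` remain. -/
theorem pentStep_iter (hX : ∀ a, X a ≠ 0) (k : ℕ)
    (h₂ : ∀ j, Even (j - (c + k)) → octaVal (yOf c X) (k + 2) j ≠ 0)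
    (h₁ : ∀ j, Even (j - (c + k + 1)) → octaVal (yOf c X) (k + 1) j ≠ 0)
    (h₀ : ∀ j, Even (j - (c + k)) → octaVal (yOf c X) k j ≠ 0) (a : ℤ) :
    pentStep (c + k) (fun a => iterNum c X k a / iterDen c X k a) a =
      iterNum c X (k + 1) a / iterDen c X (k + 1) a := by
  have hr := fun j => rayVal_ne_zero (yOf_ne_zero hX c) k j
  have hs := stepU_iter hX k h₁ h₀
  by_cases he : Even (a - (c + k + 1))
  · have e₁ : Even (a - 1 - (c + k)) := by grind
    have e₂ : Even (a - (c + (k + 1 : ℕ))) := by push_cast; rwa [← add_assoc]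
    rw [pentStep, if_pos he, hs (a - 3) (by grind), hs (a + 1) (by grind), iterNum, iterDen,
      iterNum, iterDen, if_pos e₁, if_pos e₁, if_pos e₂, if_pos e₂, iterMono, if_pos he,
      show a - 1 - 3 = a - 4 by ring, show a - 1 + 2 = a + 1 by ring, sub_add_cancel,
      show a - 1 - 2 = a - 3 by ring, show a - 3 - 1 = a - 4 by ring,
      show a - 3 + 1 = a - 2 by ring, add_sub_cancel_right, show a + 1 + 1 = a + 2 by ring]
    have n₁ := h₁ (a - 4) (by grind)
    have n₂ := h₁ (a - 2) (by grind)
    have n₃ := h₁ (a + 2) (by grind)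
    have n₄ := h₁ a (by grind)
    have n₅ := h₀ (a - 3) (by grind)
    have n₆ := h₀ (a + 1) (by grind)
    have n₇ := h₂ (a + 1) (by grind)
    have r₁ := hr (a - 3)
    have r₂ := hr (a + 1)
    field_simp
  · have e₁ : ¬ Even (a + 1 - (c + k)) := by grind
    have e₂ : ¬ Even (a - (c + (k + 1 : ℕ))) := by push_cast; rwa [← add_assoc]
    rw [pentStep, if_neg he, hs (a + 2) (by grind), hs (a - 2) (by grind), iterNum, iterDen,
      iterNum, iterDen, if_neg e₁, if_neg e₁, if_neg e₂, if_neg e₂, iterMono, if_neg he,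
      show a + 1 + 2 = a + 3 by ring, show a + 1 - 3 = a - 2 by ring,
      show a + 1 - 2 = a - 1 by ring, show a + 1 + 1 = a + 2 by ring,
      show a + 2 - 1 = a + 1 by ring, show a + 2 + 1 = a + 3 by ring,
      show a - 2 - 1 = a - 3 by ring, show a - 2 + 1 = a - 1 by ring]
    have n₁ := h₁ (a + 3) (by grind)
    have n₂ := h₁ (a + 1) (by grind)
    have n₃ := h₁ (a - 3) (by grind)
    have n₄ := h₁ (a - 1) (by grind)
    have n₅ := h₀ (a - 2) (by grind)
    have n₆ := h₀ (a + 2) (by grind)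
    have n₇ := h₂ (a - 2) (by grind)
    have r₁ := hr (a - 2)
    have r₂ := hr (a + 2)
    field_simp

end

/-- All polynomials obstructing the existence of the `k`-th iterate are nonzero. -/
def IterNonzero (c : ℤ) (X : ℤ → ℝ) (k : ℕ) : Prop :=
  ∀ l ≤ k + 1, ∀ j, Even (j - (c + l)) → octaVal (yOf c X) l j ≠ 0

theorem x_zero_eq_iter (c : ℤ) (X : ℤ → ℝ) : X = fun a => iterNum c X 0 a / iterDen c X 0 a := by
  funext a
  simp [iterNum, iterDen, iterMono, octaVal_zero, octaVal_one]

theorem IterNonzero.iter {c : ℤ} {X : ℤ → ℝ} {k : ℕ} (h : IterNonzero c X k) :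
    (∀ j, Even (j - (c + k + 1)) → octaVal (yOf c X) (k + 1) j ≠ 0) ∧
      ∀ j, Even (j - (c + k)) → octaVal (yOf c X) k j ≠ 0 :=
  ⟨fun j hj => h (k + 1) le_rfl j (by push_cast; rwa [← add_assoc]),
    fun j hj => h k (Nat.le_succ k) j hj⟩

theorem IsPentIter.iterNonzero_and_x {n : ℕ} (c : ℤ) {k : ℕ} {A B : PolygonSpace n}
    (h : IsPentIter k A B) : IterNonzero c (x c A) k ∧
      x (c + k) B = fun a => iterNum c (x c A) k a / iterDen c (x c A) k a := by
  have hX := x_ne_zero c A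
  induction k generalizing B with
  | zero =>
    obtain rfl : A = B := h
    refine ⟨?_, ?_⟩
    · intro l hl j _
      interval_cases l
      · rw [octaVal_zero]; exact one_ne_zero
      · rw [octaVal_one]; exact one_ne_zero
    · rw [Nat.cast_zero, add_zero]
      exact x_zero_eq_iter c _
  | succ k ih =>
    obtain ⟨C, hC, hB⟩ := h
    obtain ⟨i₁, i₂⟩ := ih hC
    obtain ⟨p₁, p₂⟩ := isPent_stepU_ne_zero_and_x (c + k) hB
    rw [i₂] at p₁ p₂
    have h₂ : ∀ j, Even (j - (c + k)) → octaVal (yOf c (x c A)) (k + 2) j ≠ 0 := by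
      intro j hj
      have := p₁ j hj
      rw [stepU_iter hX k i₁.iter.1 i₁.iter.2 j hj] at this
      exact left_ne_zero_of_mul (div_ne_zero_iff.1 this).1
    refine ⟨?_, ?_⟩
    · intro l hl j hj
      rcases hl.eq_or_lt with rfl | hl
      · exact h₂ j (by push_cast at hj; grind)
      · exact i₁ l (by omega) j hj
    · rw [Nat.cast_add, Nat.cast_one, ← add_assoc, p₂]
      funext a
      exact pentStep_iter hX k h₂ i₁.iter.1 i₁.iter.2 a

theorem IterNonzero.exists_isPentIter {n : ℕ} {c : ℤ} {k : ℕ} {A : PolygonSpace n}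
    (h : IterNonzero c (x c A) k) : ∃ B, IsPentIter k A B := by
  induction k with
  | zero => exact ⟨A, rfl⟩
  | succ k ih =>
    have h' : IterNonzero c (x c A) k := fun l hl => h l (by omega)
    obtain ⟨C, hC⟩ := ih h'
    have hx := (hC.iterNonzero_and_x c).2
    obtain ⟨B, hB⟩ := exists_isPent (c + k) C (by
      intro j hj
      have hX := x_ne_zero c A
      rw [hx, stepU_iter hX k h'.iter.1 h'.iter.2 j hj]
      exact div_ne_zero (mul_ne_zero (h (k + 2) le_rfl j (by push_cast; grind))
        (h'.iter.2 j hj)) (mul_ne_zero (rayVal_ne_zero (yOf_ne_zero hX c) k j)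
        (mul_ne_zero (h'.iter.1 _ (by grind)) (h'.iter.1 _ (by grind)))))
    exact ⟨B, C, hC, hB⟩

/-! ### Regular functions on the torus -/

/-- Functions on the torus of sequences without zeros, given by rational functions whose
denominators have no zero on the torus. -/
def IsRegularFn (φ : (ℤ → ℝ) → ℝ) : Prop :=
  ∃ P Q : MvPolynomial ℤ ℝ, ∀ X : ℤ → ℝ, (∀ a, X a ≠ 0) →
    MvPolynomial.eval X Q ≠ 0 ∧ φ X * MvPolynomial.eval X Q = MvPolynomial.eval X P

namespace IsRegularFn

variable {φ ψ : (ℤ → ℝ) → ℝ}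

theorem eval (p : MvPolynomial ℤ ℝ) : IsRegularFn fun X => MvPolynomial.eval X p :=
  ⟨p, 1, fun X _ => by simp⟩

theorem const (r : ℝ) : IsRegularFn fun _ => r := by
  simpa using eval (MvPolynomial.C r)

theorem coord (a : ℤ) : IsRegularFn fun X => X a := by
  simpa using eval (MvPolynomial.X a)

theorem add (h : IsRegularFn φ) (h' : IsRegularFn ψ) : IsRegularFn fun X => φ X + ψ X := by
  obtain ⟨P, Q, h⟩ := h
  obtain ⟨P', Q', h'⟩ := h'
  refine ⟨P * Q' + P' * Q, Q * Q', fun X hX => ?_⟩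
  obtain ⟨h₁, h₂⟩ := h X hX
  obtain ⟨h₃, h₄⟩ := h' X hX
  simp only [map_mul, map_add, ← h₂, ← h₄]
  exact ⟨mul_ne_zero h₁ h₃, by ring⟩

theorem mul (h : IsRegularFn φ) (h' : IsRegularFn ψ) : IsRegularFn fun X => φ X * ψ X := by
  obtain ⟨P, Q, h⟩ := h
  obtain ⟨P', Q', h'⟩ := h'
  refine ⟨P * P', Q * Q', fun X hX => ?_⟩
  obtain ⟨h₁, h₂⟩ := h X hX
  obtain ⟨h₃, h₄⟩ := h' X hX
  simp only [map_mul, ← h₂, ← h₄]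
  exact ⟨mul_ne_zero h₁ h₃, by ring⟩

theorem neg (h : IsRegularFn φ) : IsRegularFn fun X => -φ X := by
  simpa using (const (-1)).mul h

theorem sub (h : IsRegularFn φ) (h' : IsRegularFn ψ) : IsRegularFn fun X => φ X - ψ X := by
  simpa [sub_eq_add_neg] using h.add h'.neg

theorem inv (h : IsRegularFn φ) (h₀ : ∀ X : ℤ → ℝ, (∀ a, X a ≠ 0) → φ X ≠ 0) :
    IsRegularFn fun X => (φ X)⁻¹ := by
  obtain ⟨P, Q, h⟩ := h
  refine ⟨Q, P, fun X hX => ?_⟩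
  obtain ⟨h₁, h₂⟩ := h X hX
  rw [← h₂]
  exact ⟨mul_ne_zero (h₀ X hX) h₁, inv_mul_cancel_left₀ (h₀ X hX) _⟩

theorem congr (h : IsRegularFn φ) (h' : ∀ X : ℤ → ℝ, (∀ a, X a ≠ 0) → ψ X = φ X) :
    IsRegularFn ψ := by
  obtain ⟨P, Q, h⟩ := h
  exact ⟨P, Q, fun X hX => by rw [h' X hX]; exact h X hX⟩

theorem prod {ι : Type*} (s : Finset ι) {f : ι → (ℤ → ℝ) → ℝ} (h : ∀ i ∈ s, IsRegularFn (f i)) :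
    IsRegularFn fun X => ∏ i ∈ s, f i X := by
  classical
  induction s using Finset.induction_on with
  | empty => simpa using const 1
  | insert i s hi ih =>
    refine ((h i (Finset.mem_insert_self i s)).mul
      (ih fun j hj => h j (Finset.mem_insert_of_mem hj))).congr fun X _ => ?_
    rw [Finset.prod_insert hi]

theorem eval_comp {σ : Type*} (p : MvPolynomial σ ℝ) {f : (ℤ → ℝ) → σ → ℝ}
    (h : ∀ i, IsRegularFn fun X => f X i) :
    IsRegularFn fun X => MvPolynomial.eval (f X) p := by
  induction p using MvPolynomial.induction_on with
  | C r => simpa using const r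
  | add p q hp hq => simpa using hp.add hq
  | mul_X p i hp => simpa using hp.mul (h i)

theorem comp (h : IsRegularFn φ) {f : (ℤ → ℝ) → ℤ → ℝ} (hf : ∀ i, IsRegularFn fun X => f X i)
    (h₀ : ∀ X : ℤ → ℝ, (∀ a, X a ≠ 0) → ∀ a, f X a ≠ 0) : IsRegularFn fun X => φ (f X) := by
  obtain ⟨P, Q, h⟩ := h
  refine ((eval_comp P hf).mul ((eval_comp Q hf).inv fun X hX => (h _ (h₀ X hX)).1)).congr
    fun X hX => ?_
  obtain ⟨h₁, h₂⟩ := h _ (h₀ X hX)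
  rw [← h₂, mul_inv_cancel_right₀ h₁]

theorem yOf (c a : ℤ) : IsRegularFn fun X => yOf c X a := by
  have h := (coord a).mul (coord (a + 1))
  by_cases he : Even (a - c)
  · simp only [Pentagram.yOf, if_pos he]
    exact (h.inv fun X hX => mul_ne_zero (hX _) (hX _)).neg
  · simp only [Pentagram.yOf, if_neg he]
    exact h.neg

theorem octaVal (c : ℤ) (k : ℕ) (j : ℤ) : IsRegularFn fun X => octaVal (Pentagram.yOf c X) k j :=
  eval_comp _ fun _ => yOf c _

theorem rayVal (c : ℤ) (k : ℕ) (j : ℤ) : IsRegularFn fun X => rayVal (Pentagram.yOf c X) k j :=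
  eval_comp _ fun _ => yOf c _

theorem iterMono (c : ℤ) (k : ℕ) (a : ℤ) : IsRegularFn fun X => iterMono c X k a := by
  have hr : ∀ k j j', IsRegularFn fun X => Pentagram.rayVal (Pentagram.yOf c X) k j /
      Pentagram.rayVal (Pentagram.yOf c X) k j' := fun k j j' => by
    simp only [div_eq_mul_inv]
    exact (rayVal c k j).mul
      ((rayVal c k j').inv fun X hX => rayVal_ne_zero (yOf_ne_zero hX c) k j')
  induction k generalizing a with
  | zero => exact coord a
  | succ k ih =>
    simp only [Pentagram.iterMono]
    split_ifs
    · exact (ih _).mul (hr _ _ _)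
    · exact (ih _).mul (hr _ _ _)

theorem iterNum (c : ℤ) (k : ℕ) (a : ℤ) : IsRegularFn fun X => iterNum c X k a := by
  simp only [Pentagram.iterNum]
  split_ifs
  · exact (iterMono _ _ _).mul ((octaVal _ _ _).mul (octaVal _ _ _))
  · exact (iterMono _ _ _).mul ((octaVal _ _ _).mul (octaVal _ _ _))

theorem iterDen (c : ℤ) (k : ℕ) (a : ℤ) : IsRegularFn fun X => iterDen c X k a := by
  simp only [Pentagram.iterDen]
  split_ifs
  · exact (octaVal _ _ _).mul (octaVal _ _ _)
  · exact (octaVal _ _ _).mul (octaVal _ _ _)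

end IsRegularFn

/-! ### Subtori -/

/-- The coordinates of the twisted `n`-gons with `x_a x_{a+1} = 1` for `a ∈ Z`. -/
def subtorus (n : ℕ) (Z : Set ℤ) : Set (ℤ → ℝ) :=
  {X | (∀ a, X a ≠ 0) ∧ (∀ a, X (a + 2 * n) = X a) ∧ ∀ a ∈ Z, X a * X (a + 1) = 1}

/-- The translates of a set by the multiples of `2 * n`. -/
def periodize (n : ℕ) (Z : Set ℤ) : Set ℤ := {a | ∃ z ∈ Z, ∃ l : ℤ, a = z + 2 * n * l}

theorem even_sub_of_mem_periodize {n : ℕ} {Z : Set ℤ} {c : ℤ} (hZ : ∀ a ∈ Z, Even (a - c)) {a : ℤ}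
    (h : a ∈ periodize n Z) : Even (a - c) := by
  obtain ⟨z, hz, l, rfl⟩ := h
  obtain ⟨r, hr⟩ := hZ z hz
  exact ⟨r + n * l, by linear_combination hr⟩

theorem periodic_add_mul {α : Type*} {f : ℤ → α} {d : ℤ} (h : ∀ a, f (a + d) = f a) (a l : ℤ) :
    f (a + d * l) = f a := by
  have : Function.Periodic f d := h
  rw [mul_comm]
  exact this.int_mul l a

theorem periodic_emod {α : Type*} {f : ℤ → α} {d : ℤ} (h : ∀ a, f (a + d) = f a) (a : ℤ) :
    f (a % d) = f a := by
  rw [← periodic_add_mul h (a % d) (a / d), Int.emod_add_mul_ediv]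

open Classical in
/-- A retraction of the torus to `subtorus n Z`. -/
def retract (n : ℕ) (Z : Set ℤ) (X : ℤ → ℝ) (a : ℤ) : ℝ :=
  if a - 1 ∈ periodize n Z then (X ((a - 1) % (2 * n)))⁻¹ else X (a % (2 * n))

theorem retract_ne_zero (n : ℕ) (Z : Set ℤ) (X : ℤ → ℝ) (hX : ∀ a, X a ≠ 0) (a : ℤ) :
    retract n Z X a ≠ 0 := by
  rw [retract]
  split_ifs
  · exact inv_ne_zero (hX _)
  · exact hX _

theorem isRegularFn_retract (n : ℕ) (Z : Set ℤ) (a : ℤ) :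
    IsRegularFn fun X => retract n Z X a := by
  by_cases h : a - 1 ∈ periodize n Z
  · simp only [retract, if_pos h]
    exact (IsRegularFn.coord _).inv fun X hX => hX _
  · simp only [retract, if_neg h]
    exact IsRegularFn.coord _

theorem mem_periodize_add (n : ℕ) (Z : Set ℤ) (a : ℤ) :
    a + 2 * n ∈ periodize n Z ↔ a ∈ periodize n Z := by
  constructor
  · rintro ⟨z, hz, l, h⟩
    exact ⟨z, hz, l - 1, by linear_combination h⟩
  · rintro ⟨z, hz, l, h⟩
    exact ⟨z, hz, l + 1, by linear_combination h⟩

theorem subset_periodize (n : ℕ) (Z : Set ℤ) : Z ⊆ periodize n Z :=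
  fun z hz => ⟨z, hz, 0, by ring⟩

theorem mul_eq_one_of_mem_periodize {n : ℕ} {Z : Set ℤ} {X : ℤ → ℝ} (hX : X ∈ subtorus n Z) {a : ℤ}
    (ha : a ∈ periodize n Z) : X a * X (a + 1) = 1 := by
  obtain ⟨z, hz, l, rfl⟩ := ha
  rw [add_right_comm, periodic_add_mul hX.2.1, periodic_add_mul hX.2.1, hX.2.2 z hz]

/-- As `Z` lies in one parity class and the period is even, the pairs `a, a + 1` are disjoint, and
each relation can be solved for the second coordinate. -/
theorem retract_mem {n : ℕ} {Z : Set ℤ} {c : ℤ} (hZ : ∀ a ∈ Z, Even (a - c)) {X : ℤ → ℝ}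
    (hX : ∀ a, X a ≠ 0) : retract n Z X ∈ subtorus n Z := by
  refine ⟨retract_ne_zero n Z X hX, fun a => ?_, fun a ha => ?_⟩
  · rw [retract, retract, add_sub_right_comm, mem_periodize_add, Int.add_emod_right,
      Int.add_emod_right]
  · have h₁ : a - 1 ∉ periodize n Z := fun h => by
      have h₁ := even_sub_of_mem_periodize hZ h
      have h₂ := hZ a ha
      grind
    rw [retract, retract, if_neg h₁, add_sub_cancel_right, if_pos (subset_periodize n Z ha),
      mul_inv_cancel₀ (hX _)]

theorem retract_eq {n : ℕ} {Z : Set ℤ} {X : ℤ → ℝ} (hX : X ∈ subtorus n Z) :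
    retract n Z X = X := by
  funext a
  rw [retract, periodic_emod hX.2.1, periodic_emod hX.2.1]
  split_ifs with h
  · have := mul_eq_one_of_mem_periodize hX h
    rw [sub_add_cancel] at this
    exact inv_eq_of_mul_eq_one_right this
  · rfl

/-- A function does not vanish identically on a subtorus. -/
def NeZeroOn (n : ℕ) (Z : Set ℤ) (φ : (ℤ → ℝ) → ℝ) : Prop := ∃ X ∈ subtorus n Z, φ X ≠ 0

/-- Subtori are irreducible. -/
theorem NeZeroOn.mul {n : ℕ} {Z : Set ℤ} {c : ℤ} (hZ : ∀ a ∈ Z, Even (a - c))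
    {φ ψ : (ℤ → ℝ) → ℝ} (hφ : IsRegularFn φ) (hψ : IsRegularFn ψ) (h : NeZeroOn n Z φ)
    (h' : NeZeroOn n Z ψ) : NeZeroOn n Z fun X => φ X * ψ X := by
  -- Pulled back along the retraction, both functions are rational on the full torus, where nonzero
  -- polynomials have a nonzero product.
  obtain ⟨P, Q, hP⟩ := hφ.comp (isRegularFn_retract n Z) (retract_ne_zero n Z)
  obtain ⟨P', Q', hP'⟩ := hψ.comp (isRegularFn_retract n Z) (retract_ne_zero n Z)
  obtain ⟨X, hX, hX'⟩ := h
  obtain ⟨Y, hY, hY'⟩ := h'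
  have n₁ : P ≠ 0 := by
    rintro rfl
    obtain ⟨h₁, h₂⟩ := hP X hX.1
    simp only [retract_eq hX, map_zero] at h₂
    exact mul_ne_zero hX' h₁ h₂
  have n₂ : P' ≠ 0 := by
    rintro rfl
    obtain ⟨h₁, h₂⟩ := hP' Y hY.1
    simp only [retract_eq hY, map_zero] at h₂
    exact mul_ne_zero hY' h₁ h₂
  obtain ⟨t, ht, ht'⟩ := MvPolynomial_exists_eval_ne_zero (mul_ne_zero n₁ n₂)
  rw [map_mul, ← (hP t ht).2, ← (hP' t ht).2] at ht'
  exact ⟨retract n Z t, retract_mem hZ ht,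
    mul_ne_zero (left_ne_zero_of_mul (left_ne_zero_of_mul ht'))
      (left_ne_zero_of_mul (right_ne_zero_of_mul ht'))⟩

theorem NeZeroOn.prod {n : ℕ} {Z : Set ℤ} {c : ℤ} (hZ : ∀ a ∈ Z, Even (a - c)) {ι : Type*}
    (s : Finset ι) {f : ι → (ℤ → ℝ) → ℝ} (hf : ∀ i ∈ s, IsRegularFn (f i))
    (h : ∀ i ∈ s, NeZeroOn n Z (f i)) : NeZeroOn n Z fun X => ∏ i ∈ s, f i X := by
  classical
  induction s using Finset.induction_on with
  | empty =>
    exact ⟨retract n Z 1, retract_mem hZ (X := 1) (fun _ => one_ne_zero), by simp⟩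
  | insert i s hi ih =>
    have := NeZeroOn.mul hZ (hf i (Finset.mem_insert_self i s))
      (IsRegularFn.prod s fun j hj => hf j (Finset.mem_insert_of_mem hj))
      (h i (Finset.mem_insert_self i s))
      (ih (fun j hj => hf j (Finset.mem_insert_of_mem hj))
        fun j hj => h j (Finset.mem_insert_of_mem hj))
    simpa only [Finset.prod_insert hi] using this

/-! ### Points with prescribed parameters -/

theorem exists_yOf_eq {η : ℤ → ℝ} (hη : ∀ a, η a ≠ 0) (c : ℤ) :
    ∃ W : ℤ → ℝ, (∀ a, W a ≠ 0) ∧ yOf c W = η := by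
  obtain ⟨Q, -, hQ⟩ := exists_int_seq_mul fun a => Units.mk0 (-η a) (neg_ne_zero.2 (hη a))
  have hQ' : ∀ a, (Q (a + 1) : ℝ) = Q a * -η a := fun a => by rw [hQ]; rfl
  have h0 : ∀ a, (Q a : ℝ) ≠ 0 := fun a => (Q a).ne_zero
  refine ⟨fun a => if Even (a - c) then (Q a : ℝ) else (Q a : ℝ)⁻¹, fun a => ?_, ?_⟩
  · dsimp only
    split_ifs
    · exact h0 a
    · exact inv_ne_zero (h0 a)
  · funext a
    have h₁ := h0 a
    have h₂ := hη a
    by_cases h : Even (a - c)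
    · have h' : ¬ Even (a + 1 - c) := by grind
      rw [yOf, if_pos h, if_pos h, if_neg h', hQ']
      field_simp
    · have h' : Even (a + 1 - c) := by grind
      rw [yOf, if_neg h, if_neg h, if_pos h', hQ']
      field_simp

theorem yOf_add_two_mul {n : ℕ} {c : ℤ} {X : ℤ → ℝ} (hX : ∀ a, X (a + 2 * n) = X a) (a : ℤ) :
    yOf c X (a + 2 * n) = yOf c X a := by
  have : Even (a + 2 * n - c) ↔ Even (a - c) := by
    rw [add_sub_right_comm, Int.even_add]
    simp
  simp only [yOf, this, add_right_comm a _ 1, hX]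

theorem octaVal_add_two_mul {n : ℕ} {c : ℤ} {X : ℤ → ℝ} (hX : ∀ a, X (a + 2 * n) = X a) (k : ℕ)
    (a : ℤ) : octaVal (yOf c X) k (a + 2 * n) = octaVal (yOf c X) k a := by
  rw [← octaVal_shift]
  simp only [yOf_add_two_mul hX]

theorem yOf_eq_neg_one_iff {c : ℤ} {X : ℤ → ℝ} {a : ℤ} :
    yOf c X a = -1 ↔ X a * X (a + 1) = 1 := by
  rw [yOf]
  split_ifs
  · rw [neg_inj, inv_eq_one]
  · rw [neg_inj]

/-- For `k ≥ 1` the value at `j` depends on y-parameters at distance at most `3k - 3`, that is, on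
`6k - 4` consecutive coordinates. The bound on `k` says that these fit into one period, so a window
of a nonperiodic solution `W` can be repeated periodically. -/
theorem neZeroOn_octaVal {n : ℕ} {Z : Set ℤ} {c : ℤ} (hZ : ∀ a ∈ Z, Even (a - c)) {k : ℕ} {j : ℤ}
    (hj : Even (j - (c + k + 1))) (hk : 3 * k < n + 3) {η : ℤ → ℝ} (hη : ∀ a, η a ≠ 0)
    (hηZ : ∀ a ∈ periodize n Z, η a = -1) (h : octaVal η (k + 1) j ≠ 0) :
    NeZeroOn n Z fun X => octaVal (yOf c X) (k + 1) j := by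
  obtain ⟨W, hW, rfl⟩ := exists_yOf_eq hη c
  rcases Nat.eq_zero_or_pos k with rfl | hk0
  · exact ⟨retract n Z 1, retract_mem hZ (X := 1) (fun _ => one_ne_zero), by
      simp [octaVal_one]⟩
  have hn : 0 < (2 * n : ℤ) := by omega
  let s : ℤ := j - 3 * (k - 1)
  let X : ℤ → ℝ := fun a => W (s + (a - s) % (2 * n))
  have hper : ∀ a, X (a + 2 * n) = X a := fun a => by
    simp only [X, add_sub_right_comm, Int.add_emod_right]
  have hXW : ∀ a, s ≤ a → a < s + 2 * n → X a = W a := by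
    intro a h₁ h₂
    simp only [X]
    rw [Int.emod_eq_of_lt (by omega) (by omega), add_sub_cancel]
  have hyW : ∀ a, s ≤ a → a + 1 < s + 2 * n → yOf c X a = yOf c W a := by
    intro a h₁ h₂
    rw [yOf, yOf, hXW a h₁ (by omega), hXW (a + 1) (by omega) h₂]
  have hs : Even (s - c) := by
    obtain ⟨r, hr⟩ := hj
    exact ⟨r - k + 2, by simp only [s]; omega⟩
  refine ⟨X, ⟨fun a => hW _, hper, fun a ha => ?_⟩, ?_⟩
  · rw [← yOf_eq_neg_one_iff (c := c), ← periodic_add_mul (yOf_add_two_mul hper) a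
      (-((a - s) / (2 * n)))]
    have hb : a + 2 * n * (-((a - s) / (2 * n))) = s + (a - s) % (2 * n) := by
      have := Int.emod_add_mul_ediv (a - s) (2 * n)
      linear_combination -this
    have hmem : a + 2 * n * (-((a - s) / (2 * n))) ∈ periodize n Z := ⟨a, ha, _, rfl⟩
    have hev := even_sub_of_mem_periodize hZ hmem
    rw [← hηZ _ hmem]
    rw [hb] at hev ⊢
    have h₁ := Int.emod_nonneg (a - s) hn.ne'
    have h₂ := Int.emod_lt_of_pos (a - s) hn
    -- The last index of the window has the wrong parity for `Z`, so no prescribed pair of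
    -- coordinates straddles its end.
    refine hyW _ (by omega) ?_
    rcases hev with ⟨u, hu⟩
    rcases hs with ⟨v, hv⟩
    omega
  · dsimp only
    rwa [octaVal_congr (θ := yOf c W)]
    intro i hi
    have := abs_le.1 (by omega : |i - j| ≤ 3 * k - 3)
    push_cast at hi
    exact hyW i (by simp only [s]; omega) (by simp only [s]; omega)

/-! ### Rational expressions for the iterates -/

theorem rayVal_pos {η : ℤ → ℝ} (hη : ∀ a, 0 < η a) (k : ℕ) (j : ℤ) : 0 < rayVal η k j := by
  induction k with
  | zero => rw [rayVal_zero]; exact hη j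
  | succ k ih => rw [rayVal_succ]; exact mul_pos (mul_pos (hη _) ih) (hη _)

theorem octaVal_pos {η : ℤ → ℝ} (hη : ∀ a, 0 < η a) (k : ℕ) (j : ℤ) : 0 < octaVal η k j := by
  induction k using Nat.twoStepInduction generalizing j with
  | zero => rw [octaVal_zero]; exact one_pos
  | one => rw [octaVal_one]; exact one_pos
  | more k h₀ h₁ =>
    refine pos_of_mul_pos_left (?_ : 0 < _ * octaVal η k j) (h₀ j).le
    rw [octaVal_mul_octaVal]
    exact add_pos (mul_pos (h₁ _) (h₁ _))
      (mul_pos (rayVal_pos hη _ _) (mul_pos (h₁ _) (h₁ _)))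

/-- Alternating signs make all y-parameters equal to 1, and the recurrence preserves positivity. -/
theorem neZeroOn_empty_octaVal (n : ℕ) (c : ℤ) (k : ℕ) (j : ℤ) :
    NeZeroOn n ∅ fun X => octaVal (yOf c X) k j := by
  let X : ℤ → ℝ := fun a => if Even a then 1 else -1
  have hX : ∀ a, X a * X (a + 1) = -1 := by
    intro a
    by_cases h : Even a
    · simp [X, h]
    · simp [X, h]
  refine ⟨X, ⟨fun a => ?_, fun a => ?_, fun a ha => ha.elim⟩, ?_⟩
  · simp only [X]; split_ifs <;> norm_num
  · have : Even (a + 2 * n) ↔ Even a := by rw [Int.even_add]; simp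
    simp only [X, this]
  · refine (octaVal_pos (fun a => ?_) k j).ne'
    rw [yOf, hX]
    split_ifs <;> norm_num

theorem mem_subtorus_empty {n : ℕ} (c : ℤ) (A : PolygonSpace n) : x c A ∈ subtorus n ∅ :=
  ⟨x_ne_zero c A, x_add_two_mul c A, fun _ h => h.elim⟩

theorem subtorus_subset_empty (n : ℕ) (Z : Set ℤ) : subtorus n Z ⊆ subtorus n ∅ :=
  fun _ h => ⟨h.1, h.2.1, fun _ h => h.elim⟩

theorem neZeroOn_eval {n : ℕ} {Z : Set ℤ} {c : ℤ} {A : PolygonSpace n}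
    (hA : x c A ∈ subtorus n Z) {p : MvPolynomial ℤ ℝ} (h : MvPolynomial.eval (x c A) p ≠ 0) :
    NeZeroOn n Z fun X => MvPolynomial.eval X p := ⟨x c A, hA, h⟩

theorem iterDen_ne_zero {c : ℤ} {X : ℤ → ℝ} {k : ℕ}
    (h₁ : ∀ j, Even (j - (c + k + 1)) → octaVal (yOf c X) (k + 1) j ≠ 0)
    (h₀ : ∀ j, Even (j - (c + k)) → octaVal (yOf c X) k j ≠ 0) (a : ℤ) : iterDen c X k a ≠ 0 := by
  rw [iterDen]
  split_ifs
  · exact mul_ne_zero (h₁ _ (by grind)) (h₀ _ (by grind))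
  · exact mul_ne_zero (h₁ _ (by grind)) (h₀ _ (by grind))

theorem iterNum_ne_zero {c : ℤ} {X : ℤ → ℝ} {k : ℕ} (hX : ∀ a, X a ≠ 0)
    (h₁ : ∀ j, Even (j - (c + k + 1)) → octaVal (yOf c X) (k + 1) j ≠ 0)
    (h₀ : ∀ j, Even (j - (c + k)) → octaVal (yOf c X) k j ≠ 0) (a : ℤ) : iterNum c X k a ≠ 0 := by
  rw [iterNum]
  split_ifs
  · exact mul_ne_zero (iterMono_ne_zero hX k a)
      (mul_ne_zero (h₁ _ (by grind)) (h₀ _ (by grind)))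
  · exact mul_ne_zero (iterMono_ne_zero hX k a)
      (mul_ne_zero (h₁ _ (by grind)) (h₀ _ (by grind)))

/-- A regular value of an iterate satisfies, on the whole torus, the cross-multiplied formula for
the coordinates of the iterate. -/
theorem IsRegularWithValue.exists_eval {n : ℕ} (hn : 0 < n) {c : ℤ} {k : ℕ} {A B : PolygonSpace n}
    (h : IsRegularWithValue c k A B) (a : ℤ) :
    ∃ p q : MvPolynomial ℤ ℝ, MvPolynomial.eval (x c A) p ≠ 0 ∧ MvPolynomial.eval (x c A) q ≠ 0 ∧
      x (c + k) B a = MvPolynomial.eval (x c A) p / MvPolynomial.eval (x c A) q ∧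
      ∀ X ∈ subtorus n ∅, MvPolynomial.eval X p * iterDen c X k a =
        MvPolynomial.eval X q * iterNum c X k a := by
  obtain ⟨p, q, hq, hpq, hB⟩ := h a
  refine ⟨p, q, fun hp => x_ne_zero (c + k) B a (by rw [hB, hp, zero_div]), hq, hB, ?_⟩
  -- If the identity failed somewhere, then by irreducibility it would fail at a point where `q` and
  -- all `octa` values over a period and up to level `k + 1` are nonzero. Such a point is a polygon
  -- with all iterates up to `k` defined, where the identity holds by definition.
  by_contra! hne
  obtain ⟨X₀, hX₀, hne⟩ := hne
  have hc : ∀ a ∈ (∅ : Set ℤ), Even (a - c) := fun _ h => h.elim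
  have hφ : IsRegularFn fun X => MvPolynomial.eval X p * iterDen c X k a -
      MvPolynomial.eval X q * iterNum c X k a :=
    ((IsRegularFn.eval p).mul (IsRegularFn.iterDen c k a)).sub
      ((IsRegularFn.eval q).mul (IsRegularFn.iterNum c k a))
  obtain ⟨X, hX, hXne⟩ := NeZeroOn.mul hc
    (hφ.mul (IsRegularFn.eval q)) (IsRegularFn.prod (Finset.range (k + 2) ×ˢ Finset.range (2 * n))
      fun i _ => IsRegularFn.octaVal c i.1 i.2)
    (NeZeroOn.mul hc hφ (IsRegularFn.eval q) ⟨X₀, hX₀, sub_ne_zero.2 hne⟩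
      (neZeroOn_eval (mem_subtorus_empty c A) hq))
    (NeZeroOn.prod hc _ (fun i _ => IsRegularFn.octaVal c i.1 i.2)
      fun i _ => neZeroOn_empty_octaVal n c i.1 i.2)
  have hprod := Finset.prod_ne_zero_iff.1 (right_ne_zero_of_mul hXne)
  have hX₁ := right_ne_zero_of_mul (left_ne_zero_of_mul hXne)
  have hX₂ := left_ne_zero_of_mul (left_ne_zero_of_mul hXne)
  obtain ⟨A', rfl⟩ := exists_polygon c X hX.1 hX.2.1
  have hnz : IterNonzero c (x c A') k := by
    intro l hl j _
    have hpos : 0 < (2 * n : ℤ) := by omega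
    rw [← periodic_emod (octaVal_add_two_mul hX.2.1 l) j]
    have h₁ := Int.emod_nonneg j hpos.ne'
    have h₂ := Int.emod_lt_of_pos j hpos
    have := hprod (l, (j % (2 * n)).toNat)
      (Finset.mk_mem_product (Finset.mem_range.2 (by omega)) (Finset.mem_range.2 (by omega)))
    simpa only [Int.toNat_of_nonneg h₁] using this
  obtain ⟨B', hB'⟩ := hnz.exists_isPentIter
  have e₁ := hpq A' B' hB' hX₁
  rw [(hB'.iterNonzero_and_x c).2, div_eq_div_iff (iterDen_ne_zero hnz.iter.1 hnz.iter.2 a) hX₁]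
    at e₁
  apply hX₂
  linear_combination -e₁

theorem iterMono_add_two_mul {n : ℕ} {c : ℤ} {X : ℤ → ℝ} (hX : ∀ a, X (a + 2 * n) = X a) (k : ℕ)
    (a : ℤ) : iterMono c X k (a + 2 * n) = iterMono c X k a := by
  have hr : ∀ k j, rayVal (yOf c X) k (j + 2 * n) = rayVal (yOf c X) k j := by
    intro k
    induction k with
    | zero => intro j; rw [rayVal_zero, rayVal_zero, yOf_add_two_mul hX]
    | succ k ih =>
      intro j
      rw [rayVal_succ, rayVal_succ, ih, add_right_comm j, add_sub_right_comm, yOf_add_two_mul hX,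
        yOf_add_two_mul hX]
  induction k generalizing a with
  | zero => exact hX a
  | succ k ih =>
    have he : Even (a - (c + k + 1) + 2 * n) ↔ Even (a - (c + k + 1)) := by
      rw [Int.even_add]; simp
    simp only [iterMono, he, add_sub_right_comm a (2 * n : ℤ), add_right_comm a (2 * n : ℤ), hr, ih]

theorem iterNum_add_two_mul {n : ℕ} {c : ℤ} {X : ℤ → ℝ} (hX : ∀ a, X (a + 2 * n) = X a) (k : ℕ)
    (a : ℤ) : iterNum c X k (a + 2 * n) = iterNum c X k a := by
  have he : Even (a - (c + k) + 2 * n) ↔ Even (a - (c + k)) := by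
    rw [Int.even_add]; simp
  simp only [iterNum, he, add_sub_right_comm a (2 * n : ℤ), add_right_comm a (2 * n : ℤ),
    octaVal_add_two_mul hX, iterMono_add_two_mul hX]

theorem iterDen_add_two_mul {n : ℕ} {c : ℤ} {X : ℤ → ℝ} (hX : ∀ a, X (a + 2 * n) = X a) (k : ℕ)
    (a : ℤ) : iterDen c X k (a + 2 * n) = iterDen c X k a := by
  have he : Even (a - (c + k) + 2 * n) ↔ Even (a - (c + k)) := by
    rw [Int.even_add]; simp
  simp only [iterDen, he, add_sub_right_comm a (2 * n : ℤ), add_right_comm a (2 * n : ℤ),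
    octaVal_add_two_mul hX]

/-- The `k`-th iterate is nonsingular where the polynomials of the last two levels do not
vanish. -/
theorem exists_isRegularWithValue {n : ℕ} {c : ℤ} {k : ℕ} {A : PolygonSpace n}
    (h₁ : ∀ j, Even (j - (c + k + 1)) → octaVal (yOf c (x c A)) (k + 1) j ≠ 0)
    (h₀ : ∀ j, Even (j - (c + k)) → octaVal (yOf c (x c A)) k j ≠ 0) :
    ∃ B, IsRegularWithValue c k A B := by
  -- Lower levels have cancelled from the formula and may vanish at `A`, so `T^k` can be regular
  -- although intermediate iterates do not exist.
  have hN := iterNum_ne_zero (x_ne_zero c A) h₁ h₀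
  have hD := iterDen_ne_zero h₁ h₀
  obtain ⟨B, hB⟩ := exists_polygon (n := n) (c + k)
    (fun a => iterNum c (x c A) k a / iterDen c (x c A) k a) (fun a => div_ne_zero (hN a) (hD a))
    (fun a => by
      simp only [iterNum_add_two_mul (x_add_two_mul c A), iterDen_add_two_mul (x_add_two_mul c A)])
  refine ⟨B, fun a => ?_⟩
  obtain ⟨P, Q, hP⟩ := IsRegularFn.iterNum c k a
  obtain ⟨P', Q', hP'⟩ := IsRegularFn.iterDen c k a
  have key : ∀ A : PolygonSpace n, iterNum c (x c A) k a / iterDen c (x c A) k a =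
      MvPolynomial.eval (x c A) (P * Q') / MvPolynomial.eval (x c A) (P' * Q) := by
    intro A
    obtain ⟨q₁, e₁⟩ := hP (x c A) (x_ne_zero c A)
    obtain ⟨q₂, e₂⟩ := hP' (x c A) (x_ne_zero c A)
    rw [map_mul, map_mul, ← e₁, ← e₂, ← mul_div_mul_right _ _ (mul_ne_zero q₁ q₂)]
    congr 1 <;> ring
  refine ⟨P * Q', P' * Q, ?_, ?_, ?_⟩
  · rw [map_mul, ← (hP' _ (x_ne_zero c A)).2]
    exact mul_ne_zero (mul_ne_zero (hD a) (hP' _ (x_ne_zero c A)).1) (hP _ (x_ne_zero c A)).1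
  · intro A' B' h _
    exact (congrFun (h.iterNonzero_and_x c).2 a).trans (key A')
  · exact (congrFun hB a).trans (key A)

/-! ### The singularity pattern -/

/-- The `m` sites at distance two from each other and centered at `o`. -/
def zeroSites (o : ℤ) (m : ℕ) : Set ℤ := {a | ∃ t : ℕ, t < m ∧ a = o - m + 1 + 2 * t}

section

variable {n m : ℕ} {o c : ℤ}

theorem even_of_mem_zeroSites (ho : Even (o - m + 1 - c)) : ∀ a ∈ zeroSites o m, Even (a - c) := by
  rintro a ⟨t, -, rfl⟩
  obtain ⟨r, hr⟩ := ho
  exact ⟨r + t, by linear_combination hr⟩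

theorem yOf_eq_neg_one_of_mem {X : ℤ → ℝ} (hX : X ∈ subtorus n (zeroSites o m)) {a : ℤ} {t : ℕ}
    (ht : t < m) (ha : a = o + m - 1 - 2 * t) : yOf c X a = -1 := by
  rw [yOf_eq_neg_one_iff]
  refine hX.2.2 a ⟨m - 1 - t, by omega, ?_⟩
  subst ha
  have : ((m - 1 - t : ℕ) : ℤ) = m - 1 - t := by omega
  rw [this]
  ring

/-- The extreme line `u = k - 1` corresponds to the last `k` sites of the run. -/
theorem octaVal_eq_zero_of_mem {X : ℤ → ℝ} (hX : X ∈ subtorus n (zeroSites o m)) {k : ℕ}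
    (hk : 1 ≤ k) (hkm : k ≤ m) {a : ℤ} (ha : a = o + m + k - 2) :
    octaVal (yOf c X) (k + 1) a = 0 := by
  refine octaVal_eq_zero k (k - 1) (by omega) a fun t ht => ?_
  refine yOf_eq_neg_one_of_mem hX (t := t) (by omega) ?_
  omega

/-- On level `m + 1` a line uses the entire run, and each of the `m` lines through the support gives
one zero. The resulting indices are those of `Y_S`. -/
theorem octaVal_eq_zero_of_mem_level {X : ℤ → ℝ} (hX : X ∈ subtorus n (zeroSites o m)) {t : ℕ}
    (ht : t < m) {a : ℤ} (ha : a = o - 2 * (m - 1) + 4 * t) :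
    octaVal (yOf c X) (m + 1) a = 0 := by
  refine octaVal_eq_zero m t ht a fun s hs => ?_
  refine yOf_eq_neg_one_of_mem hX (t := s) hs ?_
  omega

theorem int_mul_trichotomy (n L : ℤ) (hn : 0 ≤ n) : n * L ≤ -n ∨ n * L = 0 ∨ n ≤ n * L := by
  rcases lt_trichotomy L 0 with h | h | h
  · exact Or.inl (by nlinarith)
  · exact Or.inr (Or.inl (by rw [h, mul_zero]))
  · exact Or.inr (Or.inr (by nlinarith))

theorem notMem_periodize_of_gap {a : ℤ} (h₁ : o + m - 1 < a) (h₂ : a < o - m + 1 + 2 * n) :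
    a ∉ periodize n (zeroSites o m) := by
  rintro ⟨z, ⟨t, ht, rfl⟩, l, rfl⟩
  rcases int_mul_trichotomy (2 * n) l (by omega) with h | h | h <;> omega

theorem neZeroOn_octaVal_of_gap (ho : Even (o - m + 1 - c)) {k : ℕ} {j : ℤ}
    (hj : Even (j - (c + k + 1))) (hk : 3 * k < n + 3) (h₁ : o + m + k - 2 < j)
    (h₂ : j + k + m < o + 2 + 2 * n) :
    NeZeroOn n (zeroSites o m) fun X => octaVal (yOf c X) (k + 1) j := by
  have hZ := even_of_mem_zeroSites ho
  obtain ⟨η, h, h', h''⟩ := exists_octaVal_ne_zero_of_antidiagonal (periodize n (zeroSites o m)) k j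
    (fun i hi => notMem_periodize_of_gap (by omega) (by omega))
    (fun z hz => by
      have := even_sub_of_mem_periodize hZ hz
      grind)
  exact neZeroOn_octaVal hZ hj hk h h' h''

/-- Write indices as `j + 3k - 3 - 2e`. The run occupies `t ≤ e ≤ t + m - 1` modulo `n`, while the
blocks of `exists_octaVal_ne_zero` occupy `r - 1 ≤ e ≤ 2r - 2` and `k + 2r - 1 ≤ e ≤ 2k + r - 2`.
The hole between them has length `k`, and `r = ⌈t/2⌉` places the run in it; the rounding costs one
place, hence `k ≥ m + 1`. For `t > 2k` the choice `r = k` leaves only the first block, which ends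
before the run. -/
theorem neZeroOn_octaVal_of_level (ho : Even (o - m + 1 - c)) (hn : 3 * m + 4 ≤ n) {k : ℕ} {j : ℤ}
    (hj : Even (j - (c + k + 1))) (hk : m + 1 ≤ k) (hk' : k ≤ m + 2) :
    NeZeroOn n (zeroSites o m) fun X => octaVal (yOf c X) (k + 1) j := by
  have hZ := even_of_mem_zeroSites ho
  have hpar : Even (j + 3 * k - 3 - o - m + 1) := by
    rcases ho with ⟨u, hu⟩
    rcases hj with ⟨v, hv⟩
    exact ⟨v + 2 * k - u - m, by omega⟩
  obtain ⟨s, hs⟩ := hpar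
  obtain ⟨t, L, ht, htL⟩ : ∃ (t : ℕ) (L : ℤ), t < n ∧ s = t + n * L := by
    have hn0 : (0 : ℤ) < n := by omega
    refine ⟨(s % n).toNat, s / n, ?_, ?_⟩
    · have := Int.emod_lt_of_pos s hn0
      have := Int.emod_nonneg s hn0.ne'
      omega
    · rw [Int.toNat_of_nonneg (Int.emod_nonneg s hn0.ne'), Int.emod_add_mul_ediv]
  have hgap : ∀ e : ℤ, ((t : ℤ) + m - 1 - n < e ∧ e < t) ∨ ((t : ℤ) + m - 1 < e ∧ e < t + n) →
      j + 3 * k - 3 - 2 * e ∉ periodize n (zeroSites o m) := by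
    rintro e he ⟨z, ⟨u, hu, rfl⟩, l, hl⟩
    have h₁ : e = t + (m - 1 - u) + n * (L - l) := by
      linarith [mul_sub (n : ℤ) L l]
    rcases int_mul_trichotomy n (L - l) (by omega) with h | h | h <;> omega
  have hpar' : ∀ z ∈ periodize n (zeroSites o m), Even (z + j + k + 1) := fun z hz => by
    have := even_sub_of_mem_periodize hZ hz
    grind
  rcases le_or_gt t (2 * k) with htk | htk
  · obtain ⟨η, h, h', h''⟩ := exists_octaVal_ne_zero (periodize n (zeroSites o m)) k ((t + 1) / 2)
      (by omega) j hpar'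
      (fun i hi => by
        have := hgap ((t + 1) / 2 - 1 + i) (Or.inl (by omega))
        convert this using 2
        push_cast
        ring)
      (fun i hi => by
        have := hgap (k + 2 * ((t + 1) / 2) - 1 + i) (Or.inr (by omega))
        convert this using 2
        push_cast
        ring)
    exact neZeroOn_octaVal hZ hj (by omega) h h' h''
  · obtain ⟨η, h, h', h''⟩ := exists_octaVal_ne_zero (periodize n (zeroSites o m)) k k le_rfl j
      hpar'
      (fun i hi => by
        have := hgap (k - 1 + i) (Or.inl (by omega))
        convert this using 2
        ring)
      (fun i hi => by omega)
    exact neZeroOn_octaVal hZ hj (by omega) h h' h''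

/-! ### Singular iterates, generic regularity and the final locus -/

/-- On the subtorus a factor of the numerator is identically zero and the denominator is not.
Cross-multiplication then makes `p` vanish on the subtorus, contrary to its nonzero value at `A`. -/
theorem isSingularAt_of_le (ho : Even (o - m + 1 - c)) (hn : 3 * m + 4 ≤ n) {k : ℕ}
    (hk : 1 ≤ k) (hkm : k ≤ m) {A : PolygonSpace n} (hA : x c A ∈ subtorus n (zeroSites o m)) :
    IsSingularAt c k A := by
  rintro ⟨B, hB⟩
  have hZ := even_of_mem_zeroSites ho
  have he : Even (o + m + k + 1 - (c + k)) := by grind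
  obtain ⟨p, q, hp, -, -, hpq⟩ := hB.exists_eval (by omega) (o + m + k + 1)
  obtain ⟨l, rfl⟩ := Nat.exists_eq_add_of_le' hk
  obtain ⟨X, hX, hX'⟩ := NeZeroOn.mul hZ (IsRegularFn.eval p)
    ((IsRegularFn.octaVal c _ _).mul (IsRegularFn.octaVal c _ _))
    (neZeroOn_eval hA hp)
    (NeZeroOn.mul hZ (IsRegularFn.octaVal c _ _) (IsRegularFn.octaVal c _ _)
      (neZeroOn_octaVal_of_gap ho (k := l + 1) (j := o + m + (l + 1 : ℕ) + 1 + 1) (by grind)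
        (by omega) (by omega) (by omega))
      (neZeroOn_octaVal_of_gap ho (k := l) (j := o + m + (l + 1 : ℕ) + 1 - 2)
        (by push_cast; grind) (by omega) (by omega) (by omega)))
  have := hpq X (subtorus_subset_empty _ _ hX)
  rw [iterDen, if_pos he, iterNum, if_pos he,
    octaVal_eq_zero_of_mem (a := o + m + (l + 1 : ℕ) + 1 - 3) hX hk hkm (by ring), zero_mul,
    mul_zero, mul_zero] at this
  exact hX' this

/-- The zero of level `m + 1` has moved to the denominator, while the numerator is not identically
zero. Now `q` is forced to vanish on the subtorus, contrary to its value at `A`. -/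
theorem isSingularAt_succ (ho : Even (o - m + 1 - c)) (hm : 1 ≤ m) (hn : 3 * m + 4 ≤ n)
    {A : PolygonSpace n} (hA : x c A ∈ subtorus n (zeroSites o m)) :
    IsSingularAt c (m + 1) A := by
  rintro ⟨B, hB⟩
  have hZ := even_of_mem_zeroSites ho
  have he : Even (o + 2 * m - (c + (m + 1 : ℕ))) := by push_cast; grind
  obtain ⟨p, q, -, hq, -, hpq⟩ := hB.exists_eval (by omega) (o + 2 * m)
  obtain ⟨X, hX, hX'⟩ := NeZeroOn.mul hZ (IsRegularFn.eval q)
    ((IsRegularFn.octaVal c _ _).mul (IsRegularFn.octaVal c _ _))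
    (neZeroOn_eval hA hq)
    (NeZeroOn.mul hZ (IsRegularFn.octaVal c _ _) (IsRegularFn.octaVal c _ _)
      (neZeroOn_octaVal_of_level ho hn (k := m + 1) (j := o + 2 * m - 3) (by push_cast; grind)
        le_rfl (by omega))
      (neZeroOn_octaVal_of_gap ho (k := m) (j := o + 2 * m + 2) (by grind) (by omega) (by omega)
        (by omega)))
  have := hpq X (subtorus_subset_empty _ _ hX)
  rw [iterDen, if_pos he, iterNum, if_pos he,
    octaVal_eq_zero_of_mem (a := o + 2 * m - 2) (k := m) hX hm le_rfl (by ring), mul_zero,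
    mul_zero, eq_comm, mul_left_comm] at this
  exact hX' ((mul_eq_zero.1 this).resolve_left (iterMono_ne_zero hX.1 _ _))

theorem exists_generic_polynomial (ho : Even (o - m + 1 - c)) (hn : 3 * m + 4 ≤ n) :
    ∃ g : MvPolynomial ℤ ℝ,
      (∀ A : PolygonSpace n, MvPolynomial.eval (x c A) g ≠ 0 → ¬ IsSingularAt c (m + 2) A) ∧
      ∀ f : MvPolynomial ℤ ℝ,
        NeZeroOn n (zeroSites o m) (fun X => MvPolynomial.eval X f) →
        NeZeroOn n (zeroSites o m) fun X => MvPolynomial.eval X f * MvPolynomial.eval X g := by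
  have hZ := even_of_mem_zeroSites ho
  -- By periodicity one period of indices suffices; the filter keeps the parity that occurs in the
  -- formulas.
  let s : Finset (ℕ × ℕ) := (({m + 1, m + 2} : Finset ℕ) ×ˢ Finset.range (2 * n)).filter
    fun i => Even ((i.2 : ℤ) - (c + i.1 + 1))
  have hreg : ∀ i ∈ s, IsRegularFn fun X => octaVal (yOf c X) (i.1 + 1) i.2 :=
    fun i _ => IsRegularFn.octaVal c _ _
  have hne : ∀ i ∈ s, NeZeroOn n (zeroSites o m) fun X => octaVal (yOf c X) (i.1 + 1) i.2 := by
    intro i hi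
    simp only [s, Finset.mem_filter, Finset.mem_product, Finset.mem_insert,
      Finset.mem_singleton] at hi
    exact neZeroOn_octaVal_of_level ho hn hi.2 (by omega) (by omega)
  obtain ⟨g, q, hg⟩ := IsRegularFn.prod s hreg
  refine ⟨g, fun A hA => ?_, fun f hf => ?_⟩
  · rw [← (hg _ (x_ne_zero c A)).2] at hA
    have hprod := Finset.prod_ne_zero_iff.1 (left_ne_zero_of_mul hA)
    have key : ∀ k : ℕ, k = m + 1 ∨ k = m + 2 → ∀ j, Even (j - (c + k + 1)) →
        octaVal (yOf c (x c A)) (k + 1) j ≠ 0 := by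
      intro k hk j hj
      have hpos : 0 < (2 * n : ℤ) := by omega
      have h₁ := Int.emod_nonneg j hpos.ne'
      have h₂ := Int.emod_lt_of_pos j hpos
      have h₃ := Int.emod_add_mul_ediv j (2 * n)
      rw [← periodic_emod (octaVal_add_two_mul (x_add_two_mul c A) (k + 1)) j]
      have := hprod (k, (j % (2 * n)).toNat) (by
        simp only [s, Finset.mem_filter, Finset.mem_product, Finset.mem_insert,
          Finset.mem_singleton, Finset.mem_range, Int.toNat_of_nonneg h₁]
        refine ⟨⟨hk, by omega⟩, ?_⟩
        obtain ⟨r, hr⟩ := hj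
        exact ⟨r - n * (j / (2 * n)), by linear_combination hr + h₃⟩)
      simpa only [Int.toNat_of_nonneg h₁] using this
    refine not_not.2 (exists_isRegularWithValue (fun j hj => key (m + 2) (Or.inr rfl) j hj)
      fun j hj => key (m + 1) (Or.inl rfl) j ?_)
    push_cast at hj ⊢
    convert hj using 2
    ring
  · obtain ⟨X, hX, hX'⟩ := NeZeroOn.mul hZ (IsRegularFn.eval f) (IsRegularFn.prod s hreg) hf
      (NeZeroOn.prod hZ s hreg hne)
    refine ⟨X, hX, ?_⟩
    dsimp only at hX' ⊢
    rw [← (hg X hX.1).2]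
    exact mul_ne_zero (left_ne_zero_of_mul hX')
      (mul_ne_zero (right_ne_zero_of_mul hX') (hg X hX.1).1)

theorem x_mul_x_eq_one (ho : Even (o - m + 1 - c)) (hn : 3 * m + 4 ≤ n)
    {A B : PolygonSpace n} (hA : x c A ∈ subtorus n (zeroSites o m))
    (hB : IsRegularWithValue c (m + 2) A B) {t : ℕ} (ht : t < m) {a : ℤ}
    (ha : a = o - 2 * (m - 1) + 4 * t) :
    x (c + (m + 2 : ℕ)) B a * x (c + (m + 2 : ℕ)) B (a + 1) = 1 := by
  have hZ := even_of_mem_zeroSites ho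
  have hc : ∀ a ∈ (∅ : Set ℤ), Even (a - c) := fun _ h => h.elim
  have he : ¬ Even (a - (c + (m + 2 : ℕ))) := by subst ha; push_cast; grind
  have he' : Even (a + 1 - (c + (m + 2 : ℕ))) := by grind
  obtain ⟨p, q, -, hq, hx, hpq⟩ := hB.exists_eval (by omega) a
  obtain ⟨p', q', -, hq', hx', hpq'⟩ := hB.exists_eval (by omega) (a + 1)
  set P : (ℤ → ℝ) → ℝ := fun X => MvPolynomial.eval X p * MvPolynomial.eval X p' with hP
  set Q : (ℤ → ℝ) → ℝ := fun X => MvPolynomial.eval X q * MvPolynomial.eval X q' with hQ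
  have rP : IsRegularFn P := (IsRegularFn.eval p).mul (IsRegularFn.eval p')
  have rQ : IsRegularFn Q := (IsRegularFn.eval q).mul (IsRegularFn.eval q')
  -- Multiplying the relations for `a` and `a + 1` produces common factors of level `m + 3`. They
  -- are cancelled on the full torus, and the remaining identity is then restricted to the subtorus.
  have key : ∀ X ∈ subtorus n ∅,
      P X * rayVal (yOf c X) (m + 1) a *
        (octaVal (yOf c X) (m + 2) (a - 1) * octaVal (yOf c X) (m + 2) (a + 1)) +
      Q X * (octaVal (yOf c X) (m + 2) (a - 3) * octaVal (yOf c X) (m + 2) (a + 3)) = 0 := by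
    by_contra! hne
    obtain ⟨X₀, hX₀, hne⟩ := hne
    have ro := fun k j => IsRegularFn.octaVal c k j
    obtain ⟨X, hX, hX'⟩ := NeZeroOn.mul hc
      (((rP.mul (IsRegularFn.rayVal c (m + 1) a)).mul ((ro (m + 2) (a - 1)).mul
        (ro (m + 2) (a + 1)))).add (rQ.mul ((ro (m + 2) (a - 3)).mul (ro (m + 2) (a + 3)))))
      ((ro (m + 3) (a - 2)).mul (ro (m + 3) (a + 2))) ⟨X₀, hX₀, hne⟩
      (NeZeroOn.mul hc (ro (m + 3) (a - 2)) (ro (m + 3) (a + 2))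
        (neZeroOn_empty_octaVal n c _ _) (neZeroOn_empty_octaVal n c _ _))
    apply hX'
    have e₁ := hpq X hX
    have e₂ := hpq' X hX
    have e₃ := iterMono_mul_iterMono (c := c) hX.1 (m + 2) a
    rw [if_neg he, rayPred] at e₃
    have hr := rayVal_ne_zero (yOf_ne_zero hX.1 c) (m + 1) a
    rw [iterDen, iterNum, if_neg he, if_neg he] at e₁
    rw [iterDen, iterNum, if_pos he', if_pos he', show a + 1 + 1 = a + 2 by ring,
      show a + 1 - 2 = a - 1 by ring, show a + 1 - 3 = a - 2 by ring,
      show a + 1 + 2 = a + 3 by ring] at e₂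
    have e₄ : iterMono c X (m + 2) a * iterMono c X (m + 2) (a + 1) *
        rayVal (yOf c X) (m + 1) a = -1 := by
      rw [e₃]; field_simp
    have e₅ := congrArg₂ (· * ·) e₁ e₂
    rw [hP, hQ]
    linear_combination rayVal (yOf c X) (m + 1) a * e₅ +
      MvPolynomial.eval X q * MvPolynomial.eval X q' *
        (octaVal (yOf c X) (m + 2) (a - 3) * octaVal (yOf c X) (m + 2) (a + 3)) *
        (octaVal (yOf c X) (m + 3) (a - 2) * octaVal (yOf c X) (m + 3) (a + 2)) * e₄
  have hPQ : P (x c A) = Q (x c A) := by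
    by_contra hne
    have n₁ : NeZeroOn n (zeroSites o m) fun X => octaVal (yOf c X) (m + 2) (a - 1) :=
      neZeroOn_octaVal_of_level ho hn (by subst ha; push_cast; grind) le_rfl (by omega)
    have n₂ : NeZeroOn n (zeroSites o m) fun X => octaVal (yOf c X) (m + 2) (a + 1) :=
      neZeroOn_octaVal_of_level ho hn (by subst ha; push_cast; grind) le_rfl (by omega)
    have ro := fun k j => IsRegularFn.octaVal c k j
    obtain ⟨X, hX, hX'⟩ := NeZeroOn.mul hZ (rP.sub rQ)
      ((ro (m + 2) (a - 1)).mul (ro (m + 2) (a + 1))) ⟨x c A, hA, sub_ne_zero.2 hne⟩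
      (NeZeroOn.mul hZ (ro _ _) (ro _ _) n₁ n₂)
    have e₁ := key X (subtorus_subset_empty _ _ hX)
    have e₂ := octaVal_mul_octaVal (yOf c X) (m + 1) a
    -- With the left side of the recurrence zero, its two terms are opposite, so `key` says that `P
    -- - Q` times generically nonzero factors vanishes.
    rw [octaVal_eq_zero_of_mem_level hX ht ha, mul_zero] at e₂
    have e₃ : rayVal (yOf c X) (m + 1) a * ((P X - Q X) *
        (octaVal (yOf c X) (m + 2) (a - 1) * octaVal (yOf c X) (m + 2) (a + 1))) = 0 := by
      linear_combination e₁ + Q X * e₂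
    exact hX' ((mul_eq_zero.1 e₃).resolve_left (rayVal_ne_zero (yOf_ne_zero hX.1 c) _ _))
  rw [hx, hx', div_mul_div_comm]
  exact (div_eq_one_iff_eq (mul_ne_zero hq hq')).2 hPQ

end

/-! ### The sets of indices -/

theorem half_mem_progression_iff (i : ℤ) (m : ℕ) (a : ℤ) :
    (a : ℚ) / 2 ∈ progression ((i : ℚ) - 1 / 2 * ((m : ℚ) - 1)) ((i : ℚ) + 1 / 2 * ((m : ℚ) - 1)) 1
      ↔ a ∈ zeroSites (2 * i) m := by
  constructor
  · rintro ⟨h, t, ht⟩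
    have e : a = 2 * i - m + 1 + 2 * t := by
      have : (a : ℚ) = ((2 * i - m + 1 + 2 * t : ℤ) : ℚ) := by push_cast; linarith
      exact_mod_cast this
    refine ⟨t, ?_, e⟩
    have : ((t : ℕ) : ℚ) ≤ m - 1 := by linarith
    have h' : (t : ℚ) + 1 ≤ m := by linarith
    exact_mod_cast h'
  · rintro ⟨t, ht, rfl⟩
    have : (t : ℚ) + 1 ≤ m := by exact_mod_cast ht
    refine ⟨?_, t, ?_⟩
    · push_cast; linarith
    · push_cast; ring

theorem exists_of_half_mem_progression (i : ℤ) {m : ℕ} {a : ℤ}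
    (h : (a : ℚ) / 2 ∈ progression ((i : ℚ) - ((m : ℚ) - 1)) ((i : ℚ) + ((m : ℚ) - 1)) 2) :
    ∃ t : ℕ, t < m ∧ a = 2 * i - 2 * (m - 1) + 4 * t := by
  obtain ⟨h, t, ht⟩ := h
  refine ⟨t, ?_, ?_⟩
  · have h' : (t : ℚ) + 1 ≤ m := by linarith
    exact_mod_cast h'
  · have : (a : ℚ) = ((2 * i - 2 * (m - 1) + 4 * t : ℤ) : ℚ) := by push_cast; linarith
    exact_mod_cast this

theorem mem_locus_iff {n : ℕ} (c i : ℤ) (m : ℕ) (A : PolygonSpace n) :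
    A ∈ locus c (progression ((i : ℚ) - 1 / 2 * ((m : ℚ) - 1))
      ((i : ℚ) + 1 / 2 * ((m : ℚ) - 1)) 1) ↔ x c A ∈ subtorus n (zeroSites (2 * i) m) := by
  simp only [locus, Set.mem_ofPred_eq, half_mem_progression_iff i m, y_eq_yOf,
    yOf_eq_neg_one_iff, subtorus]
  exact ⟨fun h => ⟨x_ne_zero c A, x_add_two_mul c A, h⟩, fun h => h.2.2⟩

end Pentagram

end

theorem mainTheorem2 (n : ℕ) (i : ℤ) (m : ℕ) (hm : 1 ≤ m) (hmn : (m : ℚ) < (n : ℚ) / 3 - 1)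
    (S S' : Set ℚ)
    (hS : S = Pentagram.progression ((i : ℚ) - ((m : ℚ) - 1)) ((i : ℚ) + ((m : ℚ) - 1)) 2)
    (hS' : S' = Pentagram.progression ((i : ℚ) - 1 / 2 * ((m : ℚ) - 1))
      ((i : ℚ) + 1 / 2 * ((m : ℚ) - 1)) 1)
    -- the polygons are indexed by that one of `ℤ` and `1/2 + ℤ` which contains `S'`
    (c : ℤ) (hc : ∀ j ∈ S', ∃ t : ℤ, j = (t : ℚ) + (c : ℚ) / 2) :
    (∀ k : ℕ, 1 ≤ k → k ≤ m + 1 →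
      ∀ A ∈ (Pentagram.locus c S' : Set (Pentagram.PolygonSpace n)),
        Pentagram.IsSingularAt c k A) ∧
    Pentagram.HoldsGenerically c (Pentagram.locus c S' : Set (Pentagram.PolygonSpace n))
      (fun A => ¬ Pentagram.IsSingularAt c (m + 2) A) ∧
    (∀ A ∈ (Pentagram.locus c S' : Set (Pentagram.PolygonSpace n)),
      ∀ B : Pentagram.PolygonSpace n, Pentagram.IsRegularWithValue c (m + 2) A B →
        B ∈ (Pentagram.locus (c + (m + 2 : ℕ)) S : Set (Pentagram.PolygonSpace n))) := by
  -- This is precisely the bound that `neZeroOn_octaVal` requires on the highest level, `k = m + 2`.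
  have hn : 3 * m + 4 ≤ n := by
    have h : (3 * m + 3 : ℚ) < n := by linarith
    have : 3 * m + 3 < n := by exact_mod_cast h
    omega
  subst hS hS'
  have hZ : ∀ A : Pentagram.PolygonSpace n, _ := Pentagram.mem_locus_iff c i m
  -- The smallest element of `S'`, present because `1 ≤ m`, determines the parity of the label `c`.
  have ho : Even (2 * i - m + 1 - c) := by
    have hmem : 2 * i - m + 1 ∈ Pentagram.zeroSites (2 * i) m := ⟨0, hm, by simp⟩
    obtain ⟨t, ht⟩ := hc _ ((Pentagram.half_mem_progression_iff i m _).2 hmem)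
    refine ⟨t, ?_⟩
    have : ((2 * i - m + 1 - c : ℤ) : ℚ) = ((t + t : ℤ) : ℚ) := by
      push_cast at ht ⊢; linarith
    exact_mod_cast this
  refine ⟨fun k hk hkm A hA => ?_, ?_, fun A hA B hB a ha => ?_⟩
  · rcases hkm.eq_or_lt with rfl | hkm
    · exact Pentagram.isSingularAt_succ ho hm hn ((hZ A).1 hA)
    · exact Pentagram.isSingularAt_of_le ho hn hk (by omega) ((hZ A).1 hA)
  · obtain ⟨g, hg, hg'⟩ := Pentagram.exists_generic_polynomial ho hn
    refine ⟨g, fun A _ hA => hg A hA, ?_⟩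
    rintro f ⟨A, hA, hfA⟩
    obtain ⟨X, hX, hX'⟩ := hg' f ⟨Pentagram.x c A, (hZ A).1 hA, hfA⟩
    obtain ⟨A', rfl⟩ := Pentagram.exists_polygon c X hX.1 hX.2.1
    exact ⟨A', (hZ A').2 hX, left_ne_zero_of_mul hX', right_ne_zero_of_mul hX'⟩
  · obtain ⟨t, ht, hta⟩ := Pentagram.exists_of_half_mem_progression i ha
    rw [Pentagram.y_eq_yOf, Pentagram.yOf_eq_neg_one_iff]
    exact Pentagram.x_mul_x_eq_one ho hn ((hZ A).1 hA) hB ht hta
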